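/- **Setting.** Let $(\Omega,\mathcal F,\mathbb P)$ be a probability space and $\mathbb X$ a complete separable metrizable space with Borel $\sigma$-algebra $\mathcal X$. Let $\alpha$ be a nonzero finite non-atomic measure on $\mathbb X$, and let $\rho(ds\mid x)$ be a measurable family of $\sigma$-finite measures on $(0,\infty)$ with $\rho((0,\infty)\mid x)=\infty$ for all $x$ and $\int_{\mathbb X}\int_0^\infty \min(s,1)\,\rho(ds\mid x)\,\alpha(dx)<\infty$. Let $\tilde N$ be a Poisson random measure on $(0,\infty)\times\mathbb X$ with intensity $\nu(ds,dx)=\rho(ds\mid x)\alpha(dx)$, put $\tilde\mu(A)=\int_0^\infty\int_A s\,\tilde N(ds,dx)$ and $T=\tilde\mu(\mathbb X)$, and let $P=\tilde\mu/T$ be the associated normalized random measure with independent increments (NRMI). Let $n\ge 1$ and let $\mathbf X=(X_1,\dots,X_n)$ be a sample from $P$, i.e. conditionally on $P$ the $X_i$ are i.i.d. with distribution $P$. Let $Y_1,\dots,Y_{n(\pi)}$ be the distinct values of $X_1,\dots,X_n$ and $n_j=\#\{i: X_i=Y_j\}$. For $A\in\mathcal X$, $u>0$, $y\in\mathbb X$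 and integers $k\ge 0$ put $$\tau_k(u,y)=\int_0^\infty s^k e^{-us}\rho(ds\mid y),\qquad \psi_A(u)=\int_0^\infty\!\!\int_A(1-e^{-us})\,\nu(ds,dx),\qquad V^{(k)}_{\alpha(A)}(u)=(-1)^k e^{\psi_A(u)}\frac{d^k}{du^k}e^{-\psi_A(u)},$$ and let $$f_{U_n|\mathbf X}(u\mid\mathbf X)=\frac{u^{n-1}e^{-\psi_{\mathbb X}(u)}\prod_{j=1}^{n(\pi)}\tau_{n_j}(u,Y_j)}{\int_0^\infty v^{n-1}e^{-\psi_{\mathbb X}(v)}\prod_{j=1}^{n(\pi)}\tau_{n_j}(v,Y_j)\,dv},\qquad u>0.$$ For nonnegative integers with $l_1+\dots+l_r\le m$ write $\binom{m}{l_1,\dots,l_r}=\dfrac{m!}{l_1!\cdots l_r!\,(m-l_1-\dots-l_r)!}$. Write $\delta_y(A)=1$ if $y\in A$ and $0$ otherwise, with $0^0=1$. **Claim.** Almost surely the denominator of $f_{U_n|\mathbf X}$ is finite and positive, and $f_{U_n|\mathbf X}(\cdot\mid\mathbf X)$ is the conditional density given $\mathbf X$ of the latent variable $U_n$, that is, of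 any random variable $U_n$ such that, conditionally on $\tilde\mu$, the variables $X_1,\dots,X_n,U_n$ are independent, each $X_i$ has distribution $P$, and $U_n$ has the gamma distribution with shape $n$ and rate $T$. Moreover, the integrals below converge absolutely almost surely, and the following identities hold almost surely. (i) For every $A\in\mathcal X$ and every integer $m\ge 0$, $$\mathbb E[P(A)^m\mid\mathbf X]=\frac{\Gamma(n)}{\Gamma(m+n)}\sum_{\substack{l_1,\dots,l_{n(\pi)}\ge 0\\ l_1+\dots+l_{n(\pi)}\le m}}\binom{m}{l_1,\dots,l_{n(\pi)}}\int_0^\infty u^m f_{U_n|\mathbf X}(u\mid\mathbf X)\,V^{(m-(l_1+\dots+l_{n(\pi)}))}_{\alpha(A)}(u)\prod_{j=1}^{n(\pi)}\left(\frac{\tau_{n_j+l_j}(u,Y_j)}{\tau_{n_j}(u,Y_j)}\,\delta_{Y_j}(A)^{l_j}\right)du .$$ (ii) For all pairwise disjoint $A_1,\dots,A_q\in\mathcal X$ and all integers $m_1,\dots,m_q\ge 0$, with $m=\sum_{i=1}^q m_i$, $A_{q+1}=(\bigcup_{i=1}^q A_i)^c$, $m_{q+1}=0$ and $\lambda_i=\{j:Y_j\in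 A_i\}$, $$\mathbb E\Big[\prod_{i=1}^q P(A_i)^{m_i}\,\Big|\,\mathbf X\Big]=\frac{\Gamma(n)}{\Gamma(m+n)}\int_0^\infty u^m f_{U_n|\mathbf X}(u\mid\mathbf X)\prod_{i=1}^{q+1}\left\{\sum_{\substack{(l_j)_{j\in\lambda_i},\ l_j\ge 0\\ \sum_{j\in\lambda_i}l_j\le m_i}}\binom{m_i}{(l_j)_{j\in\lambda_i}}V^{(m_i-\sum_{j\in\lambda_i}l_j)}_{\alpha(A_i)}(u)\prod_{j\in\lambda_i}\frac{\tau_{n_j+l_j}(u,Y_j)}{\tau_{n_j}(u,Y_j)}\right\}du .$$ -/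

import Mathlib

open MeasureTheory ProbabilityTheory Set
open scoped ENNReal NNReal Nat

noncomputable section

namespace NRMI

variable {Ω 𝕏 : Type*} [MeasurableSpace Ω] [MeasurableSpace 𝕏]

/-- The Poisson law with mean `r ∈ [0, ∞]`, on `[0, ∞]`; infinite mean gives the unit mass at `∞`. -/
def poissonLaw (r : ℝ≥0∞) : Measure ℝ≥0∞ :=
  if r = ∞ then Measure.dirac ∞
  else (poissonMeasure r.toNNReal).map (fun k : ℕ => (k : ℝ≥0∞))

/-- `N` is a Poisson random measure on `S` with intensity measure `ν`. -/
structure IsPoissonRandomMeasure {S : Type*} [MeasurableSpace S] (N : Ω → Measure S)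
    (ν : Measure S) (Pr : Measure Ω) : Prop where
  measurable : Measurable N
  law : ∀ B : Set S, MeasurableSet B → Pr.map (fun ω => N ω B) = poissonLaw (ν B)
  indep : ∀ (d : ℕ) (B : Fin d → Set S), (∀ i, MeasurableSet (B i)) →
    Pairwise (fun i j => Disjoint (B i) (B j)) → iIndepFun (fun i ω => N ω (B i)) Pr

/-- The intensity `ν(ds, dx) = ρ(ds | x) α(dx)` on `ℝ × 𝕏`. -/
def levyIntensity (α : Measure 𝕏) (ρ : Kernel 𝕏 ℝ) : Measure (ℝ × 𝕏) :=
  α.bind (fun x => (ρ x).map (fun s => (s, x)))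

/-- The random measure `μ(A) = ∫∫_A s N(ds, dx)`. -/
def crm (N : Ω → Measure (ℝ × 𝕏)) (ω : Ω) : Measure 𝕏 :=
  ((N ω).withDensity (fun p => ENNReal.ofReal p.1)).map Prod.snd

/-- The normalized random measure `P = μ / μ(𝕏)`. -/
def nrmi (N : Ω → Measure (ℝ × 𝕏)) (ω : Ω) : Measure 𝕏 :=
  (crm N ω univ)⁻¹ • crm N ω

/-- `X₁, …, Xₙ` is a sample from the random measure `P`: conditionally on `P`, the `Xᵢ` are
independent with distribution `P`. -/
structure IsSample {n : ℕ} (X : Fin n → Ω → 𝕏) (P : Ω → Measure 𝕏) (Pr : Measure Ω) : Prop where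
  measurable : ∀ i, Measurable (X i)
  condLaw : ∀ B : Fin n → Set 𝕏, (∀ i, MeasurableSet (B i)) →
    Pr[{ω | ∀ i, X i ω ∈ B i}.indicator (fun _ => (1 : ℝ)) | MeasurableSpace.comap P inferInstance]
      =ᵐ[Pr] fun ω => ∏ i, (P ω (B i)).toReal

/-- `U` is a latent variable for the sample `X`: conditionally on the random measure `μ = crm N`,
the variables `X₁, …, Xₙ, U` are independent, each `Xᵢ` has distribution `P = μ / T` and `U` has the
gamma distribution with shape `n` and rate `T`, where `T = μ(𝕏)`. -/
structure IsLatent {n : ℕ} (U : Ω → ℝ) (X : Fin n → Ω → 𝕏) (N : Ω → Measure (ℝ × 𝕏))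
    (Pr : Measure Ω) : Prop where
  measurable : Measurable U
  condLaw : ∀ (B : Fin n → Set 𝕏) (C : Set ℝ), (∀ i, MeasurableSet (B i)) → MeasurableSet C →
    Pr[{ω | (∀ i, X i ω ∈ B i) ∧ U ω ∈ C}.indicator (fun _ => (1 : ℝ)) |
        MeasurableSpace.comap (crm N) inferInstance]
      =ᵐ[Pr] fun ω => (∏ i, (nrmi N ω (B i)).toReal)
        * (gammaMeasure (n : ℝ) (crm N ω univ).toReal C).toReal

/-- The σ-algebra generated by the sample. -/
abbrev sampleSigma {n : ℕ} (X : Fin n → Ω → 𝕏) : MeasurableSpace Ω :=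
  MeasurableSpace.comap (fun ω i => X i ω) inferInstance

/-- `τ_k(u, y) = ∫ s^k e^{-us} ρ(ds | y)`. -/
def tau (ρ : Kernel 𝕏 ℝ) (k : ℕ) (u : ℝ) (y : 𝕏) : ℝ :=
  ∫ s, s ^ k * Real.exp (-(u * s)) ∂(ρ y)

/-- The Laplace exponent `ψ_A(t) = ∫∫_A (1 - e^{-ts}) ν(ds, dx)`. -/
def psi (α : Measure 𝕏) (ρ : Kernel 𝕏 ℝ) (A : Set 𝕏) (t : ℝ) : ℝ :=
  ∫ p in univ ×ˢ A, (1 - Real.exp (-(t * p.1))) ∂(levyIntensity α ρ)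

/-- `V_A^{(k)}(t) = (-1)^k e^{ψ_A(t)} (d/dt)^k e^{-ψ_A(t)}`. -/
def V (α : Measure 𝕏) (ρ : Kernel 𝕏 ℝ) (A : Set 𝕏) (k : ℕ) (t : ℝ) : ℝ :=
  (-1) ^ k * Real.exp (psi α ρ A t) * iteratedDeriv k (fun r => Real.exp (-psi α ρ A r)) t

open Classical in
/-- The set of distinct values of `x₁, …, xₙ`. -/
def distinct {n : ℕ} (x : Fin n → 𝕏) : Finset 𝕏 := Finset.univ.image x

open Classical in
/-- The number of indices `i` with `xᵢ = y`. -/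
def mult {n : ℕ} (x : Fin n → 𝕏) (y : 𝕏) : ℕ := (Finset.univ.filter (fun i => x i = y)).card

/-- `u^{n-1} e^{-ψ_𝕏(u)} ∏_y τ_{n_y}(u, y)`, the product being over the distinct values `y`. -/
def latentWeight (α : Measure 𝕏) (ρ : Kernel 𝕏 ℝ) {n : ℕ} (x : Fin n → 𝕏) (u : ℝ) : ℝ :=
  u ^ (n - 1) * Real.exp (-psi α ρ univ u) * ∏ y ∈ distinct x, tau ρ (mult x y) u y

/-- The density on `(0, ∞)` proportional to `latentWeight`. -/
def latentDensity (α : Measure 𝕏) (ρ : Kernel 𝕏 ℝ) {n : ℕ} (x : Fin n → 𝕏) (u : ℝ) : ℝ :=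
  latentWeight α ρ x u / ∫ v in Ioi (0 : ℝ), latentWeight α ρ x v

/-- The multinomial coefficient `m! / ((m - ∑ l)! ∏ l_y!)`, used when `∑ l ≤ m`. -/
def multiCoeff (m : ℕ) (D : Finset 𝕏) (l : 𝕏 → ℕ) : ℝ :=
  (m ! : ℝ) / (((m - ∑ y ∈ D, l y)! : ℝ) * ∏ y ∈ D, ((l y)! : ℝ))

open Classical in
/-- The families `(l_y)` of natural numbers indexed by `D` with `∑ l ≤ m`
(extended by zero outside of `D`). -/
def multiIndices (m : ℕ) (D : Finset 𝕏) : Finset (𝕏 → ℕ) :=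
  (Finset.range (m + 1)).biUnion (fun k => D.piAntidiag k)

/-- The integrand of the term with index `l` in the `m`-th posterior moment of `P(A)`. -/
def momentIntegrand (α : Measure 𝕏) (ρ : Kernel 𝕏 ℝ) {n : ℕ} (x : Fin n → 𝕏) (A : Set 𝕏) (m : ℕ)
    (l : 𝕏 → ℕ) (u : ℝ) : ℝ :=
  u ^ m * latentDensity α ρ x u * V α ρ A (m - ∑ y ∈ distinct x, l y) u
    * ∏ y ∈ distinct x, tau ρ (mult x y + l y) u y / tau ρ (mult x y) u y
        * A.indicator (fun _ => (1 : ℝ)) y ^ l y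

open Classical in
/-- The distinct values of the sample that lie in `A`. -/
def distinctIn {n : ℕ} (x : Fin n → 𝕏) (A : Set 𝕏) : Finset 𝕏 :=
  (distinct x).filter (fun y => y ∈ A)

/-- The factor that a set `A` with exponent `m` contributes to a mixed posterior moment. -/
def mixedFactor (α : Measure 𝕏) (ρ : Kernel 𝕏 ℝ) {n : ℕ} (x : Fin n → 𝕏) (A : Set 𝕏) (m : ℕ)
    (u : ℝ) : ℝ :=
  ∑ l ∈ multiIndices m (distinctIn x A),
    multiCoeff m (distinctIn x A) l * V α ρ A (m - ∑ y ∈ distinctIn x A, l y) u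
      * ∏ y ∈ distinctIn x A, tau ρ (mult x y + l y) u y / tau ρ (mult x y) u y

/-- The integrand of the mixed posterior moment of `P(A₁)^{m₁} ⋯ P(A_q)^{m_q}`; the last factor
belongs to `A_{q+1} = (⋃ Aᵢ)ᶜ` with `m_{q+1} = 0`. -/
def mixedIntegrand (α : Measure 𝕏) (ρ : Kernel 𝕏 ℝ) {n : ℕ} (x : Fin n → 𝕏) {q : ℕ}
    (A : Fin q → Set 𝕏) (m : Fin q → ℕ) (u : ℝ) : ℝ :=
  u ^ (∑ i, m i) * latentDensity α ρ x u
    * ((∏ i, mixedFactor α ρ x (A i) (m i) u) * mixedFactor α ρ x (⋃ i, A i)ᶜ 0 u)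

end NRMI

end

noncomputable section

namespace NRMI

section ExpNeg

/-- The function `x ↦ e^{-x}` on `[0, ∞]`. -/
def expNeg (x : ℝ≥0∞) : ℝ := if x = ∞ then 0 else Real.exp (-x.toReal)

lemma expNeg_top : expNeg ∞ = 0 := by simp [expNeg]

lemma expNeg_of_ne_top {x : ℝ≥0∞} (hx : x ≠ ∞) : expNeg x = Real.exp (-x.toReal) := by
  simp [expNeg, hx]

lemma expNeg_ofReal {x : ℝ} (hx : 0 ≤ x) : expNeg (ENNReal.ofReal x) = Real.exp (-x) := by
  simp [expNeg, hx]

@[simp] lemma expNeg_zero : expNeg 0 = 1 := by simp [expNeg]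

lemma expNeg_nonneg (x : ℝ≥0∞) : 0 ≤ expNeg x := by
  unfold expNeg; split_ifs <;> positivity

lemma expNeg_le_one (x : ℝ≥0∞) : expNeg x ≤ 1 := by
  unfold expNeg; split_ifs <;> simp

lemma expNeg_add (x y : ℝ≥0∞) : expNeg (x + y) = expNeg x * expNeg y := by
  by_cases hx : x = ∞
  · simp [hx, expNeg_top]
  by_cases hy : y = ∞
  · simp [hy, expNeg_top]
  rw [expNeg_of_ne_top hx, expNeg_of_ne_top hy, expNeg_of_ne_top (by simp [hx, hy]),
    ENNReal.toReal_add hx hy, ← Real.exp_add]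
  ring_nf

lemma expNeg_sum {ι : Type*} (s : Finset ι) (f : ι → ℝ≥0∞) :
    expNeg (∑ i ∈ s, f i) = ∏ i ∈ s, expNeg (f i) := by
  classical
  induction s using Finset.induction_on with
  | empty => simp
  | insert a s ha ih => rw [Finset.sum_insert ha, Finset.prod_insert ha, expNeg_add, ih]

lemma expNeg_eq_toReal_exp (x : ℝ≥0∞) : expNeg x = (EReal.exp (-(x : EReal))).toReal := by
  induction x with
  | top => simp [expNeg_top]
  | coe x =>
    have h : -(((x : ℝ≥0∞)) : EReal) = ((-(x : ℝ) : ℝ) : EReal) := by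
      rfl
    rw [h, EReal.exp_coe, ENNReal.toReal_ofReal (Real.exp_pos _).le]
    simp [expNeg]

lemma continuous_expNeg : Continuous expNeg := by
  have h : expNeg = fun x : ℝ≥0∞ => (EReal.exp (-(x : EReal))).toReal := funext expNeg_eq_toReal_exp
  rw [h]
  refine ENNReal.continuousOn_toReal.comp_continuous (f := fun x : ℝ≥0∞ => EReal.exp (-(x : EReal)))
    ?_ ?_
  · have h1 : Continuous fun x : EReal => -x := continuous_neg
    exact ENNReal.continuous_exp.comp (h1.comp continuous_coe_ennreal_ereal)
  intro x
  simp [EReal.exp_eq_top_iff]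

lemma measurable_expNeg : Measurable expNeg := continuous_expNeg.measurable

end ExpNeg

section Poisson

variable {Ω S : Type*} [MeasurableSpace Ω] [MeasurableSpace S] {N : Ω → Measure S} {ν : Measure S}
  {Pr : Measure Ω}

lemma integral_expNeg_poissonLaw {a : ℝ≥0∞} (ha : a ≠ ∞) (r : ℝ≥0∞) :
    ∫ x, expNeg (a * x) ∂(poissonLaw r) = expNeg (ENNReal.ofReal (1 - expNeg a) * r) := by
  unfold poissonLaw
  split_ifs with hr
  · rw [integral_dirac, hr]
    rcases eq_or_ne a 0 with rfl | h0
    · simp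
    · have : 0 < 1 - expNeg a := by
        rw [expNeg_of_ne_top ha]
        have := ENNReal.toReal_pos h0 ha
        simpa using this
      rw [ENNReal.mul_top h0, ENNReal.mul_top (by simpa using this)]
  · have hm : Measurable fun x : ℝ≥0∞ => expNeg (a * x) :=
      measurable_expNeg.comp (measurable_const.mul measurable_id)
    rw [integral_map Measurable.of_discrete.aemeasurable hm.aestronglyMeasurable,
      integral_poissonMeasure]
    have h1 : ∀ n : ℕ, expNeg (a * n) = (Real.exp (-a.toReal)) ^ n := by
      intro n
      rw [expNeg_of_ne_top (ENNReal.mul_ne_top ha (by simp)), ← Real.exp_nat_mul]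
      simp; ring
    have h2 : ∀ n : ℕ, (Real.exp (-(r.toNNReal : ℝ)) * (r.toNNReal : ℝ) ^ n / (n)!)
        • expNeg (a * n) = Real.exp (-r.toReal) *
          ((r.toReal * Real.exp (-a.toReal)) ^ n / (n)!) := by
      intro n; rw [h1, mul_pow, smul_eq_mul]; simp only [ENNReal.coe_toNNReal_eq_toReal]; ring
    simp_rw [h2]
    rw [tsum_mul_left, ← congrFun NormedSpace.exp_eq_tsum_div, ← Real.exp_eq_exp_ℝ, ← Real.exp_add,
      expNeg_of_ne_top (ENNReal.mul_ne_top (by simp) hr), ENNReal.toReal_mul,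
      ENNReal.toReal_ofReal (by linarith [expNeg_le_one a]), expNeg_of_ne_top ha]
    ring_nf

lemma IsPoissonRandomMeasure.measurable_apply (hN : IsPoissonRandomMeasure N ν Pr) {B : Set S}
    (hB : MeasurableSet B) : Measurable (fun ω => N ω B) :=
  (Measure.measurable_coe hB).comp hN.measurable

lemma IsPoissonRandomMeasure.measurable_lintegral (hN : IsPoissonRandomMeasure N ν Pr)
    {f : S → ℝ≥0∞} (hf : Measurable f) : Measurable (fun ω => ∫⁻ p, f p ∂(N ω)) :=
  (Measure.measurable_lintegral hf).comp hN.measurable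

lemma IsPoissonRandomMeasure.iIndepFun_fintype (hN : IsPoissonRandomMeasure N ν Pr) {ι : Type*}
    [Fintype ι] {B : ι → Set S} (hB : ∀ i, MeasurableSet (B i))
    (hd : Pairwise (fun i j => Disjoint (B i) (B j))) : iIndepFun (fun i ω => N ω (B i)) Pr := by
  have h := hN.indep (Fintype.card ι) (fun i => B ((Fintype.equivFin ι).symm i))
    (fun i => hB _) (fun i j hij => hd (by simpa using hij))
  exact h.of_precomp (g := fun i => (Fintype.equivFin ι).symm i)
    (f := fun i ω => N ω (B i)) (Fintype.equivFin ι).symm.surjective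

lemma IsPoissonRandomMeasure.integral_expNeg_simpleFunc [IsProbabilityMeasure Pr]
    (hN : IsPoissonRandomMeasure N ν Pr) (f : SimpleFunc S ℝ≥0∞) (hf : ∀ p, f p ≠ ∞) :
    ∫ ω, expNeg (∫⁻ p, f p ∂(N ω)) ∂Pr
      = expNeg (∫⁻ p, ENNReal.ofReal (1 - expNeg (f p)) ∂ν) := by
  have h1 : ∀ ω, expNeg (∫⁻ p, f p ∂(N ω))
      = ∏ v : f.range, expNeg (v * N ω (f ⁻¹' {(v : ℝ≥0∞)})) := by
    intro ω
    rw [SimpleFunc.lintegral_eq_lintegral, SimpleFunc.lintegral, ← Finset.sum_coe_sort, expNeg_sum]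
  have h2 : ∫⁻ p, ENNReal.ofReal (1 - expNeg (f p)) ∂ν
      = ∑ v : f.range, ENNReal.ofReal (1 - expNeg v) * ν (f ⁻¹' {(v : ℝ≥0∞)}) := by
    have := SimpleFunc.map_lintegral (μ := ν) (fun x => ENNReal.ofReal (1 - expNeg x)) f
    rw [← SimpleFunc.lintegral_eq_lintegral] at this
    rw [Finset.sum_coe_sort f.range
      (fun v => ENNReal.ofReal (1 - expNeg v) * ν (f ⁻¹' {(v : ℝ≥0∞)})), ← this]
    rfl
  have hi := hN.iIndepFun_fintype (ι := f.range) (B := fun v => f ⁻¹' {(v : ℝ≥0∞)})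
    (fun v => f.measurableSet_fiber v) (fun v w hvw => by
      refine Disjoint.preimage _ ?_
      exact disjoint_singleton.2 fun h => hvw (Subtype.ext h))
  have hm : ∀ a : ℝ≥0∞, Measurable fun x : ℝ≥0∞ => expNeg (a * x) := fun a =>
    measurable_expNeg.comp (measurable_const.mul measurable_id)
  simp_rw [h1]
  rw [hi.integral_fun_prod_comp (f := fun (v : f.range) x => expNeg (v * x))
    (fun v => (hN.measurable_apply (f.measurableSet_fiber v)).aemeasurable)
    (fun v => (hm v).aestronglyMeasurable),
    h2, expNeg_sum]
  refine Finset.prod_congr rfl fun v _ => ?_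
  obtain ⟨p, hp⟩ := SimpleFunc.mem_range.1 v.2
  rw [← integral_expNeg_poissonLaw (by rw [← hp]; exact hf p), ← hN.law _ (f.measurableSet_fiber v),
    integral_map (hN.measurable_apply (f.measurableSet_fiber v)).aemeasurable
    (hm v).aestronglyMeasurable]

/-- The Laplace functional of a Poisson random measure. -/
theorem IsPoissonRandomMeasure.integral_expNeg [IsProbabilityMeasure Pr]
    (hN : IsPoissonRandomMeasure N ν Pr) {g : S → ℝ≥0∞} (hg : Measurable g) :
    ∫ ω, expNeg (∫⁻ p, g p ∂(N ω)) ∂Pr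
      = expNeg (∫⁻ p, ENNReal.ofReal (1 - expNeg (g p)) ∂ν) := by
  have hanti : ∀ {x y : ℝ≥0∞}, x ≤ y → expNeg y ≤ expNeg x := by
    intro x y hxy
    obtain ⟨z, rfl⟩ := exists_add_of_le hxy
    rw [expNeg_add]
    exact mul_le_of_le_one_right (expNeg_nonneg _) (expNeg_le_one _)
  have hm : ∀ M : Measure S, Filter.Tendsto (fun k => ∫⁻ p, SimpleFunc.eapprox g k p ∂M)
      Filter.atTop (nhds (∫⁻ p, g p ∂M)) := fun M =>
    lintegral_tendsto_of_tendsto_of_monotone (fun k => (SimpleFunc.measurable _).aemeasurable)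
      (ae_of_all _ fun p _ _ h => SimpleFunc.monotone_eapprox g h p)
      (ae_of_all _ fun p => SimpleFunc.tendsto_eapprox hg p)
  have hL : Filter.Tendsto (fun k => ∫ ω, expNeg (∫⁻ p, SimpleFunc.eapprox g k p ∂(N ω)) ∂Pr)
      Filter.atTop (nhds (∫ ω, expNeg (∫⁻ p, g p ∂(N ω)) ∂Pr)) := by
    refine tendsto_integral_of_dominated_convergence (fun _ => 1) (fun k =>
      (measurable_expNeg.comp
        (hN.measurable_lintegral (SimpleFunc.measurable _))).aestronglyMeasurable)
      (integrable_const _) (fun k => ae_of_all _ fun ω => ?_) (ae_of_all _ fun ω => ?_)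
    · rw [Real.norm_of_nonneg (expNeg_nonneg _)]; exact expNeg_le_one _
    · exact (continuous_expNeg.tendsto _).comp (hm (N ω))
  have hR : Filter.Tendsto (fun k => expNeg (∫⁻ p, ENNReal.ofReal
      (1 - expNeg (SimpleFunc.eapprox g k p)) ∂ν))
      Filter.atTop (nhds (expNeg (∫⁻ p, ENNReal.ofReal (1 - expNeg (g p)) ∂ν))) := by
    refine (continuous_expNeg.tendsto _).comp ?_
    refine lintegral_tendsto_of_tendsto_of_monotone (fun k => Measurable.aemeasurable ?_)
      (ae_of_all _ fun p k l h => ?_) (ae_of_all _ fun p => ?_)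
    · exact ENNReal.measurable_ofReal.comp
        (measurable_const.sub (measurable_expNeg.comp (SimpleFunc.measurable _)))
    · exact ENNReal.ofReal_le_ofReal
        (sub_le_sub_left (hanti (SimpleFunc.monotone_eapprox g h p)) _)
    · exact (ENNReal.continuous_ofReal.comp
        (continuous_const.sub continuous_expNeg)).continuousAt.tendsto.comp
          (SimpleFunc.tendsto_eapprox hg p)
  refine tendsto_nhds_unique hL (hR.congr fun k => ?_)
  exact (hN.integral_expNeg_simpleFunc _ fun p => (SimpleFunc.eapprox_lt_top g k p).ne).symm

/-- Functions of disjoint groups of the members of an independent family have a multiplicative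
expectation. -/
lemma integral_prod_of_iIndepFun_groups [IsProbabilityMeasure Pr] {ι V E : Type*} [Fintype ι]
    [Fintype V] [MeasurableSpace E] {Y : ι × V → Ω → E} (hY : iIndepFun Y Pr)
    (hYm : ∀ i, Measurable (Y i)) {G : ι → (V → E) → ℝ} (hG : ∀ i, Measurable (G i)) :
    ∫ ω, ∏ i, G i (fun v => Y (i, v) ω) ∂Pr = ∏ i, ∫ ω, G i (fun v => Y (i, v) ω) ∂Pr := by
  classical
  suffices h : ∀ s : Finset ι, ∫ ω, ∏ i ∈ s, G i (fun v => Y (i, v) ω) ∂Pr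
      = ∏ i ∈ s, ∫ ω, G i (fun v => Y (i, v) ω) ∂Pr from h Finset.univ
  intro s
  induction s using Finset.induction_on with
  | empty => simp
  | insert a s ha ih =>
    simp_rw [Finset.prod_insert ha]
    rw [← ih]
    have hd : Disjoint (({a} : Finset ι) ×ˢ (Finset.univ : Finset V))
        (s ×ˢ (Finset.univ : Finset V)) := by
      rw [Finset.disjoint_product]; left; simpa using ha
    have hi := hY.indepFun_finset _ _ hd hYm
    refine IndepFun.integral_fun_mul_eq_mul_integral (X := fun ω => G a (fun v => Y (a, v) ω))
      (Y := fun ω => ∏ i ∈ s, G i (fun v => Y (i, v) ω)) ?_ ?_ ?_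
    · have h1 : Measurable (fun z : (({a} : Finset ι) ×ˢ (Finset.univ : Finset V) : Finset _) → E =>
          G a (fun v => z ⟨(a, v), by simp⟩)) :=
        (hG a).comp (measurable_pi_lambda _ fun v => measurable_pi_apply _)
      have h2 : Measurable (fun z : (s ×ˢ (Finset.univ : Finset V) : Finset _) → E =>
          ∏ i : s, G i (fun v => z ⟨(i, v), by simp⟩)) :=
        Finset.measurable_prod _ fun i _ =>
          (hG i).comp (measurable_pi_lambda _ fun v => measurable_pi_apply _)
      have h3 := hi.comp h1 h2
      have h4 : ((fun z : (s ×ˢ (Finset.univ : Finset V) : Finset _) → E =>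
          ∏ i : s, G i (fun v => z ⟨(i, v), by simp⟩)) ∘ fun ω i => Y i ω)
          = fun ω => ∏ i ∈ s, G i (fun v => Y (i, v) ω) := by
        funext ω
        exact Finset.prod_coe_sort s (fun i => G i (fun v => Y (i, v) ω))
      rw [h4] at h3
      exact h3
    · exact ((hG a).comp (measurable_pi_lambda _ fun v => hYm _)).aestronglyMeasurable
    · exact (Finset.measurable_prod _ fun i _ =>
        (hG i).comp (measurable_pi_lambda _ fun v => hYm _)).aestronglyMeasurable

/-- Integrals of a function over disjoint sets against a Poisson random measure are independent. -/
theorem IsPoissonRandomMeasure.integral_prod_setLIntegral [IsProbabilityMeasure Pr]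
    (hN : IsPoissonRandomMeasure N ν Pr) {g : S → ℝ≥0∞} (hg : Measurable g) {ι : Type*} [Fintype ι]
    {D : ι → Set S} (hD : ∀ i, MeasurableSet (D i))
    (hd : Pairwise (fun i j => Disjoint (D i) (D j))) {G : ι → ℝ≥0∞ → ℝ} {K : ℝ}
    (hG : ∀ i, Measurable (G i)) (hK : ∀ i x, |G i x| ≤ K)
    (hc : ∀ i, ∀ᵐ ω ∂Pr, ContinuousAt (G i) (∫⁻ p in D i, g p ∂(N ω))) :
    ∫ ω, ∏ i, G i (∫⁻ p in D i, g p ∂(N ω)) ∂Pr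
      = ∏ i, ∫ ω, G i (∫⁻ p in D i, g p ∂(N ω)) ∂Pr := by
  have hm : ∀ M : Measure S, Filter.Tendsto (fun k => ∫⁻ p, SimpleFunc.eapprox g k p ∂M)
      Filter.atTop (nhds (∫⁻ p, g p ∂M)) := fun M =>
    lintegral_tendsto_of_tendsto_of_monotone (fun k => (SimpleFunc.measurable _).aemeasurable)
      (ae_of_all _ fun p _ _ h => SimpleFunc.monotone_eapprox g h p)
      (ae_of_all _ fun p => SimpleFunc.tendsto_eapprox hg p)
  have hmeas : ∀ {f : S → ℝ≥0∞} (_ : Measurable f) (i : ι),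
      Measurable (fun ω => ∫⁻ p in D i, f p ∂(N ω)) := by
    intro f hf i
    simp_rw [← lintegral_indicator (hD i)]
    exact hN.measurable_lintegral (hf.indicator (hD i))
  have key : ∀ k, ∫ ω, ∏ i, G i (∫⁻ p in D i, SimpleFunc.eapprox g k p ∂(N ω)) ∂Pr
      = ∏ i, ∫ ω, G i (∫⁻ p in D i, SimpleFunc.eapprox g k p ∂(N ω)) ∂Pr := by
    intro k
    set f := SimpleFunc.eapprox g k
    have h1 : ∀ i ω, ∫⁻ p in D i, f p ∂(N ω)
        = ∑ v : f.range, v * N ω (f ⁻¹' {(v : ℝ≥0∞)} ∩ D i) := by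
      intro i ω
      rw [SimpleFunc.lintegral_eq_lintegral, SimpleFunc.lintegral, ← Finset.sum_coe_sort]
      refine Finset.sum_congr rfl fun v _ => ?_
      rw [Measure.restrict_apply (f.measurableSet_fiber _)]
    have hi := hN.iIndepFun_fintype (ι := ι × f.range)
      (B := fun c => f ⁻¹' {(c.2 : ℝ≥0∞)} ∩ D c.1)
      (fun c => (f.measurableSet_fiber _).inter (hD _)) (fun c e hce => by
        by_cases h : c.1 = e.1
        · have h2 : c.2 ≠ e.2 := fun h' => hce (Prod.ext h h')
          refine Disjoint.mono inter_subset_left inter_subset_left (Disjoint.preimage _ ?_)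
          exact disjoint_singleton.2 fun h => h2 (Subtype.ext h)
        · exact Disjoint.mono inter_subset_right inter_subset_right (hd h))
    have := integral_prod_of_iIndepFun_groups hi
      (fun c => hN.measurable_apply ((f.measurableSet_fiber _).inter (hD _)))
      (G := fun i z => G i (∑ v : f.range, v * z v))
      (fun i => (hG i).comp (Finset.measurable_sum _ fun v _ =>
        measurable_const.mul (measurable_pi_apply v)))
    simpa only [← h1] using this
  have hL : Filter.Tendsto
      (fun k => ∫ ω, ∏ i, G i (∫⁻ p in D i, SimpleFunc.eapprox g k p ∂(N ω)) ∂Pr)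
      Filter.atTop (nhds (∫ ω, ∏ i, G i (∫⁻ p in D i, g p ∂(N ω)) ∂Pr)) := by
    refine tendsto_integral_of_dominated_convergence (fun _ => ∏ _i : ι, K) (fun k =>
      (Finset.measurable_prod _ fun i _ =>
        (hG i).comp (hmeas (SimpleFunc.measurable _) i)).aestronglyMeasurable)
      (integrable_const _) (fun k => ae_of_all _ fun ω => ?_) ?_
    · rw [Real.norm_eq_abs, Finset.abs_prod]
      exact Finset.prod_le_prod (fun _ _ => abs_nonneg _) fun i _ => hK i _
    · filter_upwards [ae_all_iff.2 hc] with ω hω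
      exact tendsto_finsetProd _ fun i _ => (hω i).tendsto.comp (hm _)
  have hR : Filter.Tendsto
      (fun k => ∏ i, ∫ ω, G i (∫⁻ p in D i, SimpleFunc.eapprox g k p ∂(N ω)) ∂Pr)
      Filter.atTop (nhds (∏ i, ∫ ω, G i (∫⁻ p in D i, g p ∂(N ω)) ∂Pr)) := by
    refine tendsto_finsetProd _ fun i _ => ?_
    refine tendsto_integral_of_dominated_convergence (fun _ => K) (fun k =>
      ((hG i).comp (hmeas (SimpleFunc.measurable _) i)).aestronglyMeasurable)
      (integrable_const _) (fun k => ae_of_all _ fun ω => hK i _) ?_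
    filter_upwards [hc i] with ω hω
    exact hω.tendsto.comp (hm _)
  exact tendsto_nhds_unique hL (hR.congr fun k => (key k).symm)

end Poisson

section Jets

open PowerSeries

/-- `P u` is, for every `u > 0`, the Taylor series at `0` of `x ↦ P₀(u - x)`, where `P₀` is the
constant coefficient. -/
def IsJet (P : ℝ → PowerSeries ℝ) : Prop :=
  ∀ u, 0 < u → ∀ k, HasDerivAt (fun v => coeff k (P v)) (-coeff k (d⁄dX ℝ (P u))) u

lemma IsJet.sub {P Q : ℝ → PowerSeries ℝ} (hP : IsJet P) (hQ : IsJet Q) :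
    IsJet (fun u => P u - Q u) := by
  intro u hu k
  simp only [map_sub]
  exact ((hP u hu k).sub (hQ u hu k)).congr_deriv (by ring)

lemma IsJet.mul {P Q : ℝ → PowerSeries ℝ} (hP : IsJet P) (hQ : IsJet Q) :
    IsJet (fun u => P u * Q u) := by
  intro u hu k
  simp only [coeff_mul]
  have h := HasDerivAt.fun_sum (u := Finset.HasAntidiagonal.antidiagonal k)
    fun p _ => (hP u hu p.1).fun_mul (hQ u hu p.2)
  refine h.congr_deriv ?_
  rw [Derivation.leibniz, smul_eq_mul, smul_eq_mul, map_add, coeff_mul, mul_comm (Q u), coeff_mul,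
    ← Finset.sum_add_distrib, ← Finset.sum_neg_distrib]
  exact Finset.sum_congr rfl fun p _ => by ring

lemma IsJet.derivative {P : ℝ → PowerSeries ℝ} (hP : IsJet P) : IsJet (fun u => d⁄dX ℝ (P u)) := by
  intro u hu k
  simp only [coeff_derivative]
  exact ((hP u hu (k + 1)).mul_const ((k : ℝ) + 1)).congr_deriv (by
    rw [coeff_derivative]; push_cast; ring)

lemma IsJet.eq_zero {P : ℝ → PowerSeries ℝ} (hP : IsJet P) (h0 : ∀ u, 0 < u → coeff 0 (P u) = 0)
    {u : ℝ} (hu : 0 < u) : P u = 0 := by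
  have h : ∀ k, ∀ u, 0 < u → coeff k (P u) = 0 := by
    intro k
    induction k with
    | zero => exact h0
    | succ k ih =>
      intro u hu
      have h1 : HasDerivAt (fun v => coeff k (P v)) 0 u :=
        (hasDerivAt_const u (0 : ℝ)).congr_of_eventuallyEq
          (Filter.eventuallyEq_of_mem (Ioi_mem_nhds hu) fun v hv => ih v hv)
      have h2 := (hP u hu k).unique h1
      rw [coeff_derivative] at h2
      have h3 : ((k : ℝ) + 1) ≠ 0 := by positivity
      have h4 : coeff (k + 1) (P u) * ((k : ℝ) + 1) = 0 := by linarith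
      exact (mul_eq_zero.1 h4).resolve_right h3
  ext k
  simpa using h k u hu

lemma IsJet.iteratedDeriv_eq {P : ℝ → PowerSeries ℝ} (hP : IsJet P) {f : ℝ → ℝ}
    (hf : ∀ u, 0 < u → f u = coeff 0 (P u)) (k : ℕ) :
    ∀ u, 0 < u → iteratedDeriv k f u = (-1) ^ k * (k ! : ℝ) * coeff k (P u) := by
  induction k with
  | zero => intro u hu; simp [hf u hu]
  | succ k ih =>
    intro u hu
    rw [iteratedDeriv_succ]
    have h1 : HasDerivAt (fun v => (-1) ^ k * (k ! : ℝ) * coeff k (P v))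
        ((-1) ^ k * (k ! : ℝ) * -coeff k (d⁄dX ℝ (P u))) u := (hP u hu k).const_mul _
    have h2 := h1.congr_of_eventuallyEq (f₁ := iteratedDeriv k f)
      (Filter.eventuallyEq_of_mem (Ioi_mem_nhds hu) fun v hv => ih v hv)
    rw [h2.deriv, coeff_derivative, Nat.factorial_succ]
    push_cast
    ring

end Jets

section LaplaceMoments

open PowerSeries

/-- The moment `∫ s^k e^{-us} L(ds)`. -/
def lmom (L : Measure ℝ) (k : ℕ) (u : ℝ) : ℝ := ∫ s, s ^ k * Real.exp (-(u * s)) ∂L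

lemma tau_eq_lmom {𝕏 : Type*} [MeasurableSpace 𝕏] (ρ : Kernel 𝕏 ℝ) (k : ℕ) (u : ℝ) (y : 𝕏) :
    tau ρ k u y = lmom (ρ y) k u := rfl

lemma pow_mul_exp_neg_le (k : ℕ) {u s : ℝ} (hu : 0 < u) (hs : 0 ≤ s) :
    s ^ k * Real.exp (-(u * s)) ≤ (k ! : ℝ) / u ^ k := by
  have h := Real.pow_div_factorial_le_exp (u * s) (mul_nonneg hu.le hs) k
  rw [Real.exp_neg, le_div_iff₀ (by positivity), ← div_eq_mul_inv, div_mul_eq_mul_div,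
    div_le_iff₀ (Real.exp_pos _)]
  rw [div_le_iff₀ (by positivity), mul_pow] at h
  linarith

lemma hasDerivAt_lmom {L : Measure ℝ} (h0 : ∀ᵐ s ∂L, 0 ≤ s) {k : ℕ}
    (hk : ∀ u, 0 < u → Integrable (fun s => s ^ k * Real.exp (-(u * s))) L)
    (hk1 : ∀ u, 0 < u → Integrable (fun s => s ^ (k + 1) * Real.exp (-(u * s))) L)
    {u : ℝ} (hu : 0 < u) : HasDerivAt (lmom L k) (-lmom L (k + 1) u) u := by
  have h := hasDerivAt_integral_of_dominated_loc_of_deriv_le (μ := L) (x₀ := u)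
    (s := Ioi (u / 2)) (F := fun v s => s ^ k * Real.exp (-(v * s)))
    (F' := fun v s => -(s ^ (k + 1) * Real.exp (-(v * s))))
    (bound := fun s => s ^ (k + 1) * Real.exp (-(u / 2 * s)))
    (Ioi_mem_nhds (by linarith))
    (Filter.Eventually.of_forall fun v => by fun_prop) (hk u hu) (by fun_prop) ?_
    (hk1 _ (by linarith)) ?_
  · refine h.2.congr_deriv ?_
    rw [integral_neg]; rfl
  · filter_upwards [h0] with s hs v hv
    rw [norm_neg, Real.norm_of_nonneg (by positivity)]
    have : u / 2 * s ≤ v * s := mul_le_mul_of_nonneg_right (le_of_lt hv) hs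
    gcongr
  · refine ae_of_all _ fun s v _ => ?_
    have h1 : HasDerivAt (fun v : ℝ => -(v * s)) (-(1 * s)) v :=
      ((hasDerivAt_id v).mul_const s).neg
    exact (h1.exp.const_mul (s ^ k)).congr_deriv (by ring)

/-- The exponential generating series of the moments of order `≥ k₀`. -/
def lser (L : Measure ℝ) (k₀ : ℕ) (u : ℝ) : PowerSeries ℝ :=
  PowerSeries.mk fun l => lmom L (k₀ + l) u / (l ! : ℝ)

lemma derivative_lser (L : Measure ℝ) (k₀ : ℕ) (u : ℝ) :
    d⁄dX ℝ (lser L k₀ u) = lser L (k₀ + 1) u := by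
  ext l
  rw [coeff_derivative, lser, lser, coeff_mk, coeff_mk, Nat.factorial_succ, ← add_assoc,
    add_right_comm k₀ l 1]
  have h1 : (l : ℝ) + 1 ≠ 0 := by positivity
  have h2 : (l ! : ℝ) ≠ 0 := by positivity
  push_cast
  field_simp

lemma isJet_lser {L : Measure ℝ} (h0 : ∀ᵐ s ∂L, 0 ≤ s) {k₀ : ℕ}
    (hk : ∀ k, k₀ ≤ k → ∀ u, 0 < u → Integrable (fun s => s ^ k * Real.exp (-(u * s))) L) :
    IsJet (lser L k₀) := by
  intro u hu l
  rw [derivative_lser]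
  simp only [lser, coeff_mk]
  have := (hasDerivAt_lmom h0 (hk (k₀ + l) (by omega)) (hk (k₀ + l + 1) (by omega)) hu).div_const
    (l ! : ℝ)
  refine this.congr_deriv ?_
  rw [neg_div, add_right_comm]

/-- If the Laplace transform of `M` is `e^{-p}` with `p' = ∫ s e^{-us} L(ds)`, then the moment
series of `M` satisfies the corresponding differential equation. -/
lemma derivative_lser_eq_mul {L M : Measure ℝ} (hL0 : ∀ᵐ s ∂L, 0 ≤ s) (hM0 : ∀ᵐ s ∂M, 0 ≤ s)
    (hL : ∀ k, 1 ≤ k → ∀ u, 0 < u → Integrable (fun s => s ^ k * Real.exp (-(u * s))) L)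
    (hM : ∀ k u, 0 < u → Integrable (fun s => s ^ k * Real.exp (-(u * s))) M)
    {p : ℝ → ℝ} (hp : ∀ u, 0 < u → HasDerivAt p (lmom L 1 u) u)
    (hE : ∀ u, 0 < u → lmom M 0 u = Real.exp (-p u)) {u : ℝ} (hu : 0 < u) :
    d⁄dX ℝ (lser M 0 u) = lser M 0 u * lser L 1 u := by
  have hMj : IsJet (lser M 0) := isJet_lser hM0 fun k _ => hM k
  have hLj : IsJet (lser L 1) := isJet_lser hL0 hL
  refine sub_eq_zero.1 ((hMj.derivative.sub (hMj.mul hLj)).eq_zero ?_ hu)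
  intro v hv
  have h1 : HasDerivAt (lmom M 0) (-lmom M 1 v) v := hasDerivAt_lmom hM0 (hM 0) (hM 1) hv
  have h2 : HasDerivAt (lmom M 0) (Real.exp (-p v) * -lmom L 1 v) v :=
    ((hp v hv).neg.exp).congr_of_eventuallyEq
      (Filter.eventuallyEq_of_mem (Ioi_mem_nhds hv) fun w hw => hE w hw)
  have h3 := h1.unique h2
  rw [map_sub, derivative_lser, coeff_mul]
  simp [lser, coeff_mk, hE v hv]
  linarith

end LaplaceMoments

section LevyMeasure

/-- The Lévy measures of subordinators without drift. -/
structure IsLevyMeasure (L : Measure ℝ) : Prop where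
  null : L (Iic 0) = 0
  int : ∫⁻ s, ENNReal.ofReal (min s 1) ∂L < ∞

namespace IsLevyMeasure

lemma ae_pos {L : Measure ℝ} (hL : IsLevyMeasure L) : ∀ᵐ s ∂L, 0 < s := by
  have h := measure_eq_zero_iff_ae_notMem.1 hL.null
  filter_upwards [h] with s hs
  simpa using hs

lemma integrable_min {L : Measure ℝ} (hL : IsLevyMeasure L) : Integrable (fun s => min s 1) L := by
  refine ⟨by fun_prop, ?_⟩
  rw [hasFiniteIntegral_iff_ofReal]
  · exact hL.int
  · filter_upwards [hL.ae_pos] with s hs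
    exact le_min hs.le zero_le_one

lemma integrable_pow_mul_exp {L : Measure ℝ} (hL : IsLevyMeasure L) {k : ℕ} (hk : 1 ≤ k) {u : ℝ}
    (hu : 0 < u) :
    Integrable (fun s => s ^ k * Real.exp (-(u * s))) L := by
  obtain ⟨j, rfl⟩ : ∃ j, k = j + 1 := ⟨k - 1, by omega⟩
  set C := max ((j ! : ℝ) / u ^ j) (((j + 1)! : ℝ) / u ^ (j + 1))
  refine (hL.integrable_min.const_mul C).mono' (by fun_prop) ?_
  filter_upwards [hL.ae_pos] with s hs
  rw [Real.norm_of_nonneg (by positivity)]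
  have h1 := pow_mul_exp_neg_le j hu hs.le
  have h2 := pow_mul_exp_neg_le (j + 1) hu hs.le
  rcases le_total s 1 with h | h
  · rw [min_eq_left h]
    calc s ^ (j + 1) * Real.exp (-(u * s)) = (s ^ j * Real.exp (-(u * s))) * s := by ring
      _ ≤ C * s := by gcongr; exact h1.trans (le_max_left _ _)
  · rw [min_eq_right h, mul_one]
    exact h2.trans (le_max_right _ _)

lemma integrable_one_sub_exp {L : Measure ℝ} (hL : IsLevyMeasure L) {u : ℝ} (hu : 0 ≤ u) :
    Integrable (fun s => 1 - Real.exp (-(u * s))) L := by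
  refine (hL.integrable_min.const_mul (max u 1)).mono' (by fun_prop) ?_
  filter_upwards [hL.ae_pos] with s hs
  have h0 : Real.exp (-(u * s)) ≤ 1 := Real.exp_le_one_iff.2 (by nlinarith)
  rw [Real.norm_of_nonneg (by linarith)]
  have h1 := Real.add_one_le_exp (-(u * s))
  have h2 := Real.exp_pos (-(u * s))
  rcases le_total s 1 with h | h
  · rw [min_eq_left h]
    nlinarith [le_max_left u 1]
  · rw [min_eq_right h]
    nlinarith [le_max_right u 1]

lemma hasDerivAt_integral_one_sub_exp {L : Measure ℝ} (hL : IsLevyMeasure L) {u : ℝ} (hu : 0 < u) :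
    HasDerivAt (fun v => ∫ s, (1 - Real.exp (-(v * s))) ∂L) (lmom L 1 u) u := by
  have h := hasDerivAt_integral_of_dominated_loc_of_deriv_le (μ := L) (x₀ := u)
    (s := Ioi (u / 2)) (F := fun v s => 1 - Real.exp (-(v * s)))
    (F' := fun v s => s ^ 1 * Real.exp (-(v * s)))
    (bound := fun s => s ^ 1 * Real.exp (-(u / 2 * s)))
    (Ioi_mem_nhds (by linarith))
    (Filter.Eventually.of_forall fun v => by fun_prop) (hL.integrable_one_sub_exp hu.le)
    (by fun_prop) ?_ (hL.integrable_pow_mul_exp le_rfl (by linarith)) ?_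
  · exact h.2
  · filter_upwards [hL.ae_pos] with s hs v hv
    rw [Real.norm_of_nonneg (by positivity)]
    have : u / 2 * s ≤ v * s := mul_le_mul_of_nonneg_right (le_of_lt hv) hs.le
    gcongr
  · refine ae_of_all _ fun s v _ => ?_
    have h1 : HasDerivAt (fun v : ℝ => -(v * s)) (-(1 * s)) v :=
      ((hasDerivAt_id v).mul_const s).neg
    exact (h1.exp.const_sub 1).congr_deriv (by ring)

lemma lmom_nonneg {L : Measure ℝ} (hL : IsLevyMeasure L) (k : ℕ) (u : ℝ) : 0 ≤ lmom L k u :=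
  integral_nonneg_of_ae (by filter_upwards [hL.ae_pos] with s hs using by positivity)

lemma ofReal_lmom {L : Measure ℝ} (hL : IsLevyMeasure L) {k : ℕ} (hk : 1 ≤ k) {u : ℝ}
    (hu : 0 < u) :
    ENNReal.ofReal (lmom L k u) = ∫⁻ s, ENNReal.ofReal (s ^ k * Real.exp (-(u * s))) ∂L :=
  ofReal_integral_eq_lintegral_ofReal (hL.integrable_pow_mul_exp hk hu)
    (by filter_upwards [hL.ae_pos] with s hs using by positivity)

lemma lmom_pos {L : Measure ℝ} (hL : IsLevyMeasure L) (h : L univ ≠ 0) {k : ℕ} (hk : 1 ≤ k)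
    {u : ℝ} (hu : 0 < u) : 0 < lmom L k u := by
  refine (hL.lmom_nonneg k u).lt_of_ne fun h0 => h ?_
  have h1 := (integral_eq_zero_iff_of_nonneg_ae
    (by filter_upwards [hL.ae_pos] with s hs using by positivity)
    (hL.integrable_pow_mul_exp hk hu)).1 h0.symm
  have h2 : ∀ᵐ s ∂L, False := by
    filter_upwards [h1, hL.ae_pos] with s hs hs0
    have : 0 < s ^ k * Real.exp (-(u * s)) := by positivity
    exact this.ne' hs
  simpa [ae_iff] using h2

end IsLevyMeasure

end LevyMeasure

section LevyKernel

variable {𝕏 : Type*} [MeasurableSpace 𝕏]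

/-- The conditional jump measures of a completely random measure with finite total mass. -/
structure IsLevyKernel (α : Measure 𝕏) (ρ : Kernel 𝕏 ℝ) : Prop where
  levy : ∀ x, IsLevyMeasure (ρ x)
  top : ∀ x, ρ x univ = ∞
  int : ∫⁻ x, ∫⁻ s, ENNReal.ofReal (min s 1) ∂(ρ x) ∂α < ∞

/-- The Lévy measure of the mass of the set `A`. -/
def jumpLaw (α : Measure 𝕏) (ρ : Kernel 𝕏 ℝ) (A : Set 𝕏) : Measure ℝ :=
  ((levyIntensity α ρ).restrict (univ ×ˢ A)).map Prod.fst

variable {α : Measure 𝕏} {ρ : Kernel 𝕏 ℝ}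

lemma IsLevyKernel.tau_nonneg (hρ : IsLevyKernel α ρ) (k : ℕ) (u : ℝ) (x : 𝕏) : 0 ≤ tau ρ k u x :=
  (hρ.levy x).lmom_nonneg k u

lemma IsLevyKernel.tau_pos (hρ : IsLevyKernel α ρ) {k : ℕ} (hk : 1 ≤ k) {u : ℝ} (hu : 0 < u)
    (x : 𝕏) : 0 < tau ρ k u x :=
  (hρ.levy x).lmom_pos (by simp [hρ.top x]) hk hu

variable [IsSFiniteKernel ρ]

lemma measurable_map_prodMk (ρ : Kernel 𝕏 ℝ) [IsSFiniteKernel ρ] :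
    Measurable (fun x => (ρ x).map (fun s => (s, x))) := by
  refine Measure.measurable_of_measurable_coe _ fun B hB => ?_
  have h : ∀ x, (ρ x).map (fun s => (s, x)) B = ρ x (Prod.mk x ⁻¹' (Prod.swap ⁻¹' B)) := fun x => by
    rw [Measure.map_apply measurable_prodMk_right hB]; rfl
  simp_rw [h]
  exact Kernel.measurable_kernel_prodMk_left (measurable_swap hB)

lemma lintegral_levyIntensity {f : ℝ × 𝕏 → ℝ≥0∞} (hf : Measurable f) :
    ∫⁻ p, f p ∂(levyIntensity α ρ) = ∫⁻ x, ∫⁻ s, f (s, x) ∂(ρ x) ∂α := by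
  rw [levyIntensity, Measure.lintegral_bind (measurable_map_prodMk ρ).aemeasurable hf.aemeasurable]
  exact lintegral_congr fun x => lintegral_map hf measurable_prodMk_right

lemma lintegral_jumpLaw {A : Set 𝕏} (hA : MeasurableSet A) {g : ℝ → ℝ≥0∞} (hg : Measurable g) :
    ∫⁻ s, g s ∂(jumpLaw α ρ A) = ∫⁻ x in A, ∫⁻ s, g s ∂(ρ x) ∂α := by
  have hA' : MeasurableSet ((univ : Set ℝ) ×ˢ A) := MeasurableSet.univ.prod hA
  rw [jumpLaw, lintegral_map hg measurable_fst, ← lintegral_indicator hA',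
    lintegral_levyIntensity (f := (univ ×ˢ A).indicator fun a => g a.1)
      ((hg.comp measurable_fst).indicator hA'), ← lintegral_indicator hA]
  refine lintegral_congr fun x => ?_
  by_cases hx : x ∈ A <;> simp [indicator, hx]

lemma IsLevyKernel.isLevyMeasure_jumpLaw (hρ : IsLevyKernel α ρ) {A : Set 𝕏}
    (hA : MeasurableSet A) : IsLevyMeasure (jumpLaw α ρ A) := by
  refine ⟨?_, ?_⟩
  · rw [← lintegral_indicator_one measurableSet_Iic,
      lintegral_jumpLaw hA (measurable_one.indicator measurableSet_Iic)]
    simp [lintegral_indicator_one measurableSet_Iic, (hρ.levy _).null]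
  · rw [lintegral_jumpLaw hA (by fun_prop)]
    exact (setLIntegral_le_lintegral _ _).trans_lt hρ.int

lemma measurable_tau (ρ : Kernel 𝕏 ℝ) [IsSFiniteKernel ρ] (k : ℕ) :
    Measurable (fun p : ℝ × 𝕏 => tau ρ k p.1 p.2) := by
  have h : StronglyMeasurable (fun p : ℝ × 𝕏 => ∫ s, s ^ k * Real.exp (-(p.1 * s))
      ∂(Kernel.prodMkLeft ℝ ρ p)) := by
    refine StronglyMeasurable.integral_kernel_prod_right'
      (f := fun q : (ℝ × 𝕏) × ℝ => q.2 ^ k * Real.exp (-(q.1.1 * q.2))) ?_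
    exact Measurable.stronglyMeasurable (by fun_prop)
  exact h.measurable

lemma IsLevyKernel.setLIntegral_tau (hρ : IsLevyKernel α ρ) {A : Set 𝕏} (hA : MeasurableSet A)
    {k : ℕ} (hk : 1 ≤ k) {u : ℝ} (hu : 0 < u) :
    ∫⁻ x in A, ENNReal.ofReal (tau ρ k u x) ∂α = ENNReal.ofReal (lmom (jumpLaw α ρ A) k u) := by
  rw [(hρ.isLevyMeasure_jumpLaw hA).ofReal_lmom hk hu, lintegral_jumpLaw hA (by fun_prop)]
  exact lintegral_congr fun x => (hρ.levy x).ofReal_lmom hk hu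

lemma IsLevyKernel.integrableOn_tau (hρ : IsLevyKernel α ρ) {A : Set 𝕏} (hA : MeasurableSet A)
    {k : ℕ} (hk : 1 ≤ k) {u : ℝ} (hu : 0 < u) : IntegrableOn (tau ρ k u) A α := by
  refine ⟨((measurable_tau ρ k).comp measurable_prodMk_left).aestronglyMeasurable, ?_⟩
  rw [hasFiniteIntegral_iff_ofReal (ae_of_all _ fun x => hρ.tau_nonneg k u x),
    hρ.setLIntegral_tau hA hk hu]
  exact ENNReal.ofReal_lt_top

lemma IsLevyKernel.setIntegral_tau (hρ : IsLevyKernel α ρ) {A : Set 𝕏} (hA : MeasurableSet A)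
    {k : ℕ} (hk : 1 ≤ k) {u : ℝ} (hu : 0 < u) :
    ∫ x in A, tau ρ k u x ∂α = lmom (jumpLaw α ρ A) k u := by
  rw [integral_eq_lintegral_of_nonneg_ae (ae_of_all _ fun x => hρ.tau_nonneg k u x)
    (hρ.integrableOn_tau hA hk hu).aestronglyMeasurable, hρ.setLIntegral_tau hA hk hu,
    ENNReal.toReal_ofReal ((hρ.isLevyMeasure_jumpLaw hA).lmom_nonneg k u)]

lemma psi_eq_integral_jumpLaw (α : Measure 𝕏) (ρ : Kernel 𝕏 ℝ) (A : Set 𝕏) (t : ℝ) :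
    psi α ρ A t = ∫ s, (1 - Real.exp (-(t * s))) ∂(jumpLaw α ρ A) := by
  rw [jumpLaw, integral_map measurable_fst.aemeasurable (by fun_prop)]
  rfl

lemma IsLevyKernel.hasDerivAt_psi (hρ : IsLevyKernel α ρ) {A : Set 𝕏} (hA : MeasurableSet A)
    {u : ℝ} (hu : 0 < u) : HasDerivAt (psi α ρ A) (lmom (jumpLaw α ρ A) 1 u) u := by
  have h : psi α ρ A = fun v => ∫ s, (1 - Real.exp (-(v * s))) ∂(jumpLaw α ρ A) :=
    funext (psi_eq_integral_jumpLaw α ρ A)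
  rw [h]
  exact (hρ.isLevyMeasure_jumpLaw hA).hasDerivAt_integral_one_sub_exp hu

lemma IsLevyKernel.lintegral_one_sub_exp (hρ : IsLevyKernel α ρ) {A : Set 𝕏} (hA : MeasurableSet A)
    {u : ℝ} (hu : 0 ≤ u) : ∫⁻ s, ENNReal.ofReal (1 - Real.exp (-(u * s))) ∂(jumpLaw α ρ A)
      = ENNReal.ofReal (psi α ρ A u) := by
  rw [psi_eq_integral_jumpLaw, ofReal_integral_eq_lintegral_ofReal
    ((hρ.isLevyMeasure_jumpLaw hA).integrable_one_sub_exp hu)]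
  filter_upwards [(hρ.isLevyMeasure_jumpLaw hA).ae_pos] with s hs
  have h0 : Real.exp (-(u * s)) ≤ 1 := Real.exp_le_one_iff.2 (by nlinarith)
  simpa using h0

lemma IsLevyKernel.psi_nonneg (hρ : IsLevyKernel α ρ) {A : Set 𝕏} (hA : MeasurableSet A)
    {u : ℝ} (hu : 0 ≤ u) : 0 ≤ psi α ρ A u := by
  rw [psi_eq_integral_jumpLaw]
  refine integral_nonneg_of_ae ?_
  filter_upwards [(hρ.isLevyMeasure_jumpLaw hA).ae_pos] with s hs
  have h0 : Real.exp (-(u * s)) ≤ 1 := Real.exp_le_one_iff.2 (by nlinarith)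
  simpa using h0

end LevyKernel

section CRM

lemma crm_apply {Ω 𝕏 : Type*} [MeasurableSpace 𝕏] (N : Ω → Measure (ℝ × 𝕏)) (ω : Ω)
    {A : Set 𝕏} (hA : MeasurableSet A) :
    crm N ω A = ∫⁻ p in univ ×ˢ A, ENNReal.ofReal p.1 ∂(N ω) := by
  have h : Prod.snd ⁻¹' A = (univ : Set ℝ) ×ˢ A := by ext; simp
  rw [crm, Measure.map_apply measurable_snd hA,
    withDensity_apply _ (measurable_snd hA), h]

variable {Ω 𝕏 : Type*} [MeasurableSpace Ω] [MeasurableSpace 𝕏] {Pr : Measure Ω}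
  {α : Measure 𝕏} {ρ : Kernel 𝕏 ℝ} {N : Ω → Measure (ℝ × 𝕏)}

lemma measurable_crm (hN : Measurable N) : Measurable (crm N) := by
  refine Measure.measurable_of_measurable_coe _ fun A hA => ?_
  have hA' : MeasurableSet ((univ : Set ℝ) ×ˢ A) := MeasurableSet.univ.prod hA
  simp_rw [crm_apply N _ hA, ← lintegral_indicator hA']
  exact (Measure.measurable_lintegral
    ((ENNReal.measurable_ofReal.comp measurable_fst).indicator hA')).comp hN

lemma measurable_crm_apply (hN : Measurable N) {A : Set 𝕏} (hA : MeasurableSet A) :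
    Measurable (fun ω => crm N ω A) := (Measure.measurable_coe hA).comp (measurable_crm hN)

lemma measurable_nrmi (hN : Measurable N) : Measurable (nrmi N) := by
  refine Measure.measurable_of_measurable_coe _ fun A hA => ?_
  simp only [nrmi, Measure.smul_apply, smul_eq_mul]
  exact (measurable_crm_apply hN MeasurableSet.univ).inv.mul (measurable_crm_apply hN hA)

lemma crm_le_univ {Ω 𝕏 : Type*} [MeasurableSpace 𝕏] (N : Ω → Measure (ℝ × 𝕏)) (ω : Ω)
    (A : Set 𝕏) : crm N ω A ≤ crm N ω univ := measure_mono (subset_univ A)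

/-- The law of the mass of `A`. -/
def massLaw (N : Ω → Measure (ℝ × 𝕏)) (Pr : Measure Ω) (A : Set 𝕏) : Measure ℝ :=
  Pr.map (fun ω => (crm N ω A).toReal)

lemma lmom_massLaw (hN : Measurable N) {A : Set 𝕏} (hA : MeasurableSet A) (k : ℕ) (u : ℝ) :
    lmom (massLaw N Pr A) k u
      = ∫ ω, (crm N ω A).toReal ^ k * Real.exp (-(u * (crm N ω A).toReal)) ∂Pr := by
  rw [lmom, massLaw, integral_map (measurable_crm_apply hN hA).ennreal_toReal.aemeasurable
    (by fun_prop)]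

lemma ae_massLaw_nonneg (hN : Measurable N) {A : Set 𝕏} (hA : MeasurableSet A) :
    ∀ᵐ s ∂(massLaw N Pr A), 0 ≤ s := by
  rw [massLaw, ae_map_iff (measurable_crm_apply hN hA).ennreal_toReal.aemeasurable
    measurableSet_Ici]
  exact ae_of_all _ fun ω => ENNReal.toReal_nonneg

lemma lmom_massLaw_nonneg (hN : Measurable N) {A : Set 𝕏} (hA : MeasurableSet A) (k : ℕ) (u : ℝ) :
    0 ≤ lmom (massLaw N Pr A) k u :=
  integral_nonneg_of_ae (by
    filter_upwards [ae_massLaw_nonneg hN hA] with s hs using by positivity)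

variable [IsProbabilityMeasure Pr]

lemma ae_eq_zero_of_intensity_eq_zero {S : Type*} [MeasurableSpace S] {M : Ω → Measure S}
    {ν : Measure S} (hM : IsPoissonRandomMeasure M ν Pr) {B : Set S} (hB : MeasurableSet B)
    (h : ν B = 0) : ∀ᵐ ω ∂Pr, M ω B = 0 := by
  have h1 := hM.integral_expNeg (g := B.indicator 1) (measurable_one.indicator hB)
  have h2 : ∫⁻ p, ENNReal.ofReal (1 - expNeg (B.indicator 1 p)) ∂ν = 0 := by
    refine (lintegral_congr_ae ?_).trans lintegral_zero
    filter_upwards [measure_eq_zero_iff_ae_notMem.1 h] with p hp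
    simp [indicator_of_notMem hp]
  simp_rw [lintegral_indicator_one hB] at h1
  rw [h2, expNeg_zero] at h1
  have hm := measurable_expNeg.comp (hM.measurable_apply hB)
  have hint : Integrable (fun ω => expNeg (M ω B)) Pr :=
    (integrable_const (1 : ℝ)).mono' hm.aestronglyMeasurable (ae_of_all _ fun ω => by
      rw [Real.norm_of_nonneg (expNeg_nonneg _)]; exact expNeg_le_one _)
  have h3 : ∫ ω, (1 - expNeg (M ω B)) ∂Pr = 0 := by
    rw [integral_sub (integrable_const _) hint, h1]; simp
  have h4 := (integral_eq_zero_iff_of_nonneg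
    (fun ω => sub_nonneg.2 (expNeg_le_one _)) ((integrable_const _).sub hint)).1 h3
  filter_upwards [h4] with ω hω
  have h5 : expNeg (M ω B) = 1 := by
    have : 1 - expNeg (M ω B) = 0 := hω
    linarith
  by_cases htop : M ω B = ∞
  · simp [htop, expNeg_top] at h5
  · rw [expNeg_of_ne_top htop, Real.exp_eq_one_iff, neg_eq_zero, ENNReal.toReal_eq_zero_iff] at h5
    exact h5.resolve_right htop

lemma integrable_massLaw (hN : Measurable N) {A : Set 𝕏} (hA : MeasurableSet A) (k : ℕ) {u : ℝ}
    (hu : 0 < u) : Integrable (fun s => s ^ k * Real.exp (-(u * s))) (massLaw N Pr A) := by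
  have : IsProbabilityMeasure (massLaw N Pr A) :=
    Measure.isProbabilityMeasure_map (measurable_crm_apply hN hA).ennreal_toReal.aemeasurable
  refine (integrable_const ((k ! : ℝ) / u ^ k)).mono' (by fun_prop) ?_
  filter_upwards [ae_massLaw_nonneg hN hA] with s hs
  rw [Real.norm_of_nonneg (by positivity)]
  exact pow_mul_exp_neg_le k hu hs

variable [IsSFiniteKernel ρ]

lemma integral_expNeg_crm (hρ : IsLevyKernel α ρ)
    (hN : IsPoissonRandomMeasure N (levyIntensity α ρ) Pr) {A : Set 𝕏} (hA : MeasurableSet A)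
    {u : ℝ} (hu : 0 ≤ u) :
    ∫ ω, expNeg (ENNReal.ofReal u * crm N ω A) ∂Pr = Real.exp (-psi α ρ A u) := by
  have hA' : MeasurableSet ((univ : Set ℝ) ×ˢ A) := MeasurableSet.univ.prod hA
  have hg : Measurable (fun p : ℝ × 𝕏 => ENNReal.ofReal u * ENNReal.ofReal p.1) := by fun_prop
  have h1 : ∀ ω, ENNReal.ofReal u * crm N ω A = ∫⁻ p, ((univ : Set ℝ) ×ˢ A).indicator
      (fun p => ENNReal.ofReal u * ENNReal.ofReal p.1) p ∂(N ω) := by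
    intro ω
    rw [crm_apply N ω hA, lintegral_indicator hA', lintegral_const_mul _ (by fun_prop)]
  simp_rw [h1]
  rw [hN.integral_expNeg (hg.indicator hA'), ← expNeg_ofReal (hρ.psi_nonneg hA hu),
    ← hρ.lintegral_one_sub_exp hA hu, jumpLaw, lintegral_map (by fun_prop) measurable_fst]
  congr 1
  have h2 : ∀ p : ℝ × 𝕏, ENNReal.ofReal (1 - expNeg (((univ : Set ℝ) ×ˢ A).indicator
      (fun p => ENNReal.ofReal u * ENNReal.ofReal p.1) p)) = ((univ : Set ℝ) ×ˢ A).indicator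
      (fun p => ENNReal.ofReal (1 - expNeg (ENNReal.ofReal u * ENNReal.ofReal p.1))) p := by
    intro p
    by_cases hp : p ∈ (univ : Set ℝ) ×ˢ A
    · rw [indicator_of_mem hp, indicator_of_mem hp]
    · rw [indicator_of_notMem hp, indicator_of_notMem hp]; simp
  simp_rw [h2]
  rw [lintegral_indicator hA']
  have h3 : ∀ᵐ p ∂((levyIntensity α ρ).restrict (univ ×ˢ A)), 0 < p.1 :=
    ae_of_ae_map measurable_fst.aemeasurable (hρ.isLevyMeasure_jumpLaw hA).ae_pos
  refine lintegral_congr_ae ?_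
  filter_upwards [h3] with p hp
  rw [← ENNReal.ofReal_mul hu, expNeg_ofReal (by positivity)]

lemma ae_crm_univ_ne_top (hρ : IsLevyKernel α ρ)
    (hN : IsPoissonRandomMeasure N (levyIntensity α ρ) Pr) : ∀ᵐ ω ∂Pr, crm N ω univ ≠ ∞ := by
  set B : Set Ω := {ω | crm N ω univ ≠ ∞}
  have hm := measurable_crm_apply (N := N) hN.measurable (MeasurableSet.univ (α := 𝕏))
  have hB : MeasurableSet B := (hm (measurableSet_singleton ∞)).compl
  set u : ℕ → ℝ := fun n => 1 / ((n : ℝ) + 1)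
  have hu0 : ∀ n, 0 ≤ u n := fun n => by positivity
  have hu1 : ∀ n, u n ≤ 1 := fun n => by
    rw [div_le_one (by positivity)]; linarith [Nat.cast_nonneg (α := ℝ) n]
  have hut : Filter.Tendsto u Filter.atTop (nhds 0) := tendsto_one_div_add_atTop_nhds_zero_nat
  have hlevy := hρ.isLevyMeasure_jumpLaw MeasurableSet.univ
  have h1 : Filter.Tendsto (fun n => ∫ ω, expNeg (ENNReal.ofReal (u n) * crm N ω univ) ∂Pr)
      Filter.atTop (nhds (∫ ω, B.indicator (fun _ => (1 : ℝ)) ω ∂Pr)) := by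
    refine tendsto_integral_of_dominated_convergence (fun _ => 1) (fun k =>
      (measurable_expNeg.comp (measurable_const.mul hm)).aestronglyMeasurable)
      (integrable_const _) (fun k => ae_of_all _ fun ω => ?_) (ae_of_all _ fun ω => ?_)
    · rw [Real.norm_of_nonneg (expNeg_nonneg _)]; exact expNeg_le_one _
    · by_cases hω : crm N ω univ = ∞
      · have hω' : ω ∉ B := fun h => h hω
        have h2 : ∀ n, ENNReal.ofReal (u n) ≠ 0 := fun n => by
          have : 0 < u n := by positivity
          simpa using this
        simp [indicator_of_notMem hω', hω, ENNReal.mul_top (h2 _), expNeg_top]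
      · have hω' : ω ∈ B := hω
        rw [indicator_of_mem hω', ← expNeg_zero]
        refine (continuous_expNeg.tendsto 0).comp ?_
        have := ENNReal.Tendsto.mul_const (b := crm N ω univ)
          ((ENNReal.continuous_ofReal.tendsto 0).comp hut) (Or.inr hω)
        simpa using this
  have h2 : Filter.Tendsto (fun n => Real.exp (-psi α ρ univ (u n))) Filter.atTop (nhds 1) := by
    have h3 : Filter.Tendsto (fun n => psi α ρ univ (u n)) Filter.atTop (nhds 0) := by
      simp_rw [psi_eq_integral_jumpLaw]
      have := tendsto_integral_of_dominated_convergence (μ := jumpLaw α ρ univ)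
        (F := fun n s => 1 - Real.exp (-(u n * s))) (f := fun _ => 0)
        (fun s => 1 - Real.exp (-(1 * s))) (fun n => by fun_prop)
        (hlevy.integrable_one_sub_exp zero_le_one) ?_ ?_
      · simpa using this
      · intro n
        filter_upwards [hlevy.ae_pos] with s hs
        have h0 : Real.exp (-(u n * s)) ≤ 1 :=
          Real.exp_le_one_iff.2 (by nlinarith [hu0 n])
        rw [Real.norm_of_nonneg (by linarith)]
        have : u n * s ≤ 1 * s := mul_le_mul_of_nonneg_right (hu1 n) hs.le
        gcongr
      · refine ae_of_all _ fun s => ?_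
        have h4 : Continuous fun v : ℝ => 1 - Real.exp (-(v * s)) := by fun_prop
        have := (h4.tendsto 0).comp hut
        simpa [Function.comp_def] using this
    have := (Real.continuous_exp.tendsto _).comp h3.neg
    simpa [Function.comp_def] using this
  have h3 := tendsto_nhds_unique h1 (h2.congr fun n =>
    (integral_expNeg_crm hρ hN MeasurableSet.univ (hu0 n)).symm)
  rw [integral_indicator_const _ hB] at h3
  have h4 : Pr B = 1 := by
    have : Pr.real B = 1 := by simpa using h3
    rwa [measureReal_def, ENNReal.toReal_eq_one_iff] at this
  exact (mem_ae_iff_prob_eq_one hB).2 h4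

lemma ae_crm_univ_ne_zero (hρ : IsLevyKernel α ρ) (hα : α ≠ 0)
    (hN : IsPoissonRandomMeasure N (levyIntensity α ρ) Pr) : ∀ᵐ ω ∂Pr, crm N ω univ ≠ 0 := by
  have hB : MeasurableSet {p : ℝ × 𝕏 | p.1 ≤ 0} := measurableSet_le measurable_fst measurable_const
  have h0 : levyIntensity α ρ {p : ℝ × 𝕏 | p.1 ≤ 0} = 0 := by
    rw [← lintegral_indicator_one hB, lintegral_levyIntensity (measurable_one.indicator hB)]
    have : ∀ x, ∫⁻ s, {p : ℝ × 𝕏 | p.1 ≤ 0}.indicator 1 (s, x) ∂(ρ x) = 0 := by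
      intro x
      have h1 := (hρ.levy x).null
      rw [← lintegral_indicator_one measurableSet_Iic] at h1
      exact h1
    simp [this]
  have h1 : levyIntensity α ρ univ = ∞ := by
    rw [← lintegral_one, lintegral_levyIntensity measurable_const]
    simp [hρ.top, ENNReal.top_mul, hα]
  have h2 : ∀ᵐ ω ∂Pr, N ω univ = ∞ := by
    have h3 := hN.law univ MeasurableSet.univ
    rw [h1, poissonLaw, if_pos rfl] at h3
    have h4 : ∀ᵐ x ∂(Pr.map fun ω => N ω univ), x = ∞ := by
      rw [h3, ae_dirac_eq]; simp
    exact ae_of_ae_map (hN.measurable_apply MeasurableSet.univ).aemeasurable h4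
  filter_upwards [ae_eq_zero_of_intensity_eq_zero hN hB h0, h2] with ω hω hω2 hzero
  rw [crm_apply N ω MeasurableSet.univ, univ_prod_univ, Measure.restrict_univ,
    lintegral_eq_zero_iff (by fun_prop)] at hzero
  have h5 : ∀ᵐ p ∂(N ω), False := by
    filter_upwards [hzero, measure_eq_zero_iff_ae_notMem.1 hω] with p hp hp2
    exact hp2 (by simpa using hp)
  have h6 : N ω univ = 0 := by simpa [ae_iff] using h5
  simp [hω2] at h6

lemma lmom_massLaw_zero (hρ : IsLevyKernel α ρ)
    (hN : IsPoissonRandomMeasure N (levyIntensity α ρ) Pr) {A : Set 𝕏} (hA : MeasurableSet A)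
    {u : ℝ} (hu : 0 < u) : lmom (massLaw N Pr A) 0 u = Real.exp (-psi α ρ A u) := by
  rw [lmom_massLaw hN.measurable hA, ← integral_expNeg_crm hρ hN hA hu.le]
  refine integral_congr_ae ?_
  filter_upwards [ae_crm_univ_ne_top hρ hN] with ω hω
  have h1 : crm N ω A ≠ ∞ := ne_top_of_le_ne_top hω (crm_le_univ N ω A)
  rw [expNeg_of_ne_top (ENNReal.mul_ne_top ENNReal.ofReal_ne_top h1), ENNReal.toReal_mul,
    ENNReal.toReal_ofReal hu.le, pow_zero, one_mul]

lemma derivative_lser_massLaw (hρ : IsLevyKernel α ρ)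
    (hN : IsPoissonRandomMeasure N (levyIntensity α ρ) Pr) {A : Set 𝕏} (hA : MeasurableSet A)
    {u : ℝ} (hu : 0 < u) :
    PowerSeries.derivative ℝ (lser (massLaw N Pr A) 0 u)
      = lser (massLaw N Pr A) 0 u * lser (jumpLaw α ρ A) 1 u := by
  have hL := hρ.isLevyMeasure_jumpLaw hA
  exact derivative_lser_eq_mul (hL.ae_pos.mono fun s hs => hs.le)
    (ae_massLaw_nonneg hN.measurable hA) (fun k hk u hu => hL.integrable_pow_mul_exp hk hu)
    (fun k u hu => integrable_massLaw hN.measurable hA k hu)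
    (fun u hu => hρ.hasDerivAt_psi hA hu) (fun u hu => lmom_massLaw_zero hρ hN hA hu) hu

lemma exp_neg_psi_mul_V (hρ : IsLevyKernel α ρ)
    (hN : IsPoissonRandomMeasure N (levyIntensity α ρ) Pr) {A : Set 𝕏} (hA : MeasurableSet A)
    (k : ℕ) {u : ℝ} (hu : 0 < u) :
    Real.exp (-psi α ρ A u) * V α ρ A k u = lmom (massLaw N Pr A) k u := by
  have hj : IsJet (lser (massLaw N Pr A) 0) := isJet_lser (ae_massLaw_nonneg hN.measurable hA)
    fun k _ u hu => integrable_massLaw hN.measurable hA k hu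
  have h := hj.iteratedDeriv_eq (f := fun r => Real.exp (-psi α ρ A r)) (fun u hu => by
    simp [lser, lmom_massLaw_zero hρ hN hA hu]) k u hu
  rw [V, h, lser, PowerSeries.coeff_mk, zero_add]
  have h1 : Real.exp (-psi α ρ A u) * Real.exp (psi α ρ A u) = 1 := by rw [← Real.exp_add]; simp
  have h2 : ((-1 : ℝ) ^ k) * (-1) ^ k = 1 := by rw [← mul_pow]; simp
  have h3 : (k ! : ℝ) ≠ 0 := by positivity
  calc _ = (Real.exp (-psi α ρ A u) * Real.exp (psi α ρ A u)) * (((-1 : ℝ) ^ k) * (-1) ^ k)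
        * ((k ! : ℝ) * (lmom (massLaw N Pr A) k u / (k ! : ℝ))) := by ring
    _ = _ := by rw [h1, h2, mul_div_cancel₀ _ h3]; ring

/-- The masses of disjoint sets are independent. -/
lemma integral_prod_crm (hρ : IsLevyKernel α ρ)
    (hN : IsPoissonRandomMeasure N (levyIntensity α ρ) Pr) {ι : Type*} [Fintype ι]
    {A : ι → Set 𝕏} (hA : ∀ i, MeasurableSet (A i))
    (hd : Pairwise (fun i j => Disjoint (A i) (A j))) (k : ι → ℕ) {u : ℝ} (hu : 0 < u) :
    ∫ ω, ∏ i, ((crm N ω (A i)).toReal ^ k i * Real.exp (-(u * (crm N ω (A i)).toReal))) ∂Pr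
      = ∏ i, lmom (massLaw N Pr (A i)) (k i) u := by
  simp_rw [lmom_massLaw hN.measurable (hA _)]
  have hnn : ∀ i, 0 ≤ ((k i)! : ℝ) / u ^ k i := fun i => by positivity
  have h := hN.integral_prod_setLIntegral (g := fun p => ENNReal.ofReal p.1) (by fun_prop)
    (D := fun i => (univ : Set ℝ) ×ˢ A i) (fun i => MeasurableSet.univ.prod (hA i))
    (fun i j hij => (hd hij).set_prod_right _ _)
    (G := fun i r => r.toReal ^ k i * Real.exp (-(u * r.toReal)))
    (K := ∑ i, ((k i)! : ℝ) / u ^ k i) (fun i => by fun_prop) (fun i x => by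
      rw [abs_of_nonneg (by positivity)]
      exact (pow_mul_exp_neg_le _ hu ENNReal.toReal_nonneg).trans
        (Finset.single_le_sum (f := fun i => ((k i)! : ℝ) / u ^ k i) (fun i _ => hnn i)
          (Finset.mem_univ i))) (fun i => by
      filter_upwards [ae_crm_univ_ne_top hρ hN] with ω hω
      rw [← crm_apply N ω (hA i)]
      have h1 := ENNReal.tendsto_toReal (ne_top_of_le_ne_top hω (crm_le_univ N ω (A i)))
      have h2 : Continuous fun r : ℝ => r ^ k i * Real.exp (-(u * r)) := by fun_prop
      exact (h2.tendsto _).comp h1)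
  simp_rw [← crm_apply N _ (hA _)] at h
  exact h

end CRM

section Sequences

variable {𝕏 : Type*}

lemma distinct_snoc [DecidableEq 𝕏] {n : ℕ} (x : Fin n → 𝕏) (z : 𝕏) :
    distinct (Fin.snoc x z : Fin (n + 1) → 𝕏) = insert z (distinct x) := by
  classical
  ext y
  simp only [distinct, Finset.mem_image, Finset.mem_univ, true_and, Finset.mem_insert,
    Fin.exists_fin_succ', Fin.snoc_castSucc, Fin.snoc_last]
  constructor
  · rintro (h | h)
    · exact Or.inr h
    · exact Or.inl h.symm
  · rintro (h | h)
    · exact Or.inr h.symm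
    · exact Or.inl h

lemma mult_snoc [DecidableEq 𝕏] {n : ℕ} (x : Fin n → 𝕏) (z y : 𝕏) :
    mult (Fin.snoc x z : Fin (n + 1) → 𝕏) y = mult x y + if z = y then 1 else 0 := by
  simp only [mult, Finset.card_filter, Fin.sum_univ_castSucc, Fin.snoc_castSucc, Fin.snoc_last]
  congr!

lemma mult_pos {n : ℕ} {x : Fin n → 𝕏} {y : 𝕏} (hy : y ∈ distinct x) : 1 ≤ mult x y := by
  classical
  obtain ⟨i, -, rfl⟩ := Finset.mem_image.1 hy
  exact Finset.card_pos.2 ⟨i, by simp⟩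

lemma mult_eq_zero {n : ℕ} {x : Fin n → 𝕏} {y : 𝕏} (hy : y ∉ distinct x) : mult x y = 0 := by
  classical
  refine Finset.card_eq_zero.2 (Finset.filter_eq_empty_iff.2 fun i _ h => hy ?_)
  exact Finset.mem_image.2 ⟨i, Finset.mem_univ _, h⟩

lemma mem_distinctIn {n : ℕ} {x : Fin n → 𝕏} {A : Set 𝕏} {y : 𝕏} :
    y ∈ distinctIn x A ↔ y ∈ distinct x ∧ y ∈ A := by
  simp [distinctIn]

open Classical in
/-- The indices at which a value of `x` occurs for the first time. -/
def firstIndices {n : ℕ} (x : Fin n → 𝕏) : Finset (Fin n) :=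
  Finset.univ.filter (fun i => ∀ j < i, x j ≠ x i)

lemma injOn_firstIndices {n : ℕ} (x : Fin n → 𝕏) : Set.InjOn x (firstIndices x) := by
  intro i hi j hj hij
  simp only [firstIndices, Finset.coe_filter, Finset.mem_univ, true_and, mem_ofPred_eq] at hi hj
  rcases lt_trichotomy i j with h | h | h
  · exact absurd hij (hj i h)
  · exact h
  · exact absurd hij.symm (hi j h)

lemma distinct_eq_image_firstIndices [DecidableEq 𝕏] {n : ℕ} (x : Fin n → 𝕏) :
    distinct x = (firstIndices x).image x := by
  classical
  ext y
  simp only [distinct, firstIndices, Finset.mem_image, Finset.mem_univ, true_and,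
    Finset.mem_filter]
  constructor
  · rintro ⟨i, rfl⟩
    have hne : (Finset.univ.filter fun j => x j = x i).Nonempty := ⟨i, by simp⟩
    refine ⟨(Finset.univ.filter fun j => x j = x i).min' hne, fun j hj h => ?_, ?_⟩
    · have hm := Finset.min'_mem _ hne
      simp only [Finset.mem_filter, Finset.mem_univ, true_and] at hm
      exact absurd (Finset.min'_le _ j (by simp [h, hm])) (not_le.2 hj)
    · have hm := Finset.min'_mem _ hne
      simpa using hm
  · rintro ⟨i, -, h⟩
    exact ⟨i, h⟩

open Classical in
@[to_additive]
lemma prod_distinct {M : Type*} [CommMonoid M] {n : ℕ} (x : Fin n → 𝕏) (g : 𝕏 → M) :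
    ∏ y ∈ distinct x, g y = ∏ i, if i ∈ firstIndices x then g (x i) else 1 := by
  rw [distinct_eq_image_firstIndices, Finset.prod_image (injOn_firstIndices x),
    Finset.prod_ite_mem, Finset.univ_inter]

open Classical in
lemma prod_distinctIn {M : Type*} [CommMonoid M] {n : ℕ} (x : Fin n → 𝕏) (A : Set 𝕏) (g : 𝕏 → M) :
    ∏ y ∈ distinctIn x A, g y
      = ∏ i, if i ∈ firstIndices x ∧ x i ∈ A then g (x i) else 1 := by
  rw [distinctIn, Finset.prod_filter, prod_distinct]
  exact Finset.prod_congr rfl fun i _ => by split_ifs <;> simp_all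

variable [MeasurableSpace 𝕏] [MeasurableEq 𝕏]

lemma measurableSet_mem_firstIndices {n : ℕ} (i : Fin n) :
    MeasurableSet {x : Fin n → 𝕏 | i ∈ firstIndices x} := by
  have h : {x : Fin n → 𝕏 | i ∈ firstIndices x} = ⋂ j, ⋂ (_ : j < i), {x | x j = x i}ᶜ := by
    ext x; simp [firstIndices]
  rw [h]
  exact MeasurableSet.iInter fun j => MeasurableSet.iInter fun _ =>
    (measurableSet_eq_fun (measurable_pi_apply j) (measurable_pi_apply i)).compl

lemma measurable_mult_apply {n : ℕ} (i : Fin n) :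
    Measurable (fun x : Fin n → 𝕏 => mult x (x i)) := by
  classical
  simp only [mult, Finset.card_filter]
  refine Finset.measurable_sum _ fun j _ => Measurable.ite ?_ measurable_const measurable_const
  exact measurableSet_eq_fun (measurable_pi_apply j) (measurable_pi_apply i)

end Sequences

section PosteriorSeries

open PowerSeries

lemma derivative_prod {ι : Type*} [DecidableEq ι] (s : Finset ι) (f : ι → PowerSeries ℝ) :
    d⁄dX ℝ (∏ i ∈ s, f i) = ∑ i ∈ s, (∏ j ∈ s.erase i, f j) * d⁄dX ℝ (f i) := by
  induction s using Finset.induction_on with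
  | empty => simp
  | insert a s ha ih =>
    rw [Finset.prod_insert ha, Derivation.leibniz, ih, Finset.sum_insert ha,
      Finset.erase_insert ha, smul_eq_mul, smul_eq_mul, add_comm, Finset.mul_sum]
    congr 1
    refine Finset.sum_congr rfl fun i hi => ?_
    have hia : a ≠ i := fun h => ha (h ▸ hi)
    rw [Finset.erase_insert_of_ne hia, Finset.prod_insert (by simp [ha]), mul_assoc]

variable {𝕏 : Type*} [MeasurableSpace 𝕏]

/-- The exponential generating series of the moments of the mass that the prior with mass law `M`
and the atoms at the points of `x` give to `A`. -/
def postSeries (M : Measure ℝ) (ρ : Kernel 𝕏 ℝ) {n : ℕ} (x : Fin n → 𝕏) (A : Set 𝕏) (u : ℝ) :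
    PowerSeries ℝ :=
  lser M 0 u * ∏ y ∈ distinctIn x A, lser (ρ y) (mult x y) u

/-- The posterior moment with exponent `k`. -/
def postMoment (M : Measure ℝ) (ρ : Kernel 𝕏 ℝ) {n : ℕ} (x : Fin n → 𝕏) (A : Set 𝕏) (k : ℕ)
    (u : ℝ) : ℝ :=
  (k ! : ℝ) * coeff k (postSeries M ρ x A u)

variable {M : Measure ℝ} {ρ : Kernel 𝕏 ℝ} {n : ℕ} {x : Fin n → 𝕏} {A : Set 𝕏} {u : ℝ}

lemma postSeries_snoc_of_notMem {z : 𝕏} (hz : z ∉ A) :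
    postSeries M ρ (Fin.snoc x z : Fin (n + 1) → 𝕏) A u = postSeries M ρ x A u := by
  classical
  have h : distinctIn (Fin.snoc x z : Fin (n + 1) → 𝕏) A = distinctIn x A := by
    ext y
    rw [mem_distinctIn, mem_distinctIn, distinct_snoc, Finset.mem_insert]
    constructor
    · rintro ⟨rfl | h, hA⟩
      · exact absurd hA hz
      · exact ⟨h, hA⟩
    · exact fun h => ⟨Or.inr h.1, h.2⟩
  rw [postSeries, postSeries, h]
  congr 1
  refine Finset.prod_congr rfl fun y hy => ?_
  have hzy : z ≠ y := fun h => hz (h ▸ (mem_distinctIn.1 hy).2)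
  rw [mult_snoc, if_neg hzy, add_zero]

lemma postSeries_snoc_of_new {z : 𝕏} (hz : z ∈ A) (hx : z ∉ distinct x) :
    postSeries M ρ (Fin.snoc x z : Fin (n + 1) → 𝕏) A u
      = postSeries M ρ x A u * lser (ρ z) 1 u := by
  classical
  have h : distinctIn (Fin.snoc x z : Fin (n + 1) → 𝕏) A = insert z (distinctIn x A) := by
    ext y
    rw [Finset.mem_insert, mem_distinctIn, mem_distinctIn, distinct_snoc, Finset.mem_insert]
    constructor
    · rintro ⟨h | h, hA⟩
      · exact Or.inl h
      · exact Or.inr ⟨h, hA⟩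
    · rintro (rfl | h)
      · exact ⟨Or.inl rfl, hz⟩
      · exact ⟨Or.inr h.1, h.2⟩
  have hz' : z ∉ distinctIn x A := fun h => hx (mem_distinctIn.1 h).1
  rw [postSeries, postSeries, h, Finset.prod_insert hz', mult_snoc, if_pos rfl, mult_eq_zero hx,
    zero_add, mul_assoc, mul_comm (lser (ρ z) 1 u)]
  congr 2
  refine Finset.prod_congr rfl fun y hy => ?_
  have hzy : z ≠ y := fun h => hz' (h ▸ hy)
  rw [mult_snoc, if_neg hzy, add_zero]

lemma postSeries_snoc_of_old [DecidableEq 𝕏] {z : 𝕏} (hz : z ∈ distinctIn x A) :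
    postSeries M ρ (Fin.snoc x z : Fin (n + 1) → 𝕏) A u
      = lser M 0 u * ((∏ y ∈ (distinctIn x A).erase z, lser (ρ y) (mult x y) u)
          * d⁄dX ℝ (lser (ρ z) (mult x z) u)) := by
  have h : distinctIn (Fin.snoc x z : Fin (n + 1) → 𝕏) A = distinctIn x A := by
    ext y
    rw [mem_distinctIn, distinct_snoc, Finset.insert_eq_of_mem (mem_distinctIn.1 hz).1,
      ← mem_distinctIn]
  rw [postSeries, h, ← Finset.prod_erase_mul _ _ hz, mult_snoc, if_pos rfl, derivative_lser]
  congr 2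
  refine Finset.prod_congr rfl fun y hy => ?_
  have hzy : z ≠ y := (Finset.ne_of_mem_erase hy).symm
  rw [mult_snoc, if_neg hzy, add_zero]

lemma derivative_postSeries {L : Measure ℝ}
    (hM : d⁄dX ℝ (lser M 0 u) = lser M 0 u * lser L 1 u) :
    d⁄dX ℝ (postSeries M ρ x A u) = postSeries M ρ x A u * lser L 1 u
      + ∑ z ∈ distinctIn x A, postSeries M ρ (Fin.snoc x z : Fin (n + 1) → 𝕏) A u := by
  classical
  rw [Finset.sum_congr rfl fun z hz => postSeries_snoc_of_old hz, postSeries, Derivation.leibniz,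
    derivative_prod, hM, smul_eq_mul, smul_eq_mul, Finset.mul_sum, add_comm]
  congr 1
  ring

lemma coeff_mul_nonneg {P Q : PowerSeries ℝ} (hP : ∀ k, 0 ≤ coeff k P) (hQ : ∀ k, 0 ≤ coeff k Q)
    (k : ℕ) : 0 ≤ coeff k (P * Q) := by
  rw [coeff_mul]
  exact Finset.sum_nonneg fun p _ => mul_nonneg (hP _) (hQ _)

lemma coeff_prod_nonneg {ι : Type*} (s : Finset ι) {P : ι → PowerSeries ℝ}
    (hP : ∀ i k, 0 ≤ coeff k (P i)) (k : ℕ) : 0 ≤ coeff k (∏ i ∈ s, P i) := by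
  classical
  induction s using Finset.induction_on generalizing k with
  | empty => rw [Finset.prod_empty, coeff_one]; split_ifs <;> simp
  | insert a s ha ih => rw [Finset.prod_insert ha]; exact coeff_mul_nonneg (hP a) ih k

lemma coeff_postSeries_nonneg (hM : ∀ k, 0 ≤ lmom M k u) (hρ : ∀ k y, 0 ≤ tau ρ k u y) (k : ℕ) :
    0 ≤ coeff k (postSeries M ρ x A u) := by
  refine coeff_mul_nonneg (fun k => ?_) (coeff_prod_nonneg _ fun y k => ?_) k
  · rw [lser, coeff_mk]; exact div_nonneg (hM _) (by positivity)
  · rw [lser, coeff_mk]; exact div_nonneg (hρ _ _) (by positivity)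

lemma postMoment_nonneg (hM : ∀ k, 0 ≤ lmom M k u) (hρ : ∀ k y, 0 ≤ tau ρ k u y) (k : ℕ) :
    0 ≤ postMoment M ρ x A k u :=
  mul_nonneg (by positivity) (coeff_postSeries_nonneg hM hρ k)

lemma ae_notMem_finset (α : Measure 𝕏) [NullSingletonClass α] (s : Finset 𝕏) :
    ∀ᵐ z ∂α, z ∉ s :=
  measure_eq_zero_iff_ae_notMem.1 (s.finite_toSet.measure_zero α)

variable {α : Measure 𝕏} [IsSFiniteKernel ρ] [NullSingletonClass α]

/-- Adding a point of `A` to the sample raises the exponent of `A`. -/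
lemma ofReal_postMoment_succ (hρ : IsLevyKernel α ρ) (hA : MeasurableSet A)
    (hM0 : ∀ k, 0 ≤ lmom M k u) (hu : 0 < u)
    (hM : d⁄dX ℝ (lser M 0 u) = lser M 0 u * lser (jumpLaw α ρ A) 1 u) (k : ℕ) :
    ENNReal.ofReal (postMoment M ρ x A (k + 1) u)
      = ∫⁻ z in A, ENNReal.ofReal (postMoment M ρ (Fin.snoc x z : Fin (n + 1) → 𝕏) A k u) ∂α
        + ∑ z ∈ distinctIn x A,
          ENNReal.ofReal (postMoment M ρ (Fin.snoc x z : Fin (n + 1) → 𝕏) A k u) := by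
  have hτ : ∀ k y, 0 ≤ tau ρ k u y := fun k y => hρ.tau_nonneg k u y
  have h1 : postMoment M ρ x A (k + 1) u
      = (k ! : ℝ) * coeff k (postSeries M ρ x A u * lser (jumpLaw α ρ A) 1 u)
        + ∑ z ∈ distinctIn x A, postMoment M ρ (Fin.snoc x z : Fin (n + 1) → 𝕏) A k u := by
    have h := congrArg (coeff k) (derivative_postSeries (ρ := ρ) (x := x) (A := A) hM)
    rw [coeff_derivative, map_add, map_sum] at h
    simp only [postMoment, Nat.factorial_succ]
    push_cast
    rw [← Finset.mul_sum, ← mul_add, ← h]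
    ring
  have hco : ∀ z, coeff k (postSeries M ρ x A u * lser (ρ z) 1 u)
      = ∑ p ∈ Finset.HasAntidiagonal.antidiagonal k,
        coeff p.1 (postSeries M ρ x A u) * (tau ρ (1 + p.2) u z / (p.2 ! : ℝ)) := fun z => by
    rw [coeff_mul]; simp only [lser, coeff_mk]; rfl
  have hint : IntegrableOn (fun z => coeff k (postSeries M ρ x A u * lser (ρ z) 1 u)) A α := by
    simp_rw [hco]
    exact integrable_finsetSum _ fun p _ =>
      ((hρ.integrableOn_tau hA (by omega) hu).div_const _).const_mul _
  have h2 : coeff k (postSeries M ρ x A u * lser (jumpLaw α ρ A) 1 u)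
      = ∫ z in A, coeff k (postSeries M ρ x A u * lser (ρ z) 1 u) ∂α := by
    simp_rw [hco]
    rw [integral_finsetSum _ fun p _ =>
      ((hρ.integrableOn_tau hA (by omega) hu).div_const _).const_mul _, coeff_mul]
    refine Finset.sum_congr rfl fun p _ => ?_
    rw [integral_const_mul, integral_div, hρ.setIntegral_tau hA (by omega) hu, lser, coeff_mk]
  have hnn : ∀ z, 0 ≤ coeff k (postSeries M ρ x A u * lser (ρ z) 1 u) := fun z =>
    coeff_mul_nonneg (coeff_postSeries_nonneg hM0 hτ) (fun k => by
      rw [lser, coeff_mk]; exact div_nonneg (hτ _ _) (by positivity)) k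
  rw [h1, h2, ENNReal.ofReal_add
    (mul_nonneg (by positivity) (integral_nonneg hnn))
    (Finset.sum_nonneg fun z _ => postMoment_nonneg hM0 hτ k),
    ENNReal.ofReal_sum_of_nonneg fun z _ => postMoment_nonneg hM0 hτ k]
  congr 1
  rw [← integral_const_mul, ofReal_integral_eq_lintegral_ofReal (hint.const_mul _)
    (ae_of_all _ fun z => mul_nonneg (by positivity) (hnn z))]
  refine lintegral_congr_ae ?_
  filter_upwards [ae_restrict_mem hA, ae_restrict_of_ae (ae_notMem_finset α (distinct x))]
    with z hz hzx
  rw [postMoment, postSeries_snoc_of_new hz hzx]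

end PosteriorSeries

section Measurability

open PowerSeries

variable {β 𝕏 : Type*} [MeasurableSpace β] [MeasurableSpace 𝕏]

lemma measurable_coeff_mul {P Q : β → PowerSeries ℝ} (hP : ∀ k, Measurable fun b => coeff k (P b))
    (hQ : ∀ k, Measurable fun b => coeff k (Q b)) (k : ℕ) :
    Measurable fun b => coeff k (P b * Q b) := by
  simp only [coeff_mul]
  exact Finset.measurable_sum _ fun p _ => (hP p.1).mul (hQ p.2)

lemma measurable_coeff_prod {ι : Type*} (s : Finset ι) {P : ι → β → PowerSeries ℝ}
    (hP : ∀ i k, Measurable fun b => coeff k (P i b)) (k : ℕ) :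
    Measurable fun b => coeff k (∏ i ∈ s, P i b) := by
  classical
  induction s using Finset.induction_on generalizing k with
  | empty => simp only [Finset.prod_empty]; exact measurable_const
  | insert a s ha ih =>
    simp only [Finset.prod_insert ha]
    exact measurable_coeff_mul (hP a) ih k

lemma measurable_lmom (M : Measure ℝ) [SFinite M] (k : ℕ) : Measurable (lmom M k) := by
  have h : StronglyMeasurable (fun u => ∫ s, s ^ k * Real.exp (-(u * s)) ∂M) :=
    StronglyMeasurable.integral_prod_right (f := fun u s => s ^ k * Real.exp (-(u * s)))
      (Measurable.stronglyMeasurable (by fun_prop))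
  exact h.measurable

lemma measurable_snoc {n : ℕ} :
    Measurable fun p : (Fin n → 𝕏) × 𝕏 => (Fin.snoc p.1 p.2 : Fin (n + 1) → 𝕏) := by
  refine measurable_pi_lambda _ fun i => ?_
  refine Fin.lastCases ?_ (fun j => ?_) i
  · simpa using measurable_snd
  · simpa [Function.comp_def] using (measurable_pi_apply (X := fun _ : Fin n => 𝕏) j).comp
      (measurable_fst (β := 𝕏))

variable [MeasurableEq 𝕏]

lemma measurable_postMoment (M : Measure ℝ) [SFinite M] (ρ : Kernel 𝕏 ℝ) [IsSFiniteKernel ρ]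
    {n : ℕ} {A : Set 𝕏} (hA : MeasurableSet A) (k : ℕ) :
    Measurable fun p : (Fin n → 𝕏) × ℝ => postMoment M ρ p.1 A k p.2 := by
  classical
  refine measurable_const.mul ?_
  simp only [postSeries, prod_distinctIn]
  refine measurable_coeff_mul (fun k => ?_) (measurable_coeff_prod _ fun i k => ?_) k
  · simp only [lser, coeff_mk]
    exact ((measurable_lmom M _).comp measurable_snd).div_const _
  · have hs : MeasurableSet {p : (Fin n → 𝕏) × ℝ | i ∈ firstIndices p.1 ∧ p.1 i ∈ A} :=
      (measurable_fst (measurableSet_mem_firstIndices i)).inter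
        (((measurable_pi_apply i).comp measurable_fst) hA)
    have h : ∀ p : (Fin n → 𝕏) × ℝ, coeff k (if i ∈ firstIndices p.1 ∧ p.1 i ∈ A then
        lser (ρ (p.1 i)) (mult p.1 (p.1 i)) p.2 else 1)
        = if p ∈ {p : (Fin n → 𝕏) × ℝ | i ∈ firstIndices p.1 ∧ p.1 i ∈ A} then
          tau ρ (mult p.1 (p.1 i) + k) p.2 (p.1 i) / (k ! : ℝ)
          else coeff k (1 : PowerSeries ℝ) := by
      intro p
      by_cases hp : p ∈ {p : (Fin n → 𝕏) × ℝ | i ∈ firstIndices p.1 ∧ p.1 i ∈ A}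
      · rw [if_pos hp, if_pos (show i ∈ firstIndices p.1 ∧ p.1 i ∈ A from hp), lser, coeff_mk]; rfl
      · rw [if_neg hp, if_neg (show ¬(i ∈ firstIndices p.1 ∧ p.1 i ∈ A) from hp)]
    simp_rw [h]
    refine Measurable.ite hs (Measurable.div_const ?_ _) measurable_const
    have h1 : Measurable fun q : ℕ × (ℝ × 𝕏) => tau ρ q.1 q.2.1 q.2.2 :=
      measurable_from_prod_countable_right fun k => measurable_tau ρ k
    have h2 : Measurable fun p : (Fin n → 𝕏) × ℝ => (mult p.1 (p.1 i) + k, (p.2, p.1 i)) :=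
      (((measurable_mult_apply i).comp measurable_fst).add_const k).prodMk
        (measurable_snd.prodMk ((measurable_pi_apply i).comp measurable_fst))
    exact h1.comp h2

end Measurability

section RefMeasure

lemma card_distinct_le {𝕏 : Type*} {n : ℕ} (x : Fin n → 𝕏) : (distinct x).card ≤ n := by
  classical
  exact Finset.card_image_le.trans (by simp)

variable {𝕏 : Type*} [MeasurableSpace 𝕏] [MeasurableEq 𝕏]

/-- The measure that adds to a sample a new point or one of its values. -/
def addPoint (α : Measure 𝕏) {n : ℕ} (x : Fin n → 𝕏) : Measure 𝕏 :=
  α + ∑ y ∈ distinct x, Measure.dirac y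

/-- The reference measure for the joint law of a sample: the sum over the partitions of the set of
indices of the images of the powers of `α` under the diagonal embeddings. -/
def refMeasure (α : Measure 𝕏) : (n : ℕ) → Measure (Fin n → 𝕏)
  | 0 => Measure.dirac Fin.elim0
  | n + 1 => (refMeasure α n).bind
      fun x => (addPoint α x).map fun z => (Fin.snoc x z : Fin (n + 1) → 𝕏)

lemma lintegral_addPoint (α : Measure 𝕏) {n : ℕ} (x : Fin n → 𝕏) (f : 𝕏 → ℝ≥0∞) :
    ∫⁻ z, f z ∂(addPoint α x) = ∫⁻ z, f z ∂α + ∑ z ∈ distinct x, f z := by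
  rw [addPoint, lintegral_add_measure, lintegral_finsetSum_measure]
  simp only [lintegral_dirac]

variable {α : Measure 𝕏} [SFinite α]

lemma measurable_lintegral_addPoint {n : ℕ} {f : (Fin n → 𝕏) × 𝕏 → ℝ≥0∞} (hf : Measurable f) :
    Measurable fun x => ∫⁻ z, f (x, z) ∂(addPoint α x) := by
  classical
  simp_rw [lintegral_addPoint, sum_distinct]
  refine hf.lintegral_prod_right'.add (Finset.measurable_sum _ fun i _ => ?_)
  exact Measurable.ite (measurableSet_mem_firstIndices i)
    (hf.comp (measurable_id.prodMk (measurable_pi_apply i))) measurable_const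

lemma measurable_map_addPoint (n : ℕ) : Measurable fun x : Fin n → 𝕏 =>
    (addPoint α x).map fun z => (Fin.snoc x z : Fin (n + 1) → 𝕏) := by
  refine Measure.measurable_of_measurable_coe _ fun B hB => ?_
  have h : ∀ x : Fin n → 𝕏, ((addPoint α x).map fun z => (Fin.snoc x z : Fin (n + 1) → 𝕏)) B
      = ∫⁻ z, B.indicator 1 (Fin.snoc x z : Fin (n + 1) → 𝕏) ∂(addPoint α x) := fun x => by
    have hm : Measurable fun z => (Fin.snoc x z : Fin (n + 1) → 𝕏) :=
      measurable_snoc.comp measurable_prodMk_left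
    rw [← lintegral_indicator_one hB, lintegral_map (measurable_one.indicator hB) hm]
  simp_rw [h]
  exact measurable_lintegral_addPoint (f := fun p : (Fin n → 𝕏) × 𝕏 =>
    B.indicator 1 (Fin.snoc p.1 p.2 : Fin (n + 1) → 𝕏))
    ((measurable_one.indicator hB).comp measurable_snoc)

lemma lintegral_refMeasure_succ {n : ℕ} {f : (Fin (n + 1) → 𝕏) → ℝ≥0∞} (hf : Measurable f) :
    ∫⁻ x, f x ∂(refMeasure α (n + 1))
      = ∫⁻ x, (∫⁻ z, f (Fin.snoc x z) ∂α + ∑ z ∈ distinct x, f (Fin.snoc x z))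
        ∂(refMeasure α n) := by
  rw [refMeasure, Measure.lintegral_bind (measurable_map_addPoint n).aemeasurable hf.aemeasurable]
  refine lintegral_congr fun x => ?_
  have hm : Measurable fun z => (Fin.snoc x z : Fin (n + 1) → 𝕏) :=
    measurable_snoc.comp measurable_prodMk_left
  rw [lintegral_map hf hm, lintegral_addPoint]

lemma isFiniteMeasure_refMeasure (α : Measure 𝕏) [IsFiniteMeasure α] (n : ℕ) :
    IsFiniteMeasure (refMeasure α n) := by
  induction n with
  | zero => rw [refMeasure]; infer_instance
  | succ n ih =>
    refine ⟨?_⟩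
    rw [← lintegral_one, lintegral_refMeasure_succ measurable_const]
    simp only [lintegral_one, Finset.sum_const, nsmul_eq_mul, mul_one]
    calc ∫⁻ x : Fin n → 𝕏, (α univ + (distinct x).card) ∂(refMeasure α n)
        ≤ ∫⁻ _ : Fin n → 𝕏, (α univ + n) ∂(refMeasure α n) :=
          lintegral_mono fun x => by gcongr; exact card_distinct_le x
      _ < ∞ := by
          rw [lintegral_const]
          exact ENNReal.mul_lt_top (by simp) (measure_lt_top _ _)

end RefMeasure

section Moments

/-- The indicator of a box. -/
def boxInd {𝕏 : Type*} {n : ℕ} (B : Fin n → Set 𝕏) (x : Fin n → 𝕏) : ℝ≥0∞ :=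
  ∏ j, (B j).indicator 1 (x j)

lemma boxInd_snoc {𝕏 : Type*} {n : ℕ} (B : Fin n → Set 𝕏) (C : Set 𝕏) (x : Fin n → 𝕏) (z : 𝕏) :
    boxInd (Fin.snoc B C : Fin (n + 1) → Set 𝕏) (Fin.snoc x z)
      = boxInd B x * C.indicator 1 z := by
  simp only [boxInd, Fin.prod_univ_castSucc, Fin.snoc_castSucc, Fin.snoc_last]

variable {Ω 𝕏 : Type*} [MeasurableSpace Ω] [MeasurableSpace 𝕏] {Pr : Measure Ω}
  {α : Measure 𝕏} {ρ : Kernel 𝕏 ℝ} {N : Ω → Measure (ℝ × 𝕏)} {ι : Type*} [Fintype ι]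

lemma measurable_boxInd {n : ℕ} {B : Fin n → Set 𝕏} (hB : ∀ j, MeasurableSet (B j)) :
    Measurable (boxInd B) :=
  Finset.measurable_prod _ fun j _ => (measurable_one.indicator (hB j)).comp (measurable_pi_apply j)

instance sFinite_massLaw (N : Ω → Measure (ℝ × 𝕏)) (Pr : Measure Ω) [SFinite Pr] (A : Set 𝕏) :
    SFinite (massLaw N Pr A) := by
  unfold massLaw; infer_instance

/-- The joint posterior moment for the sets `A i` with the exponents `m i`. -/
def postProd (N : Ω → Measure (ℝ × 𝕏)) (Pr : Measure Ω) (ρ : Kernel 𝕏 ℝ) (A : ι → Set 𝕏)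
    (m : ι → ℕ) {n : ℕ} (x : Fin n → 𝕏) (u : ℝ) : ℝ :=
  ∏ i, postMoment (massLaw N Pr (A i)) ρ x (A i) (m i) u

lemma measurable_postProd [MeasurableEq 𝕏] [SFinite Pr] [IsSFiniteKernel ρ] {A : ι → Set 𝕏}
    (hA : ∀ i, MeasurableSet (A i)) (m : ι → ℕ) (n : ℕ) :
    Measurable fun p : (Fin n → 𝕏) × ℝ => postProd N Pr ρ A m p.1 p.2 :=
  Finset.measurable_prod _ fun i _ => measurable_postMoment _ _ (hA i) _

lemma measurable_ofReal_postProd [MeasurableEq 𝕏] [SFinite Pr] [IsSFiniteKernel ρ] {A : ι → Set 𝕏}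
    (hA : ∀ i, MeasurableSet (A i)) (m : ι → ℕ) (n : ℕ) (u : ℝ) :
    Measurable fun x : Fin n → 𝕏 => ENNReal.ofReal (postProd N Pr ρ A m x u) := by
  have h1 : Measurable fun x : Fin n → 𝕏 => (x, u) := measurable_prodMk_right
  have h2 := (measurable_postProd (N := N) (Pr := Pr) (ρ := ρ) hA m n).comp h1
  exact ENNReal.measurable_ofReal.comp h2

lemma postProd_nonneg (hρ : IsLevyKernel α ρ) (hN : Measurable N) {A : ι → Set 𝕏}
    (hA : ∀ i, MeasurableSet (A i)) (m : ι → ℕ) {n : ℕ} (x : Fin n → 𝕏) (u : ℝ) :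
    0 ≤ postProd N Pr ρ A m x u :=
  Finset.prod_nonneg fun i _ => postMoment_nonneg
    (fun k => lmom_massLaw_nonneg hN (hA i) k u) (fun k y => hρ.tau_nonneg k u y) _

lemma postProd_snoc [DecidableEq ι] {A : ι → Set 𝕏} (hd : Pairwise fun i j => Disjoint (A i) (A j))
    {i : ι} {z : 𝕏} (hz : z ∈ A i) (m : ι → ℕ) {n : ℕ} (x : Fin n → 𝕏) (u : ℝ) :
    postProd N Pr ρ A m (Fin.snoc x z : Fin (n + 1) → 𝕏) u
      = postMoment (massLaw N Pr (A i)) ρ (Fin.snoc x z : Fin (n + 1) → 𝕏) (A i) (m i) u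
        * ∏ j ∈ Finset.univ.erase i, postMoment (massLaw N Pr (A j)) ρ x (A j) (m j) u := by
  rw [postProd, ← Finset.mul_prod_erase _ _ (Finset.mem_univ i)]
  congr 1
  refine Finset.prod_congr rfl fun j hj => ?_
  have hzj : z ∉ A j := fun h => disjoint_left.1 (hd (Finset.ne_of_mem_erase hj)) h hz
  rw [postMoment, postMoment, postSeries_snoc_of_notMem hzj]

lemma postProd_add_single [DecidableEq ι] (A : ι → Set 𝕏) (i : ι) (m : ι → ℕ) {n : ℕ}
    (x : Fin n → 𝕏) (u : ℝ) :
    postProd N Pr ρ A (m + Pi.single i 1) x u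
      = postMoment (massLaw N Pr (A i)) ρ x (A i) (m i + 1) u
        * ∏ j ∈ Finset.univ.erase i, postMoment (massLaw N Pr (A j)) ρ x (A j) (m j) u := by
  rw [postProd, ← Finset.mul_prod_erase _ _ (Finset.mem_univ i)]
  congr 1
  · simp
  · refine Finset.prod_congr rfl fun j hj => ?_
    rw [Pi.add_apply, Pi.single_eq_of_ne (Finset.ne_of_mem_erase hj), add_zero]

variable [IsSFiniteKernel ρ] [NullSingletonClass α] [IsProbabilityMeasure Pr]

lemma ofReal_postProd_add_single [DecidableEq ι] (hρ : IsLevyKernel α ρ)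
    (hN : IsPoissonRandomMeasure N (levyIntensity α ρ) Pr) {A : ι → Set 𝕏}
    (hA : ∀ i, MeasurableSet (A i)) (hd : Pairwise fun i j => Disjoint (A i) (A j))
    (i : ι) (m : ι → ℕ) {n : ℕ} (x : Fin n → 𝕏) {u : ℝ} (hu : 0 < u) :
    ENNReal.ofReal (postProd N Pr ρ A (m + Pi.single i 1) x u)
      = ∫⁻ z in A i, ENNReal.ofReal (postProd N Pr ρ A m (Fin.snoc x z : Fin (n + 1) → 𝕏) u) ∂α
        + ∑ z ∈ distinctIn x (A i),
          ENNReal.ofReal (postProd N Pr ρ A m (Fin.snoc x z : Fin (n + 1) → 𝕏) u) := by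
  have hM0 : ∀ i k, 0 ≤ lmom (massLaw N Pr (A i)) k u := fun i k =>
    lmom_massLaw_nonneg hN.measurable (hA i) k u
  have hR : 0 ≤ ∏ j ∈ Finset.univ.erase i, postMoment (massLaw N Pr (A j)) ρ x (A j) (m j) u :=
    Finset.prod_nonneg fun j _ =>
      postMoment_nonneg (hM0 j) (fun k y => hρ.tau_nonneg k u y) _
  have h1 : ∀ z ∈ A i, ENNReal.ofReal (postProd N Pr ρ A m (Fin.snoc x z : Fin (n + 1) → 𝕏) u)
      = ENNReal.ofReal (postMoment (massLaw N Pr (A i)) ρ (Fin.snoc x z : Fin (n + 1) → 𝕏)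
          (A i) (m i) u) * ENNReal.ofReal
        (∏ j ∈ Finset.univ.erase i, postMoment (massLaw N Pr (A j)) ρ x (A j) (m j) u) := by
    intro z hz
    rw [postProd_snoc hd hz, ENNReal.ofReal_mul' hR]
  rw [postProd_add_single, ENNReal.ofReal_mul' hR,
    ofReal_postMoment_succ hρ (hA i) (hM0 i) hu (derivative_lser_massLaw hρ hN (hA i) hu),
    setLIntegral_congr_fun (hA i) h1,
    Finset.sum_congr rfl fun z hz => h1 z (mem_distinctIn.1 hz).2, ← Finset.sum_mul, add_mul,
    lintegral_mul_const' _ _ ENNReal.ofReal_ne_top]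

variable [MeasurableEq 𝕏]

lemma lintegral_boxInd_snoc [DecidableEq ι] [SFinite α] (hρ : IsLevyKernel α ρ)
    (hN : IsPoissonRandomMeasure N (levyIntensity α ρ) Pr) {A : ι → Set 𝕏}
    (hA : ∀ i, MeasurableSet (A i)) (hd : Pairwise fun i j => Disjoint (A i) (A j))
    (i : ι) (m : ι → ℕ) {n : ℕ} {B : Fin n → Set 𝕏} (hB : ∀ j, MeasurableSet (B j)) {u : ℝ}
    (hu : 0 < u) :
    ∫⁻ x, boxInd (Fin.snoc B (A i) : Fin (n + 1) → Set 𝕏) x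
        * ENNReal.ofReal (postProd N Pr ρ A m x u) ∂(refMeasure α (n + 1))
      = ∫⁻ x, boxInd B x * ENNReal.ofReal (postProd N Pr ρ A (m + Pi.single i 1) x u)
        ∂(refMeasure α n) := by
  classical
  have hB' : ∀ j, MeasurableSet ((Fin.snoc B (A i) : Fin (n + 1) → Set 𝕏) j) := by
    intro j
    refine Fin.lastCases ?_ (fun j => ?_) j
    · simpa using hA i
    · simpa using hB j
  have hm : Measurable fun x : Fin (n + 1) → 𝕏 => ENNReal.ofReal (postProd N Pr ρ A m x u) :=
    measurable_ofReal_postProd hA m (n + 1) u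
  have hb := measurable_boxInd hB'
  have hf : Measurable fun x : Fin (n + 1) → 𝕏 =>
      boxInd (Fin.snoc B (A i) : Fin (n + 1) → Set 𝕏) x
        * ENNReal.ofReal (postProd N Pr ρ A m x u) := hb.mul hm
  rw [lintegral_refMeasure_succ hf]
  refine lintegral_congr fun x => ?_
  simp only [boxInd_snoc]
  have hbt : boxInd B x ≠ ∞ := by
    refine ENNReal.prod_ne_top fun j _ => ?_
    by_cases h : x j ∈ B j <;> simp [h]
  have h1 : ∀ z, boxInd B x * (A i).indicator 1 z
      * ENNReal.ofReal (postProd N Pr ρ A m (Fin.snoc x z : Fin (n + 1) → 𝕏) u)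
      = boxInd B x * (A i).indicator (fun z =>
        ENNReal.ofReal (postProd N Pr ρ A m (Fin.snoc x z : Fin (n + 1) → 𝕏) u)) z := by
    intro z
    by_cases h : z ∈ A i <;> simp [h]
  simp_rw [h1]
  rw [lintegral_const_mul' _ _ hbt, lintegral_indicator (hA i), ← Finset.mul_sum, ← mul_add,
    ofReal_postProd_add_single hρ hN hA hd i m x hu, distinctIn, Finset.sum_filter]
  congr! 3

end Moments

section Partitions

variable {𝕏 : Type*}

lemma prod_prod_distinctIn {ι : Type*} [Fintype ι] {A : ι → Set 𝕏}
    (hd : Pairwise fun i j => Disjoint (A i) (A j))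
    (hc : ⋃ i, A i = univ) {R : Type*} [CommMonoid R] {n : ℕ} (x : Fin n → 𝕏) (g : 𝕏 → R) :
    ∏ i, ∏ y ∈ distinctIn x (A i), g y = ∏ y ∈ distinct x, g y := by
  classical
  simp only [distinctIn, Finset.prod_filter]
  rw [Finset.prod_comm]
  refine Finset.prod_congr rfl fun y _ => ?_
  obtain ⟨i, hi⟩ := mem_iUnion.1 (hc ▸ mem_univ y : y ∈ ⋃ i, A i)
  rw [Finset.prod_eq_single i]
  · rw [if_pos hi]
  · intro j _ hj
    rw [if_neg fun h => disjoint_left.1 (hd hj) h hi]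
  · simp

/-- The cell of the partition generated by the sets `E j`. -/
def cell {n : ℕ} (E : Fin n → Set 𝕏) (σ : Fin n → Bool) : Set 𝕏 := {z | ∀ j, z ∈ E j ↔ σ j = true}

lemma disjoint_cell {n : ℕ} (E : Fin n → Set 𝕏) :
    Pairwise fun σ σ' => Disjoint (cell E σ) (cell E σ') := by
  intro σ σ' h
  refine disjoint_left.2 fun z hz hz' => h (funext fun j => ?_)
  have := (hz j).symm.trans (hz' j)
  exact Bool.eq_iff_iff.2 this

lemma iUnion_cell {n : ℕ} (E : Fin n → Set 𝕏) : ⋃ σ, cell E σ = univ := by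
  classical
  refine eq_univ_of_forall fun z => mem_iUnion.2 ⟨fun j => decide (z ∈ E j), fun j => by simp⟩

variable [MeasurableSpace 𝕏]

lemma measurableSet_cell {n : ℕ} {E : Fin n → Set 𝕏} (hE : ∀ j, MeasurableSet (E j))
    (σ : Fin n → Bool) : MeasurableSet (cell E σ) := by
  have h : cell E σ = ⋂ j, if σ j = true then E j else (E j)ᶜ := by
    ext z
    simp only [cell, mem_ofPred_eq, mem_iInter]
    refine forall_congr' fun j => ?_
    split_ifs with h <;> simp [h]
  rw [h]
  refine MeasurableSet.iInter fun j => ?_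
  split_ifs
  · exact hE j
  · exact (hE j).compl

lemma measure_eq_sum_cell (μ : Measure 𝕏) {n : ℕ} {E : Fin n → Set 𝕏}
    (hE : ∀ j, MeasurableSet (E j)) (j : Fin n) :
    μ (E j) = ∑ σ, if σ j = true then μ (cell E σ) else 0 := by
  have h : E j = ⋃ σ, (if σ j = true then cell E σ else ∅) := by
    classical
    ext z
    rw [mem_iUnion]
    constructor
    · intro hz
      refine ⟨fun j => decide (z ∈ E j), ?_⟩
      rw [if_pos (by simpa using hz)]
      intro j; simp
    · rintro ⟨σ, hσ⟩
      split_ifs at hσ with h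
      · exact (hσ j).2 h
      · exact absurd hσ (by simp)
  conv_lhs => rw [h]
  rw [measure_iUnion, tsum_fintype]
  · refine Finset.sum_congr rfl fun σ _ => ?_
    split_ifs <;> simp
  · intro σ σ' hσ
    have := disjoint_cell E hσ
    simp only [Function.onFun]
    split_ifs <;> simp [this]
  · intro σ
    split_ifs
    · exact measurableSet_cell hE σ
    · exact MeasurableSet.empty

lemma prod_measure_eq_sum_cell {n : ℕ} {E : Fin n → Set 𝕏} (hE : ∀ j, MeasurableSet (E j))
    (μ : Fin n → Measure 𝕏) :
    ∏ j, μ j (E j) = ∑ c : Fin n → (Fin n → Bool), if ∀ j, c j j = true then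
      ∏ j, μ j (cell E (c j)) else 0 := by
  classical
  rw [Finset.prod_congr rfl fun j _ => measure_eq_sum_cell (μ j) hE j, Finset.prod_univ_sum,
    Fintype.piFinset_univ]
  refine Finset.sum_congr rfl fun c _ => ?_
  split_ifs with h
  · exact Finset.prod_congr rfl fun j _ => if_pos (h j)
  · obtain ⟨j, hj⟩ := not_forall.1 h
    exact Finset.prod_eq_zero (Finset.mem_univ j) (if_neg hj)

lemma boxInd_eq_prod_dirac {n : ℕ} {E : Fin n → Set 𝕏} (hE : ∀ j, MeasurableSet (E j))
    (x : Fin n → 𝕏) : boxInd E x = ∏ j, Measure.dirac (x j) (E j) :=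
  Finset.prod_congr rfl fun j _ => (Measure.dirac_apply' _ (hE j)).symm

end Partitions

section JointMoments

variable {Ω 𝕏 : Type*} [MeasurableSpace Ω] [MeasurableSpace 𝕏] {Pr : Measure Ω}
  {α : Measure 𝕏} {ρ : Kernel 𝕏 ℝ} {N : Ω → Measure (ℝ × 𝕏)} {ι : Type*} [Fintype ι]

/-- The factor `e^{-ψ(u)} ∏_y τ_{n_y}(u, y)` of the latent weight. -/
def sampleWeight (α : Measure 𝕏) (ρ : Kernel 𝕏 ℝ) {n : ℕ} (x : Fin n → 𝕏) (u : ℝ) : ℝ :=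
  Real.exp (-psi α ρ univ u) * ∏ y ∈ distinct x, tau ρ (mult x y) u y

lemma prod_pow_sum_single [DecidableEq ι] {R : Type*} [CommMonoid R] {n : ℕ} (c : Fin n → ι)
    (r : ι → R) : ∏ i, r i ^ ((∑ j, Pi.single (c j) 1 : ι → ℕ) i) = ∏ j, r (c j) := by
  simp only [Finset.sum_apply, ← Finset.prod_pow_eq_pow_sum]
  rw [Finset.prod_comm]
  refine Finset.prod_congr rfl fun j _ => ?_
  rw [Finset.prod_eq_single (c j)]
  · simp
  · intro i _ hi; simp [Pi.single_eq_of_ne hi]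
  · simp

lemma measure_univ_eq_sum (μ : Measure 𝕏) {A : ι → Set 𝕏} (hA : ∀ i, MeasurableSet (A i))
    (hd : Pairwise fun i j => Disjoint (A i) (A j)) (hc : ⋃ i, A i = univ) :
    μ univ = ∑ i, μ (A i) := by
  rw [← hc, measure_iUnion hd hA, tsum_fintype]

variable [IsSFiniteKernel ρ] [IsProbabilityMeasure Pr]

lemma lintegral_exp_mul_prod_crm [DecidableEq ι] (hρ : IsLevyKernel α ρ)
    (hN : IsPoissonRandomMeasure N (levyIntensity α ρ) Pr) {A : ι → Set 𝕏}
    (hA : ∀ i, MeasurableSet (A i)) (hd : Pairwise fun i j => Disjoint (A i) (A j))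
    (hc : ⋃ i, A i = univ) {n : ℕ} (c : Fin n → ι) {u : ℝ} (hu : 0 < u) :
    ∫⁻ ω, ENNReal.ofReal (Real.exp (-(u * (crm N ω univ).toReal))) * ∏ j, crm N ω (A (c j)) ∂Pr
      = ENNReal.ofReal (∏ i, lmom (massLaw N Pr (A i)) ((∑ j, Pi.single (c j) 1 : ι → ℕ) i) u) := by
  set k : ι → ℕ := ∑ j, Pi.single (c j) 1
  have hnn : ∀ ω, 0 ≤ ∏ i, ((crm N ω (A i)).toReal ^ k i
      * Real.exp (-(u * (crm N ω (A i)).toReal))) := fun ω =>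
    Finset.prod_nonneg fun i _ => by positivity
  have hint : Integrable (fun ω => ∏ i, ((crm N ω (A i)).toReal ^ k i
      * Real.exp (-(u * (crm N ω (A i)).toReal)))) Pr := by
    refine (integrable_const (∏ i, ((k i)! : ℝ) / u ^ k i)).mono' ?_ (ae_of_all _ fun ω => ?_)
    · refine (Finset.measurable_prod _ fun i _ => ?_).aestronglyMeasurable
      have := (measurable_crm_apply hN.measurable (hA i)).ennreal_toReal
      fun_prop
    · rw [Real.norm_of_nonneg (hnn ω)]
      exact Finset.prod_le_prod (fun i _ => by positivity)
        fun i _ => pow_mul_exp_neg_le _ hu ENNReal.toReal_nonneg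
  rw [← integral_prod_crm hρ hN hA hd k hu, ofReal_integral_eq_lintegral_ofReal hint
    (ae_of_all _ hnn)]
  refine lintegral_congr_ae ?_
  filter_upwards [ae_crm_univ_ne_top hρ hN] with ω hω
  have hfin : ∀ i, crm N ω (A i) ≠ ∞ := fun i => ne_top_of_le_ne_top hω (crm_le_univ N ω _)
  rw [Finset.prod_mul_distrib, prod_pow_sum_single, ← Real.exp_sum, mul_comm,
    ENNReal.ofReal_mul (Finset.prod_nonneg fun j _ => ENNReal.toReal_nonneg),
    ENNReal.ofReal_prod_of_nonneg fun j _ => ENNReal.toReal_nonneg]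
  congr 1
  · exact Finset.prod_congr rfl fun j _ => (ENNReal.ofReal_toReal (hfin _)).symm
  · rw [measure_univ_eq_sum _ hA hd hc, ENNReal.toReal_sum fun i _ => hfin i, Finset.mul_sum,
      Finset.sum_neg_distrib]

lemma prod_lmom_massLaw_zero (hρ : IsLevyKernel α ρ)
    (hN : IsPoissonRandomMeasure N (levyIntensity α ρ) Pr) {A : ι → Set 𝕏}
    (hA : ∀ i, MeasurableSet (A i)) (hd : Pairwise fun i j => Disjoint (A i) (A j))
    (hc : ⋃ i, A i = univ) {u : ℝ} (hu : 0 < u) :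
    ∏ i, lmom (massLaw N Pr (A i)) 0 u = Real.exp (-psi α ρ univ u) := by
  have h := integral_prod_crm hρ hN hA hd 0 hu
  simp only [Pi.zero_apply] at h
  rw [← h, ← lmom_massLaw_zero hρ hN MeasurableSet.univ hu,
    lmom_massLaw hN.measurable MeasurableSet.univ]
  refine integral_congr_ae ?_
  filter_upwards [ae_crm_univ_ne_top hρ hN] with ω hω
  have hfin : ∀ i, crm N ω (A i) ≠ ∞ := fun i => ne_top_of_le_ne_top hω (crm_le_univ N ω _)
  simp only [pow_zero, one_mul]
  rw [← Real.exp_sum, measure_univ_eq_sum _ hA hd hc, ENNReal.toReal_sum fun i _ => hfin i,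
    Finset.mul_sum, Finset.sum_neg_distrib]

lemma postProd_zero (hρ : IsLevyKernel α ρ)
    (hN : IsPoissonRandomMeasure N (levyIntensity α ρ) Pr) {A : ι → Set 𝕏}
    (hA : ∀ i, MeasurableSet (A i)) (hd : Pairwise fun i j => Disjoint (A i) (A j))
    (hc : ⋃ i, A i = univ) {n : ℕ} (x : Fin n → 𝕏) {u : ℝ} (hu : 0 < u) :
    postProd N Pr ρ A 0 x u = sampleWeight α ρ x u := by
  classical
  have h1 : ∀ i, postMoment (massLaw N Pr (A i)) ρ x (A i) 0 u
      = lmom (massLaw N Pr (A i)) 0 u * ∏ y ∈ distinctIn x (A i), tau ρ (mult x y) u y := by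
    intro i
    simp [postMoment, postSeries, lser, map_prod, tau_eq_lmom]
  simp only [postProd, Pi.zero_apply, h1]
  rw [Finset.prod_mul_distrib, prod_lmom_massLaw_zero hρ hN hA hd hc hu, prod_prod_distinctIn hd hc,
    sampleWeight]

variable [MeasurableEq 𝕏]

lemma measurable_ofReal_sampleWeight (hρ : IsLevyKernel α ρ)
    (hN : IsPoissonRandomMeasure N (levyIntensity α ρ) Pr) (n : ℕ) {u : ℝ} (hu : 0 < u) :
    Measurable fun x : Fin n → 𝕏 => ENNReal.ofReal (sampleWeight α ρ x u) := by
  have h := measurable_ofReal_postProd (N := N) (Pr := Pr) (ρ := ρ) (ι := Unit)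
    (A := fun _ => univ) (fun _ => MeasurableSet.univ) 0 n u
  have h1 : ∀ x : Fin n → 𝕏, postProd N Pr ρ (fun _ : Unit => univ) 0 x u
      = sampleWeight α ρ x u := fun x =>
    postProd_zero hρ hN (fun _ => MeasurableSet.univ)
      (fun i j h => absurd (Subsingleton.elim i j) h) (iUnion_const univ) x hu
  simp_rw [← h1]
  exact h

variable [NullSingletonClass α] [SFinite α]

lemma lintegral_boxInd_color [DecidableEq ι] (hρ : IsLevyKernel α ρ)
    (hN : IsPoissonRandomMeasure N (levyIntensity α ρ) Pr) {A : ι → Set 𝕏}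
    (hA : ∀ i, MeasurableSet (A i)) (hd : Pairwise fun i j => Disjoint (A i) (A j))
    {n : ℕ} (c : Fin n → ι) (m : ι → ℕ) {u : ℝ} (hu : 0 < u) :
    ∫⁻ x, boxInd (fun j => A (c j)) x * ENNReal.ofReal (postProd N Pr ρ A m x u)
        ∂(refMeasure α n)
      = ENNReal.ofReal (∏ i, lmom (massLaw N Pr (A i))
          ((m + ∑ j, Pi.single (c j) 1 : ι → ℕ) i) u) := by
  induction n generalizing m with
  | zero =>
    have h0 : distinct (Fin.elim0 : Fin 0 → 𝕏) = ∅ := by simp [distinct]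
    have hf : Measurable fun x : Fin 0 → 𝕏 => boxInd (fun j => A (c j)) x
        * ENNReal.ofReal (postProd N Pr ρ A m x u) :=
      (measurable_boxInd fun j => hA _).mul (measurable_ofReal_postProd hA m 0 u)
    rw [refMeasure, lintegral_dirac' _ hf]
    simp only [boxInd, Finset.univ_eq_empty, Finset.prod_empty, one_mul, Finset.sum_empty, add_zero]
    congr 1
    refine Finset.prod_congr rfl fun i _ => ?_
    have h3 : ((m i)! : ℝ) ≠ 0 := by positivity
    rw [postMoment, postSeries, distinctIn, h0, Finset.filter_empty, Finset.prod_empty, mul_one,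
      lser, PowerSeries.coeff_mk, zero_add, mul_div_cancel₀ _ h3]
  | succ n ih =>
    have h1 : (fun j => A (c j)) = (Fin.snoc (fun j : Fin n => A (c j.castSucc))
        (A (c (Fin.last n))) : Fin (n + 1) → Set 𝕏) := by
      funext j
      refine Fin.lastCases ?_ (fun j => ?_) j
      · simp
      · simp
    rw [h1, lintegral_boxInd_snoc hρ hN hA hd (c (Fin.last n)) m (fun j => hA _) hu,
      ih (fun j => c j.castSucc), Fin.sum_univ_castSucc, add_assoc, add_comm (Pi.single _ _)]

/-- The joint moments of the masses of arbitrary sets, exponentially tilted by the total mass. -/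
theorem lintegral_exp_mul_prod_crm_eq (hρ : IsLevyKernel α ρ)
    (hN : IsPoissonRandomMeasure N (levyIntensity α ρ) Pr) {n : ℕ} {E : Fin n → Set 𝕏}
    (hE : ∀ j, MeasurableSet (E j)) {u : ℝ} (hu : 0 < u) :
    ∫⁻ ω, ENNReal.ofReal (Real.exp (-(u * (crm N ω univ).toReal))) * ∏ j, crm N ω (E j) ∂Pr
      = ∫⁻ x, boxInd E x * ENNReal.ofReal (sampleWeight α ρ x u) ∂(refMeasure α n) := by
  classical
  have hcm := measurable_crm_apply (N := N) hN.measurable (MeasurableSet.univ (α := 𝕏))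
  have hC := measurableSet_cell hE
  simp_rw [boxInd_eq_prod_dirac hE, prod_measure_eq_sum_cell hE, Finset.sum_mul, Finset.mul_sum]
  rw [lintegral_finsetSum, lintegral_finsetSum]
  · refine Finset.sum_congr rfl fun c _ => ?_
    split_ifs with h
    · rw [lintegral_exp_mul_prod_crm hρ hN hC (disjoint_cell E) (iUnion_cell E) c hu]
      have h1 := lintegral_boxInd_color hρ hN hC (disjoint_cell E) c 0 hu
      simp_rw [postProd_zero hρ hN hC (disjoint_cell E) (iUnion_cell E) _ hu,
        boxInd_eq_prod_dirac fun j => hC (c j)] at h1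
      rw [h1, zero_add]
    · simp
  · intro c _
    split_ifs
    · have h1 : Measurable fun x : Fin n → 𝕏 => ∏ j, Measure.dirac (x j) (cell E (c j)) := by
        simp_rw [← boxInd_eq_prod_dirac fun j => hC (c j)]
        exact measurable_boxInd fun j => hC (c j)
      exact h1.mul (measurable_ofReal_sampleWeight hρ hN n hu)
    · simp
  · intro c _
    split_ifs
    · refine Measurable.mul (by fun_prop) (Finset.measurable_prod _ fun j _ => ?_)
      exact measurable_crm_apply hN.measurable (hC _)
    · simp

/-- The joint moments of the masses of arbitrary sets and of the members of a partition. -/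
theorem lintegral_exp_mul_prod_pow_crm [DecidableEq ι] (hρ : IsLevyKernel α ρ)
    (hN : IsPoissonRandomMeasure N (levyIntensity α ρ) Pr) {A : ι → Set 𝕏}
    (hA : ∀ i, MeasurableSet (A i)) (hd : Pairwise fun i j => Disjoint (A i) (A j))
    (hc : ⋃ i, A i = univ) (m : ι → ℕ) {n : ℕ} {B : Fin n → Set 𝕏}
    (hB : ∀ j, MeasurableSet (B j)) {u : ℝ} (hu : 0 < u) :
    ∫⁻ ω, ENNReal.ofReal (Real.exp (-(u * (crm N ω univ).toReal)))
        * ((∏ i, crm N ω (A i) ^ m i) * ∏ j, crm N ω (B j)) ∂Pr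
      = ∫⁻ x, boxInd B x * ENNReal.ofReal (postProd N Pr ρ A m x u) ∂(refMeasure α n) := by
  obtain ⟨K, hK⟩ : ∃ K, ∑ i, m i = K := ⟨_, rfl⟩
  induction K generalizing n m with
  | zero =>
    have hm : m = 0 := funext fun i => (Finset.sum_eq_zero_iff.1 hK) i (Finset.mem_univ i)
    subst hm
    simp_rw [postProd_zero hρ hN hA hd hc _ hu, ← lintegral_exp_mul_prod_crm_eq hρ hN hB hu]
    simp
  | succ K ih =>
    obtain ⟨i, -, hi⟩ := Finset.exists_ne_zero_of_sum_ne_zero (hK.trans_ne K.succ_ne_zero)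
    obtain ⟨m', rfl⟩ : ∃ m' : ι → ℕ, m = m' + Pi.single i 1 := by
      refine ⟨m - Pi.single i 1, (tsub_add_cancel_of_le ?_).symm⟩
      intro j
      by_cases hj : j = i
      · subst hj; simpa using Nat.one_le_iff_ne_zero.2 hi
      · simp [Pi.single_eq_of_ne hj]
    have hK' : ∑ i, m' i = K := by
      simp only [Pi.add_apply, Finset.sum_add_distrib, Finset.sum_pi_single', Finset.mem_univ,
        if_true] at hK
      omega
    have hB' : ∀ j, MeasurableSet ((Fin.snoc B (A i) : Fin (n + 1) → Set 𝕏) j) := by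
      intro j
      refine Fin.lastCases ?_ (fun j => ?_) j
      · simpa using hA i
      · simpa using hB j
    rw [← lintegral_boxInd_snoc hρ hN hA hd i m' hB hu, ← ih m' hB' hK']
    refine lintegral_congr fun ω => ?_
    rw [Fin.prod_univ_castSucc]
    simp only [Fin.snoc_castSucc, Fin.snoc_last, Pi.add_apply, pow_add, Finset.prod_mul_distrib]
    have h1 : ∏ j, crm N ω (A j) ^ (Pi.single i 1 : ι → ℕ) j = crm N ω (A i) := by
      rw [Finset.prod_eq_single i]
      · simp
      · intro j _ hj; simp [Pi.single_eq_of_ne hj]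
      · simp
    rw [h1]
    ring

end JointMoments

section Disintegration

variable {Ω E : Type*} [MeasurableSpace Ω] [MeasurableSpace E] {Pr : Measure Ω}

/-- A measure on a finite power is determined by its values on boxes. -/
lemma ext_of_boxInd {𝕏 : Type*} [MeasurableSpace 𝕏] {n : ℕ} {μ ν : Measure (Fin n → 𝕏)}
    [IsFiniteMeasure μ] (h : ∀ B : Fin n → Set 𝕏, (∀ i, MeasurableSet (B i)) →
      ∫⁻ x, boxInd B x ∂μ = ∫⁻ x, boxInd B x ∂ν) : μ = ν := by
  have hb : ∀ B : Fin n → Set 𝕏, boxInd B = (Set.pi univ B).indicator 1 := by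
    intro B
    funext x
    by_cases hx : x ∈ Set.pi univ B
    · rw [indicator_of_mem hx]
      exact Finset.prod_eq_one fun i _ => indicator_of_mem (hx i (mem_univ i)) 1
    · rw [indicator_of_notMem hx]
      simp only [Set.mem_pi, mem_univ, true_imp_iff, not_forall] at hx
      obtain ⟨i, hi⟩ := hx
      exact Finset.prod_eq_zero (Finset.mem_univ i) (indicator_of_notMem hi _)
  have h' : ∀ B : Fin n → Set 𝕏, (∀ i, MeasurableSet (B i)) →
      μ (Set.pi univ B) = ν (Set.pi univ B) := by
    intro B hB
    have hm : MeasurableSet (Set.pi univ B) := MeasurableSet.univ_pi hB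
    have := h B hB
    simpa only [hb, lintegral_indicator_one hm] using this
  refine ext_of_generate_finite _ generateFrom_pi.symm isPiSystem_pi ?_ ?_
  · rintro _ ⟨B, hB, rfl⟩
    exact h' B fun i => hB i (mem_univ i)
  · have := h' (fun _ => univ) fun _ => MeasurableSet.univ
    simpa using this

variable [IsProbabilityMeasure Pr] {L : Measure E} {w f : E → ℝ≥0∞} {X : Ω → E}

lemma ae_density_ne (hX : Measurable X) (hw : Measurable w) (hlaw : Pr.map X = L.withDensity w) :
    ∀ᵐ ω ∂Pr, w (X ω) ≠ 0 ∧ w (X ω) ≠ ∞ := by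
  have h1 : ∫⁻ x, w x ∂L ≠ ∞ := by
    rw [← setLIntegral_univ, ← withDensity_apply _ MeasurableSet.univ, ← hlaw,
      Measure.map_apply hX MeasurableSet.univ]
    simp
  have h2 : ∀ᵐ x ∂(Pr.map X), w x ≠ 0 ∧ w x ≠ ∞ := by
    rw [hlaw, ae_withDensity_iff hw]
    filter_upwards [ae_lt_top hw h1] with x hx h0
    exact ⟨h0, hx.ne⟩
  exact ae_of_ae_map hX.aemeasurable h2

/-- The conditional expectation given `X` in terms of densities with respect to a common reference
measure. -/
lemma condExp_toReal_of_density (hX : Measurable X) (hw : Measurable w) (hf : Measurable f)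
    (hlaw : Pr.map X = L.withDensity w) {Z : Ω → ℝ≥0∞} (hZ : Measurable Z)
    (hZi : ∫⁻ ω, Z ω ∂Pr ≠ ∞) (hlawZ : (Pr.withDensity Z).map X = L.withDensity f) :
    (∀ᵐ ω ∂Pr, f (X ω) ≠ ∞) ∧
      Pr[fun ω => (Z ω).toReal | MeasurableSpace.comap X inferInstance]
        =ᵐ[Pr] fun ω => (f (X ω)).toReal / (w (X ω)).toReal := by
  have hset : ∀ {s : Set E}, MeasurableSet s → ∫⁻ ω in X ⁻¹' s, Z ω ∂Pr = ∫⁻ x in s, f x ∂L := by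
    intro s hs
    rw [← withDensity_apply _ (hX hs), ← withDensity_apply _ hs, ← hlawZ, Measure.map_apply hX hs]
  have hfi : ∫⁻ x, f x ∂L ≠ ∞ := by
    have := hset MeasurableSet.univ
    simp only [preimage_univ, Measure.restrict_univ] at this
    rwa [← this]
  have hne := ae_density_ne hX hw hlaw
  have hac : Pr.map X ≪ L := hlaw ▸ withDensity_absolutelyContinuous L w
  have hftop : ∀ᵐ ω ∂Pr, f (X ω) ≠ ∞ := by
    have h1 : ∀ᵐ x ∂(Pr.map X), f x ≠ ∞ :=
      hac.ae_le ((ae_lt_top hf hfi).mono fun x hx => hx.ne)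
    exact ae_of_ae_map hX.aemeasurable h1
  refine ⟨hftop, ?_⟩
  have hw0 : ∀ᵐ x ∂L, w x = 0 → f x = 0 := by
    have hm : MeasurableSet {x | w x = 0} := hw (measurableSet_singleton 0)
    have h1 : Pr (X ⁻¹' {x | w x = 0}) = 0 := by
      rw [measure_eq_zero_iff_ae_notMem]
      filter_upwards [hne] with ω hω h using hω.1 h
    have h2 := hset hm
    rw [setLIntegral_measure_zero _ _ h1] at h2
    have h3 := (lintegral_eq_zero_iff hf).1 h2.symm
    rw [Filter.EventuallyEq, ae_restrict_iff' hm] at h3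
    exact h3
  have hwt : ∀ᵐ x ∂L, w x ≠ ∞ := by
    have h1 : ∫⁻ x, w x ∂L ≠ ∞ := by
      rw [← setLIntegral_univ, ← withDensity_apply _ MeasurableSet.univ, ← hlaw,
        Measure.map_apply hX MeasurableSet.univ]
      simp
    exact (ae_lt_top hw h1).mono fun x hx => hx.ne
  have hq : ∀ {s : Set E}, MeasurableSet s →
      ∫⁻ ω in X ⁻¹' s, f (X ω) / w (X ω) ∂Pr = ∫⁻ x in s, f x ∂L := by
    intro s hs
    rw [← setLIntegral_map (f := fun x => f x / w x) hs (hf.div hw) hX, hlaw,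
      restrict_withDensity hs, lintegral_withDensity_eq_lintegral_mul (g := fun x => f x / w x) _ hw
        (hf.div hw)]
    refine lintegral_congr_ae (ae_restrict_of_ae ?_)
    filter_upwards [hw0, hwt] with x hx0 hxt
    simp only [Pi.mul_apply]
    by_cases h : w x = 0
    · rw [h, hx0 h]; simp
    · rw [mul_comm, ENNReal.div_mul_cancel h hxt]
  have hZtop : ∀ᵐ ω ∂Pr, Z ω < ∞ := ae_lt_top hZ hZi
  have hqm : Measurable fun ω => f (X ω) / w (X ω) := (hf.div hw).comp hX
  have hqtop : ∀ᵐ ω ∂Pr, f (X ω) / w (X ω) < ∞ := by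
    filter_upwards [hne, hftop] with ω hω hfω
    exact ENNReal.div_lt_top hfω hω.1
  have hZint : Integrable (fun ω => (Z ω).toReal) Pr :=
    integrable_toReal_of_lintegral_ne_top hZ.aemeasurable hZi
  have hqint : Integrable (fun ω => (f (X ω) / w (X ω)).toReal) Pr := by
    refine integrable_toReal_of_lintegral_ne_top hqm.aemeasurable ?_
    have := hq MeasurableSet.univ
    simp only [preimage_univ, Measure.restrict_univ] at this
    rwa [this]
  have hle : MeasurableSpace.comap X inferInstance ≤ ‹MeasurableSpace Ω› := hX.comap_le
  have h := ae_eq_condExp_of_forall_setIntegral_eq (μ := Pr) hle hZint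
    (g := fun ω => (f (X ω) / w (X ω)).toReal) (fun s _ _ => hqint.integrableOn) ?_ ?_
  · refine h.symm.trans (ae_of_all _ fun ω => ?_)
    exact ENNReal.toReal_div _ _
  · rintro _ ⟨s, hs, rfl⟩ _
    rw [integral_toReal hqm.aemeasurable (ae_restrict_of_ae hqtop),
      integral_toReal hZ.aemeasurable (ae_restrict_of_ae hZtop), hq hs, hset hs]
  · have h1 : Measurable[MeasurableSpace.comap X inferInstance]
        fun ω => (f (X ω) / w (X ω)).toReal :=
      ((hf.div hw).ennreal_toReal).comp (comap_measurable X)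
    exact h1.stronglyMeasurable.aestronglyMeasurable

end Disintegration

section Master

lemma nrmi_apply {Ω 𝕏 : Type*} [MeasurableSpace 𝕏] (N : Ω → Measure (ℝ × 𝕏)) (ω : Ω) (A : Set 𝕏) :
    nrmi N ω A = (crm N ω univ)⁻¹ * crm N ω A := rfl

variable {Ω 𝕏 : Type*} [MeasurableSpace Ω] [MeasurableSpace 𝕏] {Pr : Measure Ω}
  {α : Measure 𝕏} {ρ : Kernel 𝕏 ℝ} {N : Ω → Measure (ℝ × 𝕏)} {ι : Type*} [Fintype ι]

/-- The density with respect to the reference measure of the sample, weighted by the moments of the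
normalized random measure and the probability that the latent variable belongs to `C`. -/
def postInt (N : Ω → Measure (ℝ × 𝕏)) (Pr : Measure Ω) (ρ : Kernel 𝕏 ℝ) (A : ι → Set 𝕏)
    (m : ι → ℕ) (C : Set ℝ) {n : ℕ} (x : Fin n → 𝕏) : ℝ≥0∞ :=
  ∫⁻ u in C ∩ Ioi 0, ENNReal.ofReal (u ^ (n + ∑ i, m i - 1) / Real.Gamma (n + ∑ i, m i : ℕ))
    * ENNReal.ofReal (postProd N Pr ρ A m x u)

lemma gammaMeasure_natCast_apply {a : ℕ} (ha : 1 ≤ a) {r : ℝ} (hr : 0 < r) {C : Set ℝ}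
    (hC : MeasurableSet C) :
    gammaMeasure a r C = ENNReal.ofReal (r ^ a) * ∫⁻ u in C ∩ Ioi 0,
      ENNReal.ofReal (u ^ (a - 1) / Real.Gamma a) * ENNReal.ofReal (Real.exp (-(u * r))) := by
  have h0 : gammaMeasure a r C = ∫⁻ u in C, gammaPDF a r u := by
    rw [gammaMeasure, withDensity_apply _ hC]
  have h1 : ∫⁻ u in C, gammaPDF a r u = ∫⁻ u in C ∩ Ioi 0, gammaPDF a r u := by
    have h2 : ∀ᵐ u ∂(volume.restrict C), u ∉ Ioi (0 : ℝ) → gammaPDF a r u = 0 := by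
      have h3 : ∀ᵐ u ∂(volume : Measure ℝ), u ≠ 0 := by
        simp [ae_iff]
      filter_upwards [ae_restrict_of_ae h3] with u hu0 hu
      exact gammaPDF_of_neg (lt_of_le_of_ne (not_lt.1 hu) hu0)
    rw [inter_comm, ← Measure.restrict_restrict measurableSet_Ioi,
      ← lintegral_indicator measurableSet_Ioi]
    refine lintegral_congr_ae ?_
    filter_upwards [h2] with u hu
    by_cases h : u ∈ Ioi (0 : ℝ)
    · rw [indicator_of_mem h]
    · rw [indicator_of_notMem h, hu h]
  have hG : 0 < Real.Gamma a := Real.Gamma_pos_of_pos (by exact_mod_cast ha)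
  rw [h0, h1, ← lintegral_const_mul _ (by fun_prop)]
  refine setLIntegral_congr_fun (hC.inter measurableSet_Ioi) fun u hu => ?_
  have hu0 : 0 < u := hu.2
  rw [gammaPDF_of_nonneg hu0.le, ← ENNReal.ofReal_mul (by positivity),
    ← ENNReal.ofReal_mul (by positivity), Real.rpow_natCast]
  congr 1
  have h4 : u ^ ((a : ℝ) - 1) = u ^ (a - 1) := by
    rw [← Real.rpow_natCast, Nat.cast_sub ha, Nat.cast_one]
  rw [h4, mul_comm r u]
  ring

variable [IsSFiniteKernel ρ] [IsProbabilityMeasure Pr] [MeasurableEq 𝕏]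

lemma measurable_postInt (hA : ∀ i, MeasurableSet (A i)) (m : ι → ℕ) (C : Set ℝ) (n : ℕ) :
    Measurable fun x : Fin n → 𝕏 => postInt N Pr ρ A m C x := by
  have h1 : Measurable fun p : (Fin n → 𝕏) × ℝ =>
      ENNReal.ofReal (p.2 ^ (n + ∑ i, m i - 1) / Real.Gamma (n + ∑ i, m i : ℕ))
        * ENNReal.ofReal (postProd N Pr ρ A m p.1 p.2) := by
    have h2 := ENNReal.measurable_ofReal.comp
      (measurable_postProd (N := N) (Pr := Pr) (ρ := ρ) hA m n)
    have h3 : Measurable fun p : (Fin n → 𝕏) × ℝ =>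
      ENNReal.ofReal (p.2 ^ (n + ∑ i, m i - 1) / Real.Gamma (n + ∑ i, m i : ℕ)) := by fun_prop
    exact h3.mul h2
  exact h1.lintegral_prod_right'

variable [NullSingletonClass α] [IsFiniteMeasure α]

theorem lintegral_gammaMeasure_mul_prod_nrmi [DecidableEq ι] (hρ : IsLevyKernel α ρ) (hα : α ≠ 0)
    (hN : IsPoissonRandomMeasure N (levyIntensity α ρ) Pr) {A : ι → Set 𝕏}
    (hA : ∀ i, MeasurableSet (A i)) (hd : Pairwise fun i j => Disjoint (A i) (A j))
    (hc : ⋃ i, A i = univ) (m : ι → ℕ) {n : ℕ} (hn : 1 ≤ n) {B : Fin n → Set 𝕏}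
    (hB : ∀ j, MeasurableSet (B j)) {C : Set ℝ} (hC : MeasurableSet C) :
    ∫⁻ ω, gammaMeasure (n + ∑ i, m i : ℕ) (crm N ω univ).toReal C
        * ((∏ i, nrmi N ω (A i) ^ m i) * ∏ j, nrmi N ω (B j)) ∂Pr
      = ∫⁻ x, boxInd B x * postInt N Pr ρ A m C x ∂(refMeasure α n) := by
  set a := n + ∑ i, m i
  have hfin := isFiniteMeasure_refMeasure α n
  set g : ℝ → ℝ≥0∞ := fun u => ENNReal.ofReal (u ^ (a - 1) / Real.Gamma (a : ℕ))
  have hg : Measurable g := by fun_prop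
  set R : Ω → ℝ≥0∞ := fun ω => (∏ i, crm N ω (A i) ^ m i) * ∏ j, crm N ω (B j)
  have hcm : ∀ {D : Set 𝕏}, MeasurableSet D → Measurable fun ω => crm N ω D := fun hD =>
    measurable_crm_apply hN.measurable hD
  have hR : Measurable R :=
    (Finset.measurable_prod _ fun i _ => (hcm (hA i)).pow_const _).mul
      (Finset.measurable_prod _ fun j _ => hcm (hB j))
  have hT : Measurable fun ω => (crm N ω univ).toReal := (hcm MeasurableSet.univ).ennreal_toReal
  have h1 : ∀ᵐ ω ∂Pr, gammaMeasure a (crm N ω univ).toReal C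
        * ((∏ i, nrmi N ω (A i) ^ m i) * ∏ j, nrmi N ω (B j))
      = ∫⁻ u in C ∩ Ioi 0, g u * (ENNReal.ofReal (Real.exp (-(u * (crm N ω univ).toReal)))
        * R ω) := by
    filter_upwards [ae_crm_univ_ne_top hρ hN, ae_crm_univ_ne_zero hρ hα hN] with ω htop h0
    have hpos : 0 < (crm N ω univ).toReal := ENNReal.toReal_pos h0 htop
    rw [gammaMeasure_natCast_apply (by omega) hpos hC, ENNReal.ofReal_pow hpos.le,
      ENNReal.ofReal_toReal htop]
    simp only [nrmi_apply, mul_pow, Finset.prod_mul_distrib, Finset.prod_pow_eq_pow_sum,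
      Finset.prod_const, Finset.card_univ, Fintype.card_fin]
    have h2 : ∫⁻ u in C ∩ Ioi 0, g u * (ENNReal.ofReal (Real.exp (-(u * (crm N ω univ).toReal)))
        * R ω) = (∫⁻ u in C ∩ Ioi 0, g u
          * ENNReal.ofReal (Real.exp (-(u * (crm N ω univ).toReal)))) * R ω := by
      rw [← lintegral_mul_const _ (by fun_prop)]
      exact lintegral_congr fun u => (mul_assoc _ _ _).symm
    rw [h2]
    have h3 : crm N ω univ ^ a * ((crm N ω univ)⁻¹ ^ (∑ i, m i) * (crm N ω univ)⁻¹ ^ n) = 1 := by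
      rw [← pow_add, add_comm (∑ i, m i) n, ← mul_pow, ENNReal.mul_inv_cancel h0 htop, one_pow]
    calc _ = (crm N ω univ ^ a * ((crm N ω univ)⁻¹ ^ (∑ i, m i) * (crm N ω univ)⁻¹ ^ n))
          * ((∫⁻ u in C ∩ Ioi 0, g u
            * ENNReal.ofReal (Real.exp (-(u * (crm N ω univ).toReal)))) * R ω) := by
          simp only [R, g]; ring
      _ = _ := by rw [h3, one_mul]
  have hpm : Measurable fun p : ℝ × (Fin n → 𝕏) =>
      ENNReal.ofReal (postProd N Pr ρ A m p.2 p.1) := by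
    have h := (measurable_postProd (N := N) (Pr := Pr) (ρ := ρ) hA m n).comp
      (measurable_swap (α := ℝ) (β := Fin n → 𝕏))
    exact ENNReal.measurable_ofReal.comp h
  have he : Measurable fun p : Ω × ℝ =>
      ENNReal.ofReal (Real.exp (-(p.2 * (crm N p.1 univ).toReal))) :=
    ENNReal.measurable_ofReal.comp (Real.measurable_exp.comp
      (measurable_snd.mul (hT.comp measurable_fst)).neg)
  have hj0 : Measurable fun p : Ω × ℝ =>
      g p.2 * (ENNReal.ofReal (Real.exp (-(p.2 * (crm N p.1 univ).toReal))) * R p.1) :=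
    (hg.comp measurable_snd).mul (he.mul (hR.comp measurable_fst))
  rw [lintegral_congr_ae h1, lintegral_lintegral_swap hj0.aemeasurable]
  have h4 : ∀ u ∈ C ∩ Ioi (0 : ℝ), ∫⁻ ω, g u
        * (ENNReal.ofReal (Real.exp (-(u * (crm N ω univ).toReal))) * R ω) ∂Pr
      = ∫⁻ x, g u * (boxInd B x * ENNReal.ofReal (postProd N Pr ρ A m x u))
        ∂(refMeasure α n) := by
    intro u hu
    rw [lintegral_const_mul' _ _ ENNReal.ofReal_ne_top,
      lintegral_const_mul' _ _ ENNReal.ofReal_ne_top,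
      lintegral_exp_mul_prod_pow_crm hρ hN hA hd hc m hB hu.2]
  rw [setLIntegral_congr_fun (hC.inter measurableSet_Ioi) h4]
  have hbm := measurable_boxInd hB
  have hjm : Measurable fun p : ℝ × (Fin n → 𝕏) =>
      g p.1 * (boxInd B p.2 * ENNReal.ofReal (postProd N Pr ρ A m p.2 p.1)) :=
    (hg.comp measurable_fst).mul ((hbm.comp measurable_snd).mul hpm)
  rw [lintegral_lintegral_swap hjm.aemeasurable]
  refine lintegral_congr fun x => ?_
  have hbt : boxInd B x ≠ ∞ := by
    refine ENNReal.prod_ne_top fun j _ => ?_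
    by_cases h : x j ∈ B j <;> simp [h]
  rw [postInt, ← lintegral_const_mul' _ _ hbt]
  exact lintegral_congr fun u => by simp only [g, a]; ring

end Master

section SampleLaw

variable {Ω 𝕏 : Type*} [MeasurableSpace Ω] [MeasurableSpace 𝕏] {Pr : Measure Ω}
  {N : Ω → Measure (ℝ × 𝕏)} {ι : Type*} [Fintype ι] {n : ℕ} {X : Fin n → Ω → 𝕏}

lemma nrmi_le_one {Ω 𝕏 : Type*} [MeasurableSpace 𝕏] (N : Ω → Measure (ℝ × 𝕏)) (ω : Ω)
    (A : Set 𝕏) : nrmi N ω A ≤ 1 := by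
  rw [nrmi_apply]
  exact (mul_le_mul_right (crm_le_univ N ω A) _).trans (ENNReal.inv_mul_le_one _)

lemma ofReal_prod_toReal_pow {Ω 𝕏 ι : Type*} [Fintype ι] [MeasurableSpace 𝕏]
    (N : Ω → Measure (ℝ × 𝕏)) (ω : Ω) (A : ι → Set 𝕏) (m : ι → ℕ) :
    ENNReal.ofReal (∏ i, (nrmi N ω (A i)).toReal ^ m i) = ∏ i, nrmi N ω (A i) ^ m i := by
  rw [ENNReal.ofReal_prod_of_nonneg fun i _ => by positivity]
  refine Finset.prod_congr rfl fun i _ => ?_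
  rw [ENNReal.ofReal_pow ENNReal.toReal_nonneg,
    ENNReal.ofReal_toReal (ne_top_of_le_ne_top ENNReal.one_ne_top (nrmi_le_one N ω _))]

lemma boxInd_comp_eq {Ω 𝕏 : Type*} {n : ℕ} (X : Fin n → Ω → 𝕏) (B : Fin n → Set 𝕏) (ω : Ω) :
    boxInd B (fun i => X i ω)
      = ENNReal.ofReal ({ω | ∀ i, X i ω ∈ B i}.indicator (fun _ => (1 : ℝ)) ω) := by
  by_cases h : ω ∈ {ω | ∀ i, X i ω ∈ B i}
  · rw [indicator_of_mem h, ENNReal.ofReal_one]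
    exact Finset.prod_eq_one fun i _ => indicator_of_mem (h i) 1
  · rw [indicator_of_notMem h, ENNReal.ofReal_zero]
    have h' : ¬∀ i, X i ω ∈ B i := h
    obtain ⟨i, hi⟩ := not_forall.1 h'
    exact Finset.prod_eq_zero (Finset.mem_univ i) (indicator_of_notMem hi _)

lemma measurable_prod_toReal_pow {A : ι → Set 𝕏} (hA : ∀ i, MeasurableSet (A i)) (m : ι → ℕ) :
    Measurable fun P : Measure 𝕏 => ∏ i, (P (A i)).toReal ^ m i :=
  Finset.measurable_prod _ fun i _ => (Measure.measurable_coe (hA i)).ennreal_toReal.pow_const _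

lemma norm_prod_toReal_pow_le {Ω 𝕏 ι : Type*} [Fintype ι] [MeasurableSpace 𝕏]
    (N : Ω → Measure (ℝ × 𝕏)) (ω : Ω) (A : ι → Set 𝕏) (m : ι → ℕ) :
    ‖∏ i, (nrmi N ω (A i)).toReal ^ m i‖ ≤ 1 := by
  rw [Real.norm_of_nonneg (Finset.prod_nonneg fun i _ => by positivity)]
  refine Finset.prod_le_one (fun i _ => by positivity) fun i _ => ?_
  refine pow_le_one₀ ENNReal.toReal_nonneg ?_
  exact ENNReal.toReal_le_of_le_ofReal zero_le_one (by simpa using nrmi_le_one N ω _)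

variable [IsProbabilityMeasure Pr]

lemma IsSample.lintegral_boxInd_mul (hX : IsSample X (nrmi N) Pr) (hN : Measurable N)
    {A : ι → Set 𝕏} (hA : ∀ i, MeasurableSet (A i)) (m : ι → ℕ) {B : Fin n → Set 𝕏}
    (hB : ∀ j, MeasurableSet (B j)) :
    ∫⁻ ω, (∏ i, nrmi N ω (A i) ^ m i) * boxInd B (fun i => X i ω) ∂Pr
      = ∫⁻ ω, (∏ i, nrmi N ω (A i) ^ m i) * ∏ j, nrmi N ω (B j) ∂Pr := by
  have hm := measurable_nrmi hN
  set Z : Ω → ℝ := fun ω => ∏ i, (nrmi N ω (A i)).toReal ^ m i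
  set I : Ω → ℝ := {ω | ∀ i, X i ω ∈ B i}.indicator (fun _ => (1 : ℝ))
  set J : Ω → ℝ := fun ω => ∏ j, (nrmi N ω (B j)).toReal
  have hle : MeasurableSpace.comap (nrmi N) inferInstance ≤ ‹MeasurableSpace Ω› := hm.comap_le
  have hZm' : StronglyMeasurable[MeasurableSpace.comap (nrmi N) inferInstance] Z :=
    ((measurable_prod_toReal_pow hA m).comp (comap_measurable (nrmi N))).stronglyMeasurable
  have hZm : Measurable Z := (measurable_prod_toReal_pow hA m).comp hm
  have hJm : Measurable J := by
    have := (measurable_prod_toReal_pow hB fun _ => 1).comp hm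
    simpa [Function.comp_def] using this
  have hE : MeasurableSet {ω | ∀ i, X i ω ∈ B i} := by
    have : {ω | ∀ i, X i ω ∈ B i} = ⋂ i, X i ⁻¹' B i := by ext; simp
    rw [this]
    exact MeasurableSet.iInter fun i => hX.measurable i (hB i)
  have hI0 : ∀ ω, 0 ≤ I ω := fun ω => indicator_nonneg (fun _ _ => zero_le_one) ω
  have hII : Integrable I Pr := (integrable_const (1 : ℝ)).indicator hE
  have hZI : Integrable (Z * I) Pr :=
    hII.bdd_mul hZm.aestronglyMeasurable (ae_of_all _ fun ω => norm_prod_toReal_pow_le N ω A m)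
  have hJ1 : ∀ ω, ‖J ω‖ ≤ 1 := fun ω => by
    have := norm_prod_toReal_pow_le N ω B fun _ => 1
    simpa only [pow_one] using this
  have hJI : Integrable J Pr :=
    (integrable_const (1 : ℝ)).mono' hJm.aestronglyMeasurable (ae_of_all _ hJ1)
  have hZJ : Integrable (Z * J) Pr :=
    hJI.bdd_mul hZm.aestronglyMeasurable (ae_of_all _ fun ω => norm_prod_toReal_pow_le N ω A m)
  have hZ0 : ∀ ω, 0 ≤ Z ω := fun ω => Finset.prod_nonneg fun i _ => by positivity
  have hJ0 : ∀ ω, 0 ≤ J ω := fun ω => Finset.prod_nonneg fun i _ => ENNReal.toReal_nonneg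
  have h1 : ∫ ω, (Z * I) ω ∂Pr = ∫ ω, (Z * J) ω ∂Pr := by
    rw [← integral_condExp hle (f := Z * I)]
    refine integral_congr_ae ?_
    filter_upwards [condExp_mul_of_stronglyMeasurable_left hZm' hZI hII, hX.condLaw B hB]
      with ω h2 h3
    rw [h2, Pi.mul_apply, h3, Pi.mul_apply]
  have h2 := congrArg ENNReal.ofReal h1
  rw [ofReal_integral_eq_lintegral_ofReal hZI (ae_of_all _ fun ω => mul_nonneg (hZ0 ω) (hI0 ω)),
    ofReal_integral_eq_lintegral_ofReal hZJ (ae_of_all _ fun ω => mul_nonneg (hZ0 ω) (hJ0 ω))] at h2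
  convert h2 using 3 with ω ω
  · rw [Pi.mul_apply, ENNReal.ofReal_mul (hZ0 ω), ofReal_prod_toReal_pow, boxInd_comp_eq]
  · have h4 := ofReal_prod_toReal_pow N ω B fun _ => 1
    simp only [pow_one] at h4
    rw [Pi.mul_apply, ENNReal.ofReal_mul (hZ0 ω), ofReal_prod_toReal_pow, ← h4]

lemma IsLatent.lintegral_boxInd_mul {U : Ω → ℝ} (hU : IsLatent U X N Pr) (hN : Measurable N)
    (hX : ∀ i, Measurable (X i)) (hn : 1 ≤ n)
    (hT : ∀ᵐ ω ∂Pr, crm N ω univ ≠ ∞ ∧ crm N ω univ ≠ 0) {B : Fin n → Set 𝕏}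
    (hB : ∀ j, MeasurableSet (B j)) {C : Set ℝ} (hC : MeasurableSet C) :
    ∫⁻ ω, (U ⁻¹' C).indicator 1 ω * boxInd B (fun i => X i ω) ∂Pr
      = ∫⁻ ω, gammaMeasure n (crm N ω univ).toReal C * ∏ j, nrmi N ω (B j) ∂Pr := by
  have hm := measurable_crm hN
  have hle : MeasurableSpace.comap (crm N) inferInstance ≤ ‹MeasurableSpace Ω› := hm.comap_le
  have hE : MeasurableSet {ω | (∀ i, X i ω ∈ B i) ∧ U ω ∈ C} := by
    have : {ω | (∀ i, X i ω ∈ B i) ∧ U ω ∈ C} = (⋂ i, X i ⁻¹' B i) ∩ U ⁻¹' C := by ext; simp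
    rw [this]
    exact (MeasurableSet.iInter fun i => hX i (hB i)).inter (hU.measurable hC)
  have hII : Integrable ({ω | (∀ i, X i ω ∈ B i) ∧ U ω ∈ C}.indicator (fun _ => (1 : ℝ))) Pr :=
    (integrable_const (1 : ℝ)).indicator hE
  have h1 := integral_condExp hle
    (f := {ω | (∀ i, X i ω ∈ B i) ∧ U ω ∈ C}.indicator (fun _ => (1 : ℝ))) (μ := Pr)
  have hae := hU.condLaw B C hB hC
  have hint := (integrable_condExp (m := MeasurableSpace.comap (crm N) inferInstance) (μ := Pr)
    (f := {ω | (∀ i, X i ω ∈ B i) ∧ U ω ∈ C}.indicator (fun _ => (1 : ℝ)))).congr hae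
  rw [integral_congr_ae hae] at h1
  have h2 := congrArg ENNReal.ofReal h1
  rw [ofReal_integral_eq_lintegral_ofReal hint (ae_of_all _ fun ω => by positivity),
    ofReal_integral_eq_lintegral_ofReal hII
    (ae_of_all _ fun ω => indicator_nonneg (fun _ _ => zero_le_one) ω)] at h2
  refine Eq.trans (lintegral_congr fun ω => ?_) (h2.symm.trans (lintegral_congr_ae ?_))
  · rw [boxInd_comp_eq]
    by_cases hu : U ω ∈ C <;> by_cases hx : ∀ i, X i ω ∈ B i <;> simp [indicator, hu, hx]
  · filter_upwards [hT] with ω hω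
    have hp := isProbabilityMeasure_gammaMeasure (a := n) (r := (crm N ω univ).toReal)
      (by exact_mod_cast hn) (ENNReal.toReal_pos hω.2 hω.1)
    have h4 := ofReal_prod_toReal_pow N ω B fun _ => 1
    simp only [pow_one] at h4
    rw [ENNReal.ofReal_mul' ENNReal.toReal_nonneg, ENNReal.ofReal_toReal (measure_ne_top _ _), h4,
      mul_comm]

end SampleLaw

section Posterior

variable {Ω 𝕏 : Type*} [MeasurableSpace Ω] [MeasurableSpace 𝕏] {Pr : Measure Ω}
  {α : Measure 𝕏} {ρ : Kernel 𝕏 ℝ} {N : Ω → Measure (ℝ × 𝕏)} {ι : Type*} [Fintype ι]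

/-- The density of the sample with respect to the reference measure, restricted to the event that
the latent variable belongs to `C`. -/
def sampleInt (α : Measure 𝕏) (ρ : Kernel 𝕏 ℝ) (C : Set ℝ) {n : ℕ} (x : Fin n → 𝕏) : ℝ≥0∞ :=
  ∫⁻ u in C ∩ Ioi 0, ENNReal.ofReal (u ^ (n - 1) / Real.Gamma n)
    * ENNReal.ofReal (sampleWeight α ρ x u)

variable [IsSFiniteKernel ρ] [IsProbabilityMeasure Pr]

lemma postInt_zero (hρ : IsLevyKernel α ρ)
    (hN : IsPoissonRandomMeasure N (levyIntensity α ρ) Pr) {A : ι → Set 𝕏}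
    (hA : ∀ i, MeasurableSet (A i)) (hd : Pairwise fun i j => Disjoint (A i) (A j))
    (hc : ⋃ i, A i = univ) {C : Set ℝ} (hC : MeasurableSet C) {n : ℕ} (x : Fin n → 𝕏) :
    postInt N Pr ρ A 0 C x = sampleInt α ρ C x := by
  refine setLIntegral_congr_fun (hC.inter measurableSet_Ioi) fun u hu => ?_
  simp [postProd_zero hρ hN hA hd hc x hu.2]

variable [MeasurableEq 𝕏]

lemma measurable_sampleInt (hρ : IsLevyKernel α ρ)
    (hN : IsPoissonRandomMeasure N (levyIntensity α ρ) Pr) {C : Set ℝ} (hC : MeasurableSet C)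
    (n : ℕ) : Measurable fun x : Fin n → 𝕏 => sampleInt α ρ C x := by
  have h := measurable_postInt (N := N) (Pr := Pr) (ρ := ρ) (ι := Unit)
    (A := fun _ => univ) (fun _ => MeasurableSet.univ) 0 C n
  have h1 : ∀ x : Fin n → 𝕏, postInt N Pr ρ (fun _ : Unit => univ) 0 C x
      = sampleInt α ρ C x := fun x =>
    postInt_zero hρ hN (fun _ => MeasurableSet.univ)
      (fun i j h => absurd (Subsingleton.elim i j) h) (iUnion_const univ) hC x
  simp_rw [← h1]
  exact h

variable [NullSingletonClass α] [IsFiniteMeasure α] {n : ℕ} {X : Fin n → Ω → 𝕏}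

lemma map_withDensity_prod_nrmi [DecidableEq ι] (hρ : IsLevyKernel α ρ) (hα : α ≠ 0)
    (hN : IsPoissonRandomMeasure N (levyIntensity α ρ) Pr) (hn : 1 ≤ n)
    (hX : IsSample X (nrmi N) Pr) {A : ι → Set 𝕏}
    (hA : ∀ i, MeasurableSet (A i)) (hd : Pairwise fun i j => Disjoint (A i) (A j))
    (hc : ⋃ i, A i = univ) (m : ι → ℕ) :
    (Pr.withDensity fun ω => ∏ i, nrmi N ω (A i) ^ m i).map (fun ω i => X i ω)
      = (refMeasure α n).withDensity fun x => postInt N Pr ρ A m univ x := by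
  have hXm : Measurable fun ω i => X i ω := measurable_pi_lambda _ hX.measurable
  have hZ : Measurable fun ω => ∏ i, nrmi N ω (A i) ^ m i :=
    Finset.measurable_prod _ fun i _ =>
      ((Measure.measurable_coe (hA i)).comp (measurable_nrmi hN.measurable)).pow_const _
  have : IsFiniteMeasure ((Pr.withDensity fun ω => ∏ i, nrmi N ω (A i) ^ m i).map
      fun ω i => X i ω) := by
    have : IsFiniteMeasure (Pr.withDensity fun ω => ∏ i, nrmi N ω (A i) ^ m i) := by
      refine isFiniteMeasure_withDensity (ne_top_of_le_ne_top ENNReal.one_ne_top ?_)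
      calc ∫⁻ ω, ∏ i, nrmi N ω (A i) ^ m i ∂Pr ≤ ∫⁻ _, 1 ∂Pr :=
            lintegral_mono fun ω => Finset.prod_le_one' fun i _ =>
              pow_le_one' (nrmi_le_one N ω _) _
        _ = 1 := by simp
    infer_instance
  refine ext_of_boxInd fun B hB => ?_
  rw [lintegral_map (measurable_boxInd hB) hXm, lintegral_withDensity_eq_lintegral_mul _ hZ
    (g := fun ω => boxInd B fun i => X i ω) ((measurable_boxInd hB).comp hXm),
    lintegral_withDensity_eq_lintegral_mul _
    (measurable_postInt hA m univ n) (measurable_boxInd hB)]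
  simp only [Pi.mul_apply]
  rw [hX.lintegral_boxInd_mul hN.measurable hA m hB]
  have h := lintegral_gammaMeasure_mul_prod_nrmi hρ hα hN hA hd hc m hn hB MeasurableSet.univ
  simp_rw [mul_comm (postInt _ _ _ _ _ _ _)]
  rw [← h]
  refine lintegral_congr_ae ?_
  filter_upwards [ae_crm_univ_ne_top hρ hN, ae_crm_univ_ne_zero hρ hα hN] with ω htop h0
  have ha : (0 : ℝ) < ((n + ∑ i, m i : ℕ) : ℝ) := by exact_mod_cast (by omega)
  have hp := isProbabilityMeasure_gammaMeasure ha (ENNReal.toReal_pos h0 htop)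
  rw [measure_univ, one_mul]

lemma map_sample (hρ : IsLevyKernel α ρ) (hα : α ≠ 0)
    (hN : IsPoissonRandomMeasure N (levyIntensity α ρ) Pr) (hn : 1 ≤ n)
    (hX : IsSample X (nrmi N) Pr) :
    Pr.map (fun ω i => X i ω) = (refMeasure α n).withDensity (sampleInt α ρ univ) := by
  have h := map_withDensity_prod_nrmi hρ hα hN hn hX (ι := Unit) (A := fun _ => univ)
    (fun _ => MeasurableSet.univ) (fun i j h => absurd (Subsingleton.elim i j) h)
    (iUnion_const univ) 0
  have h1 : ∀ x : Fin n → 𝕏, postInt N Pr ρ (fun _ : Unit => univ) 0 univ x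
      = sampleInt α ρ univ x := fun x =>
    postInt_zero hρ hN (fun _ => MeasurableSet.univ)
      (fun i j h => absurd (Subsingleton.elim i j) h) (iUnion_const univ) MeasurableSet.univ x
  simp_rw [h1] at h
  simpa using h

lemma map_withDensity_latent (hρ : IsLevyKernel α ρ) (hα : α ≠ 0)
    (hN : IsPoissonRandomMeasure N (levyIntensity α ρ) Pr) (hn : 1 ≤ n)
    (hX : ∀ i, Measurable (X i)) {U : Ω → ℝ} (hU : IsLatent U X N Pr) {C : Set ℝ}
    (hC : MeasurableSet C) :
    (Pr.withDensity ((U ⁻¹' C).indicator 1)).map (fun ω i => X i ω)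
      = (refMeasure α n).withDensity (sampleInt α ρ C) := by
  have hXm : Measurable fun ω i => X i ω := measurable_pi_lambda _ hX
  have hZ : Measurable ((U ⁻¹' C).indicator (1 : Ω → ℝ≥0∞)) :=
    measurable_one.indicator (hU.measurable hC)
  have : IsFiniteMeasure ((Pr.withDensity ((U ⁻¹' C).indicator 1)).map fun ω i => X i ω) := by
    rw [withDensity_indicator_one (hU.measurable hC)]
    infer_instance
  refine ext_of_boxInd fun B hB => ?_
  rw [lintegral_map (measurable_boxInd hB) hXm, lintegral_withDensity_eq_lintegral_mul _ hZ
    (g := fun ω => boxInd B fun i => X i ω) ((measurable_boxInd hB).comp hXm),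
    lintegral_withDensity_eq_lintegral_mul _
    (measurable_sampleInt hρ hN hC n) (measurable_boxInd hB)]
  simp only [Pi.mul_apply]
  rw [hU.lintegral_boxInd_mul hN.measurable hX hn
    ((ae_crm_univ_ne_top hρ hN).and (ae_crm_univ_ne_zero hρ hα hN)) hB hC]
  have h := lintegral_gammaMeasure_mul_prod_nrmi hρ hα hN (ι := Unit) (A := fun _ => univ)
    (fun _ => MeasurableSet.univ) (fun i j h => absurd (Subsingleton.elim i j) h)
    (iUnion_const univ) 0 hn hB hC
  have h1 : ∀ x : Fin n → 𝕏, postInt N Pr ρ (fun _ : Unit => univ) 0 C x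
      = sampleInt α ρ C x := fun x =>
    postInt_zero hρ hN (fun _ => MeasurableSet.univ)
      (fun i j h => absurd (Subsingleton.elim i j) h) (iUnion_const univ) hC x
  simp_rw [h1] at h
  simp_rw [mul_comm (sampleInt _ _ _ _)]
  simpa using h

end Posterior

section Expansion

open PowerSeries

variable {𝕏 : Type*}

lemma mem_multiIndices {m : ℕ} {D : Finset 𝕏} {l : 𝕏 → ℕ} :
    l ∈ multiIndices m D ↔ ∑ y ∈ D, l y ≤ m ∧ ∀ y, l y ≠ 0 → y ∈ D := by
  classical
  simp only [multiIndices, Finset.mem_biUnion, Finset.mem_range, Finset.mem_piAntidiag]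
  constructor
  · rintro ⟨k, hk, h1, h2⟩
    exact ⟨h1.le.trans (Nat.lt_succ_iff.1 hk), h2⟩
  · rintro ⟨h1, h2⟩
    exact ⟨_, Nat.lt_succ_of_le h1, rfl, h2⟩

lemma multiIndices_zero (D : Finset 𝕏) : multiIndices 0 D = {0} := by
  ext l
  rw [mem_multiIndices, Finset.mem_singleton]
  constructor
  · rintro ⟨h1, h2⟩
    funext y
    by_contra h
    exact h ((Finset.sum_eq_zero_iff.1 (Nat.le_zero.1 h1)) y (h2 y h))
  · rintro rfl
    simp

lemma coeff_mul_prod (k : ℕ) (D : Finset 𝕏) (Q : PowerSeries ℝ) (P : 𝕏 → PowerSeries ℝ) :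
    coeff k (Q * ∏ y ∈ D, P y)
      = ∑ l ∈ multiIndices k D, coeff (k - ∑ y ∈ D, l y) Q * ∏ y ∈ D, coeff (l y) (P y) := by
  classical
  have h1 : ∀ j, coeff j (∏ y ∈ D, P y)
      = ∑ l ∈ D.piAntidiag j, ∏ y ∈ D, coeff (l y) (P y) := by
    intro j
    rw [coeff_prod]
    refine Finset.sum_bij (fun l _ => ⇑l) (fun l hl => ?_)
      (fun l _ l' _ h => DFunLike.coe_injective h) (fun l hl => ?_) fun l _ => rfl
    · rw [Finset.mem_finsuppAntidiag] at hl
      rw [Finset.mem_piAntidiag]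
      exact ⟨hl.1, fun y hy => hl.2 (Finsupp.mem_support_iff.2 hy)⟩
    · rw [Finset.mem_piAntidiag] at hl
      refine ⟨Finsupp.onFinset D l hl.2, ?_, rfl⟩
      rw [Finset.mem_finsuppAntidiag]
      exact ⟨hl.1, fun y hy => hl.2 y (Finsupp.mem_support_iff.1 hy)⟩
  rw [mul_comm, coeff_mul, Finset.Nat.sum_antidiagonal_eq_sum_range_succ_mk, multiIndices,
    Finset.sum_biUnion]
  · refine Finset.sum_congr rfl fun j _ => ?_
    rw [h1, Finset.sum_mul]
    refine Finset.sum_congr rfl fun l hl => ?_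
    rw [(Finset.mem_piAntidiag.1 hl).1, mul_comm]
  · intro i _ j _ hij
    refine Finset.disjoint_left.2 fun l hl hl' => hij ?_
    rw [Finset.mem_piAntidiag] at hl hl'
    exact hl.1.symm.trans hl'.1

variable {Ω : Type*} [MeasurableSpace Ω] [MeasurableSpace 𝕏] {Pr : Measure Ω}
  {α : Measure 𝕏} {ρ : Kernel 𝕏 ℝ} {N : Ω → Measure (ℝ × 𝕏)} {n : ℕ}

lemma IsLevyKernel.tau_mult_pos (hρ : IsLevyKernel α ρ) {x : Fin n → 𝕏} {y : 𝕏}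
    (hy : y ∈ distinct x) {u : ℝ} (hu : 0 < u) : 0 < tau ρ (mult x y) u y :=
  hρ.tau_pos (mult_pos hy) hu y

lemma mixedFactor_zero (hρ : IsLevyKernel α ρ) (x : Fin n → 𝕏) (A : Set 𝕏) {u : ℝ} (hu : 0 < u) :
    mixedFactor α ρ x A 0 u = 1 := by
  have h1 : ∏ y ∈ distinctIn x A, tau ρ (mult x y) u y / tau ρ (mult x y) u y = 1 :=
    Finset.prod_eq_one fun y hy => div_self (hρ.tau_mult_pos (mem_distinctIn.1 hy).1 hu).ne'
  have h2 : V α ρ A 0 u = 1 := by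
    rw [V, iteratedDeriv_zero, pow_zero, one_mul, ← Real.exp_add, add_neg_cancel, Real.exp_zero]
  rw [mixedFactor, multiIndices_zero, Finset.sum_singleton]
  simp only [Pi.zero_apply, add_zero, Nat.zero_sub, h1, h2]
  simp [multiCoeff]

lemma sum_multiCoeff_mul_momentIntegrand (hρ : IsLevyKernel α ρ) (x : Fin n → 𝕏) (A : Set 𝕏)
    (m : ℕ) {u : ℝ} (hu : 0 < u) :
    ∑ l ∈ multiIndices m (distinct x), multiCoeff m (distinct x) l
        * momentIntegrand α ρ x A m l u
      = u ^ m * latentDensity α ρ x u * mixedFactor α ρ x A m u := by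
  have hsub : distinctIn x A ⊆ distinct x := fun y hy => (mem_distinctIn.1 hy).1
  have hle : multiIndices m (distinctIn x A) ⊆ multiIndices m (distinct x) := by
    intro l hl
    rw [mem_multiIndices] at hl ⊢
    refine ⟨?_, fun y hy => hsub (hl.2 y hy)⟩
    rw [← Finset.sum_subset hsub fun y _ hy => by_contra fun h => hy (hl.2 y h)]
    exact hl.1
  rw [← Finset.sum_subset hle, mixedFactor, Finset.mul_sum]
  · refine Finset.sum_congr rfl fun l hl => ?_
    have h0 : ∀ y, y ∉ distinctIn x A → l y = 0 := fun y hy =>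
      by_contra fun h => hy ((mem_multiIndices.1 hl).2 y h)
    have hs : ∑ y ∈ distinct x, l y = ∑ y ∈ distinctIn x A, l y :=
      (Finset.sum_subset hsub fun y _ hy => h0 y hy).symm
    have hf : ∏ y ∈ distinct x, ((l y)! : ℝ) = ∏ y ∈ distinctIn x A, ((l y)! : ℝ) :=
      (Finset.prod_subset hsub fun y _ hy => by rw [h0 y hy]; simp).symm
    have hp : ∏ y ∈ distinct x, tau ρ (mult x y + l y) u y / tau ρ (mult x y) u y
          * A.indicator (fun _ => (1 : ℝ)) y ^ l y
        = ∏ y ∈ distinctIn x A, tau ρ (mult x y + l y) u y / tau ρ (mult x y) u y := by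
      rw [← Finset.prod_subset hsub]
      · refine Finset.prod_congr rfl fun y hy => ?_
        rw [indicator_of_mem (mem_distinctIn.1 hy).2, one_pow, mul_one]
      · intro y hy hyA
        rw [h0 y hyA, add_zero, pow_zero, mul_one, div_self (hρ.tau_mult_pos hy hu).ne']
    rw [multiCoeff, multiCoeff, momentIntegrand, hs, hf, hp]
    ring
  · intro l hl hl'
    obtain ⟨y, hy, hyA⟩ : ∃ y, l y ≠ 0 ∧ y ∉ distinctIn x A := by
      by_contra! h
      refine hl' (mem_multiIndices.2 ⟨?_, h⟩)
      exact (Finset.sum_le_sum_of_subset hsub).trans (mem_multiIndices.1 hl).1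
    have hyD : y ∈ distinct x := (mem_multiIndices.1 hl).2 y hy
    have hyA' : y ∉ A := fun h => hyA (mem_distinctIn.2 ⟨hyD, h⟩)
    rw [momentIntegrand, Finset.prod_eq_zero hyD, mul_zero, mul_zero]
    rw [indicator_of_notMem hyA', zero_pow hy, mul_zero]

variable [IsSFiniteKernel ρ] [IsProbabilityMeasure Pr]

/-- The posterior moment with exponent `k`, written with the derivatives `V`. -/
lemma postMoment_eq (hρ : IsLevyKernel α ρ)
    (hN : IsPoissonRandomMeasure N (levyIntensity α ρ) Pr) {A : Set 𝕏} (hA : MeasurableSet A)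
    (x : Fin n → 𝕏) (k : ℕ) {u : ℝ} (hu : 0 < u) :
    postMoment (massLaw N Pr A) ρ x A k u
      = Real.exp (-psi α ρ A u) * (∏ y ∈ distinctIn x A, tau ρ (mult x y) u y)
        * mixedFactor α ρ x A k u := by
  rw [postMoment, postSeries, coeff_mul_prod, mixedFactor, Finset.mul_sum, Finset.mul_sum]
  refine Finset.sum_congr rfl fun l _ => ?_
  have h1 : ∏ y ∈ distinctIn x A, tau ρ (mult x y) u y ≠ 0 :=
    Finset.prod_ne_zero_iff.2 fun y hy => (hρ.tau_mult_pos (mem_distinctIn.1 hy).1 hu).ne'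
  have h2 : ∏ y ∈ distinctIn x A, ((l y)! : ℝ) ≠ 0 :=
    Finset.prod_ne_zero_iff.2 fun y _ => by positivity
  have h3 : ((k - ∑ y ∈ distinctIn x A, l y)! : ℝ) ≠ 0 := by positivity
  simp only [lser, coeff_mk, zero_add, ← tau_eq_lmom, Finset.prod_div_distrib]
  rw [← exp_neg_psi_mul_V hρ hN hA _ hu, multiCoeff]
  field_simp

lemma prod_exp_neg_psi {ι : Type*} [Fintype ι] (hρ : IsLevyKernel α ρ)
    (hN : IsPoissonRandomMeasure N (levyIntensity α ρ) Pr) {A : ι → Set 𝕏}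
    (hA : ∀ i, MeasurableSet (A i)) (hd : Pairwise fun i j => Disjoint (A i) (A j))
    (hc : ⋃ i, A i = univ) {u : ℝ} (hu : 0 < u) :
    ∏ i, Real.exp (-psi α ρ (A i) u) = Real.exp (-psi α ρ univ u) := by
  simp_rw [← lmom_massLaw_zero hρ hN (hA _) hu]
  exact prod_lmom_massLaw_zero hρ hN hA hd hc hu

lemma postProd_eq {ι : Type*} [Fintype ι] (hρ : IsLevyKernel α ρ)
    (hN : IsPoissonRandomMeasure N (levyIntensity α ρ) Pr) {A : ι → Set 𝕏}
    (hA : ∀ i, MeasurableSet (A i)) (hd : Pairwise fun i j => Disjoint (A i) (A j))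
    (hc : ⋃ i, A i = univ) (m : ι → ℕ) (x : Fin n → 𝕏) {u : ℝ} (hu : 0 < u) :
    postProd N Pr ρ A m x u
      = sampleWeight α ρ x u * ∏ i, mixedFactor α ρ x (A i) (m i) u := by
  simp only [postProd, postMoment_eq hρ hN (hA _) x _ hu]
  rw [Finset.prod_mul_distrib, Finset.prod_mul_distrib, prod_prod_distinctIn hd hc,
    prod_exp_neg_psi hρ hN hA hd hc hu, sampleWeight]

end Expansion

section Integrals

variable {Ω 𝕏 : Type*} [MeasurableSpace Ω] [MeasurableSpace 𝕏] {Pr : Measure Ω}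
  {α : Measure 𝕏} {ρ : Kernel 𝕏 ℝ} {N : Ω → Measure (ℝ × 𝕏)} {n : ℕ}

lemma latentWeight_eq (x : Fin n → 𝕏) (u : ℝ) :
    latentWeight α ρ x u = u ^ (n - 1) * sampleWeight α ρ x u := mul_assoc _ _ _

lemma sampleInt_mono (x : Fin n → 𝕏) (C : Set ℝ) : sampleInt α ρ C x ≤ sampleInt α ρ univ x :=
  lintegral_mono_set (inter_subset_inter_left _ (subset_univ _))

lemma multiCoeff_pos {𝕏 : Type*} (m : ℕ) (D : Finset 𝕏) (l : 𝕏 → ℕ) : 0 < multiCoeff m D l := by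
  have h : 0 < ∏ y ∈ D, ((l y)! : ℝ) := Finset.prod_pos fun y _ => by positivity
  rw [multiCoeff]
  positivity

variable [IsSFiniteKernel ρ] [IsProbabilityMeasure Pr]

lemma V_eq (hρ : IsLevyKernel α ρ) (hN : IsPoissonRandomMeasure N (levyIntensity α ρ) Pr)
    {A : Set 𝕏} (hA : MeasurableSet A) (k : ℕ) {u : ℝ} (hu : 0 < u) :
    V α ρ A k u = lmom (massLaw N Pr A) k u / lmom (massLaw N Pr A) 0 u := by
  rw [← exp_neg_psi_mul_V hρ hN hA k hu, lmom_massLaw_zero hρ hN hA hu,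
    mul_div_cancel_left₀ _ (Real.exp_ne_zero _)]

lemma V_nonneg (hρ : IsLevyKernel α ρ) (hN : IsPoissonRandomMeasure N (levyIntensity α ρ) Pr)
    {A : Set 𝕏} (hA : MeasurableSet A) (k : ℕ) {u : ℝ} (hu : 0 < u) : 0 ≤ V α ρ A k u := by
  rw [V_eq hρ hN hA k hu]
  exact div_nonneg (lmom_massLaw_nonneg hN.measurable hA _ _)
    (lmom_massLaw_nonneg hN.measurable hA _ _)

lemma momentIntegrand_nonneg (hρ : IsLevyKernel α ρ)
    (hN : IsPoissonRandomMeasure N (levyIntensity α ρ) Pr) (x : Fin n → 𝕏) {A : Set 𝕏}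
    (hA : MeasurableSet A) (m : ℕ) (l : 𝕏 → ℕ) {u : ℝ} (hu : 0 < u) :
    0 ≤ momentIntegrand α ρ x A m l u := by
  have hw : ∀ v ∈ Ioi (0 : ℝ), 0 ≤ latentWeight α ρ x v := fun v hv =>
    mul_nonneg (mul_nonneg (pow_nonneg (le_of_lt hv) _) (Real.exp_nonneg _))
      (Finset.prod_nonneg fun y _ => hρ.tau_nonneg _ _ _)
  have hd : 0 ≤ latentDensity α ρ x u :=
    div_nonneg (hw u hu) (setIntegral_nonneg measurableSet_Ioi hw)
  refine mul_nonneg (mul_nonneg (mul_nonneg (by positivity) hd) (V_nonneg hρ hN hA _ hu)) ?_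
  refine Finset.prod_nonneg fun y _ => mul_nonneg (div_nonneg (hρ.tau_nonneg _ _ _)
    (hρ.tau_nonneg _ _ _)) (pow_nonneg (indicator_nonneg (fun _ _ => zero_le_one) _) _)

variable [MeasurableEq 𝕏]

section Partition

variable {ι : Type*} [Fintype ι] {A : ι → Set 𝕏}

lemma integrableOn_postProd (hρ : IsLevyKernel α ρ)
    (hN : IsPoissonRandomMeasure N (levyIntensity α ρ) Pr) (hA : ∀ i, MeasurableSet (A i))
    (m : ι → ℕ) (hn : 1 ≤ n) (x : Fin n → 𝕏) {C : Set ℝ} (hC : MeasurableSet C)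
    (h : postInt N Pr ρ A m C x ≠ ∞) :
    IntegrableOn (fun u => u ^ (n + ∑ i, m i - 1) * postProd N Pr ρ A m x u) (C ∩ Ioi 0) ∧
      ∫ u in C ∩ Ioi 0, u ^ (n + ∑ i, m i - 1) * postProd N Pr ρ A m x u
        = Real.Gamma (n + ∑ i, m i : ℕ) * (postInt N Pr ρ A m C x).toReal := by
  have hG : 0 < Real.Gamma (n + ∑ i, m i : ℕ) := Real.Gamma_pos_of_pos (by
    exact_mod_cast (by omega))
  set f : ℝ → ℝ := fun u => u ^ (n + ∑ i, m i - 1) / Real.Gamma (n + ∑ i, m i : ℕ)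
    * postProd N Pr ρ A m x u with hf
  have hfm : Measurable f := by
    have h0 := measurable_postProd (N := N) (Pr := Pr) (ρ := ρ) hA m n
    have h1 : Measurable fun u => postProd N Pr ρ A m x u :=
      h0.comp (g := fun p : (Fin n → 𝕏) × ℝ => postProd N Pr ρ A m p.1 p.2)
        (f := fun u : ℝ => (x, u)) measurable_prodMk_left
    have h2 : Measurable fun u : ℝ => u ^ (n + ∑ i, m i - 1) / Real.Gamma (n + ∑ i, m i : ℕ) := by
      fun_prop
    exact h2.mul h1
  have hf0 : 0 ≤ᵐ[volume.restrict (C ∩ Ioi 0)] f := by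
    refine (ae_restrict_iff' (hC.inter measurableSet_Ioi)).2 (ae_of_all _ fun u hu => ?_)
    have hu : 0 < u := hu.2
    exact mul_nonneg (by positivity) (postProd_nonneg hρ hN.measurable hA m x u)
  have hfl : ∫⁻ u in C ∩ Ioi 0, ENNReal.ofReal (f u) = postInt N Pr ρ A m C x := by
    refine setLIntegral_congr_fun (hC.inter measurableSet_Ioi) fun u hu => ?_
    have hu : 0 < u := hu.2
    exact ENNReal.ofReal_mul (by positivity)
  have hfi : IntegrableOn f (C ∩ Ioi 0) := by
    refine ⟨hfm.aestronglyMeasurable, ?_⟩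
    rw [hasFiniteIntegral_iff_ofReal hf0, hfl]
    exact h.lt_top
  have he : (fun u => u ^ (n + ∑ i, m i - 1) * postProd N Pr ρ A m x u)
      = fun u => Real.Gamma (n + ∑ i, m i : ℕ) * f u := by
    funext u
    rw [hf]
    field_simp
  rw [he]
  refine ⟨hfi.const_mul _, ?_⟩
  rw [integral_const_mul, integral_eq_lintegral_of_nonneg_ae hf0 hfm.aestronglyMeasurable, hfl]

end Partition

lemma integrableOn_latentWeight (hρ : IsLevyKernel α ρ)
    (hN : IsPoissonRandomMeasure N (levyIntensity α ρ) Pr) (hn : 1 ≤ n) (x : Fin n → 𝕏)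
    {C : Set ℝ} (hC : MeasurableSet C) (h : sampleInt α ρ C x ≠ ∞) :
    IntegrableOn (latentWeight α ρ x) (C ∩ Ioi 0) ∧
      ∫ u in C ∩ Ioi 0, latentWeight α ρ x u
        = Real.Gamma n * (sampleInt α ρ C x).toReal := by
  have hd : Pairwise fun i j : Unit => Disjoint (univ : Set 𝕏) univ :=
    fun i j h => absurd (Subsingleton.elim i j) h
  have hA : ∀ i : Unit, MeasurableSet (univ : Set 𝕏) := fun _ => MeasurableSet.univ
  have h1 := postInt_zero hρ hN hA hd (iUnion_const univ) hC x
  have h2 := integrableOn_postProd hρ hN hA 0 hn x hC (by rwa [h1])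
  have he : EqOn (fun u => u ^ (n + ∑ i : Unit, (0 : Unit → ℕ) i - 1)
      * postProd N Pr ρ (fun _ : Unit => univ) 0 x u) (latentWeight α ρ x) (C ∩ Ioi 0) := by
    intro u hu
    have h3 := postProd_zero hρ hN hA hd (iUnion_const univ) x hu.2
    simp only [h3, latentWeight_eq, Pi.zero_apply, Finset.sum_const_zero, add_zero]
  rw [h1, setIntegral_congr_fun (hC.inter measurableSet_Ioi) he] at h2
  refine ⟨(integrableOn_congr_fun he (hC.inter measurableSet_Ioi)).1 h2.1, ?_⟩
  simpa using h2.2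

lemma setIntegral_latentDensity (hρ : IsLevyKernel α ρ)
    (hN : IsPoissonRandomMeasure N (levyIntensity α ρ) Pr) (hn : 1 ≤ n) (x : Fin n → 𝕏)
    {C : Set ℝ} (hC : MeasurableSet C) (h : sampleInt α ρ univ x ≠ ∞) :
    ∫ u in C ∩ Ioi 0, latentDensity α ρ x u
      = (sampleInt α ρ C x).toReal / (sampleInt α ρ univ x).toReal := by
  have h1 := (integrableOn_latentWeight hρ hN hn x MeasurableSet.univ h).2
  have h2 := (integrableOn_latentWeight hρ hN hn x hC
    (ne_top_of_le_ne_top h (sampleInt_mono x C))).2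
  rw [univ_inter] at h1
  have hG : Real.Gamma n ≠ 0 := (Real.Gamma_pos_of_pos (by exact_mod_cast hn)).ne'
  simp only [latentDensity]
  rw [integral_div, h1, h2, mul_div_mul_left _ _ hG]

/-- The partition that consists of the sets `A i` and of the complement of their union. -/
def withCompl {q : ℕ} (A : Fin q → Set 𝕏) : Option (Fin q) → Set 𝕏 :=
  fun o => o.elim (⋃ i, A i)ᶜ A

/-- The exponents of `withCompl`. -/
def withZero {q : ℕ} (m : Fin q → ℕ) : Option (Fin q) → ℕ := fun o => o.elim 0 m

section WithCompl

variable {𝕏 : Type*} {q : ℕ} {A : Fin q → Set 𝕏}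

lemma measurableSet_withCompl [MeasurableSpace 𝕏] (hA : ∀ i, MeasurableSet (A i)) :
    ∀ o, MeasurableSet (withCompl A o)
  | none => (MeasurableSet.iUnion hA).compl
  | some i => hA i

lemma disjoint_withCompl (hd : Pairwise fun i j => Disjoint (A i) (A j)) :
    Pairwise fun o o' => Disjoint (withCompl A o) (withCompl A o') := by
  rintro (_ | i) (_ | j) h
  · exact absurd rfl h
  · exact (disjoint_compl_right_iff_subset.2 (subset_iUnion A j)).symm
  · exact disjoint_compl_right_iff_subset.2 (subset_iUnion A i)
  · exact hd fun hij => h (congrArg some hij)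

lemma iUnion_withCompl : ⋃ o, withCompl A o = univ := by
  rw [iUnion_option]
  exact compl_union_self _

end WithCompl

variable {q : ℕ} {A : Fin q → Set 𝕏}

lemma integrableOn_mixedIntegrand (hρ : IsLevyKernel α ρ)
    (hN : IsPoissonRandomMeasure N (levyIntensity α ρ) Pr) (hn : 1 ≤ n)
    (hA : ∀ i, MeasurableSet (A i)) (hd : Pairwise fun i j => Disjoint (A i) (A j))
    (m : Fin q → ℕ) (x : Fin n → 𝕏) (h : sampleInt α ρ univ x ≠ ∞)
    (hm : postInt N Pr ρ (withCompl A) (withZero m) univ x ≠ ∞) :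
    IntegrableOn (mixedIntegrand α ρ x A m) (Ioi 0) ∧
      Real.Gamma n / Real.Gamma ((∑ i, m i : ℕ) + n) *
          ∫ u in Ioi (0 : ℝ), mixedIntegrand α ρ x A m u
        = (postInt N Pr ρ (withCompl A) (withZero m) univ x).toReal
          / (sampleInt α ρ univ x).toReal := by
  have h1 := (integrableOn_latentWeight hρ hN hn x MeasurableSet.univ h).2
  have h2 := integrableOn_postProd hρ hN (measurableSet_withCompl hA) (withZero m) hn x
    MeasurableSet.univ hm
  have hs : ∑ o, withZero m o = ∑ i, m i := by simp [Fintype.sum_option, withZero]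
  rw [univ_inter] at h1 h2
  rw [hs] at h2
  have he : EqOn (mixedIntegrand α ρ x A m) (fun u => (Real.Gamma n
      * (sampleInt α ρ univ x).toReal)⁻¹ * (u ^ (n + ∑ i, m i - 1)
        * postProd N Pr ρ (withCompl A) (withZero m) x u)) (Ioi 0) := by
    intro u hu
    have hp : n + ∑ i, m i - 1 = ∑ i, m i + (n - 1) := by omega
    simp only [mixedIntegrand, latentDensity, h1]
    rw [latentWeight_eq]
    rw [postProd_eq hρ hN (measurableSet_withCompl hA) (disjoint_withCompl hd) iUnion_withCompl
      _ x hu, Fintype.prod_option, hp, pow_add]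
    simp only [withCompl, withZero, Option.elim]
    ring
  rw [setIntegral_congr_fun measurableSet_Ioi he, integral_const_mul, h2.2]
  refine ⟨(integrableOn_congr_fun he measurableSet_Ioi).2 (h2.1.const_mul _), ?_⟩
  have hG : Real.Gamma n ≠ 0 := (Real.Gamma_pos_of_pos (by exact_mod_cast hn)).ne'
  have hG' : Real.Gamma (n + ∑ i, m i : ℕ) ≠ 0 := (Real.Gamma_pos_of_pos (by
    exact_mod_cast (by omega))).ne'
  have hc : ((∑ i, m i : ℕ) + n : ℝ) = (n + ∑ i, m i : ℕ) := by push_cast; ring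
  rw [hc]
  field_simp

lemma aestronglyMeasurable_momentIntegrand (hρ : IsLevyKernel α ρ)
    (hN : IsPoissonRandomMeasure N (levyIntensity α ρ) Pr) (hn : 1 ≤ n) (x : Fin n → 𝕏)
    {A : Set 𝕏} (hA : MeasurableSet A) (m : ℕ) (l : 𝕏 → ℕ) (h : sampleInt α ρ univ x ≠ ∞) :
    AEStronglyMeasurable (momentIntegrand α ρ x A m l) (volume.restrict (Ioi 0)) := by
  have h1 := (integrableOn_latentWeight hρ hN hn x MeasurableSet.univ h).1
  rw [univ_inter] at h1
  have h2 : ∀ k, AEStronglyMeasurable (V α ρ A k) (volume.restrict (Ioi 0)) := by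
    intro k
    have h3 : Measurable fun u => lmom (massLaw N Pr A) k u / lmom (massLaw N Pr A) 0 u :=
      (measurable_lmom _ k).div (measurable_lmom _ 0)
    refine h3.aestronglyMeasurable.congr ((ae_restrict_iff' measurableSet_Ioi).2
      (ae_of_all _ fun u hu => (V_eq hρ hN hA k hu).symm))
  have h3 : ∀ k y, Measurable fun u => tau ρ k u y := fun k y =>
    (measurable_tau ρ k).comp (measurable_id.prodMk measurable_const)
  have h4 : Measurable fun u => ∏ y ∈ distinct x, tau ρ (mult x y + l y) u y
      / tau ρ (mult x y) u y * A.indicator (fun _ => (1 : ℝ)) y ^ l y :=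
    Finset.measurable_prod _ fun y _ => ((h3 _ y).div (h3 _ y)).mul measurable_const
  have h5 : AEStronglyMeasurable (latentDensity α ρ x) (volume.restrict (Ioi 0)) :=
    (h1.div_const _).aestronglyMeasurable
  exact (((continuous_pow m).aestronglyMeasurable.mul h5).mul (h2 _)).mul
    h4.aestronglyMeasurable

lemma integrableOn_momentIntegrand (hρ : IsLevyKernel α ρ)
    (hN : IsPoissonRandomMeasure N (levyIntensity α ρ) Pr) (hn : 1 ≤ n) {A : Set 𝕏}
    (hA : MeasurableSet A) (m : ℕ) (x : Fin n → 𝕏) (h : sampleInt α ρ univ x ≠ ∞)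
    (hi : IntegrableOn (mixedIntegrand α ρ x (fun _ : Fin 1 => A) (fun _ => m)) (Ioi 0)) :
    (∀ l ∈ multiIndices m (distinct x),
      IntegrableOn (momentIntegrand α ρ x A m l) (Ioi 0)) ∧
    ∑ l ∈ multiIndices m (distinct x), multiCoeff m (distinct x) l
        * ∫ u in Ioi (0 : ℝ), momentIntegrand α ρ x A m l u
      = ∫ u in Ioi (0 : ℝ), mixedIntegrand α ρ x (fun _ : Fin 1 => A) (fun _ => m) u := by
  have he : EqOn (mixedIntegrand α ρ x (fun _ : Fin 1 => A) (fun _ => m))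
      (fun u => ∑ l ∈ multiIndices m (distinct x), multiCoeff m (distinct x) l
        * momentIntegrand α ρ x A m l u) (Ioi 0) := by
    intro u hu
    simp [mixedIntegrand, sum_multiCoeff_mul_momentIntegrand hρ x A m hu,
      mixedFactor_zero hρ x _ hu]
  have hint : ∀ l ∈ multiIndices m (distinct x),
      IntegrableOn (momentIntegrand α ρ x A m l) (Ioi 0) := by
    intro l hl
    refine Integrable.mono' (hi.const_mul (multiCoeff m (distinct x) l)⁻¹)
      (aestronglyMeasurable_momentIntegrand hρ hN hn x hA m l h)
      ((ae_restrict_iff' measurableSet_Ioi).2 (ae_of_all _ fun u hu => ?_))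
    rw [Real.norm_of_nonneg (momentIntegrand_nonneg hρ hN x hA m l hu), he hu,
      le_inv_mul_iff₀ (multiCoeff_pos _ _ _)]
    exact Finset.single_le_sum (f := fun l => multiCoeff m (distinct x) l
      * momentIntegrand α ρ x A m l u) (fun l _ => mul_nonneg (multiCoeff_pos _ _ _).le
        (momentIntegrand_nonneg hρ hN x hA m l hu)) hl
  refine ⟨hint, ?_⟩
  rw [setIntegral_congr_fun measurableSet_Ioi he, integral_finsetSum _ fun l hl =>
    (hint l hl).const_mul _]
  simp_rw [integral_const_mul]

end Integrals

section PosteriorMoments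

variable {Ω 𝕏 : Type*} [MeasurableSpace Ω] [MeasurableSpace 𝕏] {Pr : Measure Ω}
  {α : Measure 𝕏} {ρ : Kernel 𝕏 ℝ} {N : Ω → Measure (ℝ × 𝕏)} {n : ℕ} {X : Fin n → Ω → 𝕏}
  [IsSFiniteKernel ρ] [IsProbabilityMeasure Pr] [MeasurableEq 𝕏] [NullSingletonClass α]
  [IsFiniteMeasure α]

lemma ae_sampleInt_ne (hρ : IsLevyKernel α ρ) (hα : α ≠ 0)
    (hN : IsPoissonRandomMeasure N (levyIntensity α ρ) Pr) (hn : 1 ≤ n)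
    (hX : IsSample X (nrmi N) Pr) :
    ∀ᵐ ω ∂Pr, sampleInt α ρ univ (fun i => X i ω) ≠ 0 ∧
      sampleInt α ρ univ (fun i => X i ω) ≠ ∞ :=
  ae_density_ne (measurable_pi_lambda _ hX.measurable)
    (measurable_sampleInt hρ hN MeasurableSet.univ n) (map_sample hρ hα hN hn hX)

lemma ae_integrableOn_latentWeight (hρ : IsLevyKernel α ρ) (hα : α ≠ 0)
    (hN : IsPoissonRandomMeasure N (levyIntensity α ρ) Pr) (hn : 1 ≤ n)
    (hX : IsSample X (nrmi N) Pr) :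
    ∀ᵐ ω ∂Pr, IntegrableOn (latentWeight α ρ (fun i => X i ω)) (Ioi 0) ∧
      0 < ∫ v in Ioi (0 : ℝ), latentWeight α ρ (fun i => X i ω) v := by
  filter_upwards [ae_sampleInt_ne hρ hα hN hn hX] with ω hω
  have h := integrableOn_latentWeight hρ hN hn (fun i => X i ω) MeasurableSet.univ hω.2
  rw [univ_inter] at h
  rw [h.2]
  exact ⟨h.1, mul_pos (Real.Gamma_pos_of_pos (by exact_mod_cast hn))
    (ENNReal.toReal_pos hω.1 hω.2)⟩

lemma condExp_latent (hρ : IsLevyKernel α ρ) (hα : α ≠ 0)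
    (hN : IsPoissonRandomMeasure N (levyIntensity α ρ) Pr) (hn : 1 ≤ n)
    (hX : IsSample X (nrmi N) Pr) {U : Ω → ℝ} (hU : IsLatent U X N Pr) {C : Set ℝ}
    (hC : MeasurableSet C) :
    Pr[(U ⁻¹' C).indicator (fun _ => (1 : ℝ)) | sampleSigma X]
      =ᵐ[Pr] fun ω => ∫ u in C ∩ Ioi 0, latentDensity α ρ (fun i => X i ω) u := by
  have hL := isFiniteMeasure_refMeasure α n
  have hUC := hU.measurable hC
  have h := (condExp_toReal_of_density (measurable_pi_lambda _ hX.measurable)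
    (measurable_sampleInt hρ hN MeasurableSet.univ n) (measurable_sampleInt hρ hN hC n)
    (map_sample hρ hα hN hn hX) (Z := (U ⁻¹' C).indicator 1) (measurable_one.indicator hUC)
    (by rw [lintegral_indicator_one hUC]; exact measure_ne_top _ _)
    (map_withDensity_latent hρ hα hN hn hX.measurable hU hC)).2
  have he : (fun ω => ((U ⁻¹' C).indicator (1 : Ω → ℝ≥0∞) ω).toReal)
      = (U ⁻¹' C).indicator (fun _ => (1 : ℝ)) := by
    funext ω
    by_cases hω : ω ∈ U ⁻¹' C <;> simp [hω]
  rw [he] at h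
  refine h.trans ?_
  filter_upwards [ae_sampleInt_ne hρ hα hN hn hX] with ω hω
  rw [setIntegral_latentDensity hρ hN hn _ hC hω.2]

lemma condExp_mixed (hρ : IsLevyKernel α ρ) (hα : α ≠ 0)
    (hN : IsPoissonRandomMeasure N (levyIntensity α ρ) Pr) (hn : 1 ≤ n)
    (hX : IsSample X (nrmi N) Pr) {q : ℕ} {A : Fin q → Set 𝕏} (m : Fin q → ℕ)
    (hA : ∀ i, MeasurableSet (A i)) (hd : Pairwise fun i j => Disjoint (A i) (A j)) :
    (∀ᵐ ω ∂Pr, IntegrableOn (mixedIntegrand α ρ (fun i => X i ω) A m) (Ioi 0)) ∧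
    Pr[fun ω => ∏ i, (nrmi N ω (A i)).toReal ^ m i | sampleSigma X]
      =ᵐ[Pr] fun ω => Real.Gamma n / Real.Gamma ((∑ i, m i : ℕ) + n) *
        ∫ u in Ioi (0 : ℝ), mixedIntegrand α ρ (fun i => X i ω) A m u := by
  have hL := isFiniteMeasure_refMeasure α n
  have hA' := measurableSet_withCompl hA
  have hZ : Measurable fun ω => ∏ o, nrmi N ω (withCompl A o) ^ withZero m o :=
    Finset.measurable_prod _ fun o _ =>
      ((Measure.measurable_coe (hA' o)).comp (measurable_nrmi hN.measurable)).pow_const _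
  have hZ1 : ∫⁻ ω, ∏ o, nrmi N ω (withCompl A o) ^ withZero m o ∂Pr ≠ ∞ := by
    refine ne_top_of_le_ne_top ENNReal.one_ne_top ?_
    calc ∫⁻ ω, ∏ o, nrmi N ω (withCompl A o) ^ withZero m o ∂Pr ≤ ∫⁻ _, 1 ∂Pr :=
          lintegral_mono fun ω => Finset.prod_le_one' fun o _ => pow_le_one' (nrmi_le_one N ω _) _
      _ = 1 := by simp
  obtain ⟨h1, h2⟩ := condExp_toReal_of_density (measurable_pi_lambda _ hX.measurable)
    (measurable_sampleInt hρ hN MeasurableSet.univ n) (measurable_postInt hA' (withZero m) univ n)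
    (map_sample hρ hα hN hn hX) hZ hZ1
    (map_withDensity_prod_nrmi hρ hα hN hn hX hA' (disjoint_withCompl hd) iUnion_withCompl
      (withZero m))
  have he : (fun ω => (∏ o, nrmi N ω (withCompl A o) ^ withZero m o).toReal)
      = fun ω => ∏ i, (nrmi N ω (A i)).toReal ^ m i := by
    funext ω
    simp [ENNReal.toReal_prod, ENNReal.toReal_pow, Fintype.prod_option, withCompl, withZero]
  rw [he] at h2
  have h3 : ∀ᵐ ω ∂Pr, sampleInt α ρ univ (fun i => X i ω) ≠ ∞ ∧
      postInt N Pr ρ (withCompl A) (withZero m) univ (fun i => X i ω) ≠ ∞ := by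
    filter_upwards [ae_sampleInt_ne hρ hα hN hn hX, h1] with ω hω hω'
    exact ⟨hω.2, hω'⟩
  refine ⟨?_, h2.trans ?_⟩
  · filter_upwards [h3] with ω hω
    exact (integrableOn_mixedIntegrand hρ hN hn hA hd m _ hω.1 hω.2).1
  · filter_upwards [h3] with ω hω
    exact (integrableOn_mixedIntegrand hρ hN hn hA hd m _ hω.1 hω.2).2.symm

lemma condExp_moment (hρ : IsLevyKernel α ρ) (hα : α ≠ 0)
    (hN : IsPoissonRandomMeasure N (levyIntensity α ρ) Pr) (hn : 1 ≤ n)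
    (hX : IsSample X (nrmi N) Pr) {A : Set 𝕏} (m : ℕ) (hA : MeasurableSet A) :
    (∀ᵐ ω ∂Pr, ∀ l ∈ multiIndices m (distinct (fun i => X i ω)),
      IntegrableOn (momentIntegrand α ρ (fun i => X i ω) A m l) (Ioi 0)) ∧
    Pr[fun ω => (nrmi N ω A).toReal ^ m | sampleSigma X]
      =ᵐ[Pr] fun ω => Real.Gamma n / Real.Gamma (m + n) *
        ∑ l ∈ multiIndices m (distinct (fun i => X i ω)),
          multiCoeff m (distinct (fun i => X i ω)) l *
            ∫ u in Ioi (0 : ℝ), momentIntegrand α ρ (fun i => X i ω) A m l u := by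
  obtain ⟨h1, h2⟩ := condExp_mixed hρ hα hN hn hX (A := fun _ : Fin 1 => A) (fun _ => m)
    (fun _ => hA) fun i j h => absurd (Subsingleton.elim i j) h
  have h3 : ∀ᵐ ω ∂Pr, sampleInt α ρ univ (fun i => X i ω) ≠ ∞ ∧
      IntegrableOn (mixedIntegrand α ρ (fun i => X i ω) (fun _ : Fin 1 => A) fun _ => m)
        (Ioi 0) := by
    filter_upwards [ae_sampleInt_ne hρ hα hN hn hX, h1] with ω hω hω'
    exact ⟨hω.2, hω'⟩
  simp only [Fin.prod_univ_one, Fin.sum_univ_one] at h2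
  refine ⟨?_, h2.trans ?_⟩
  · filter_upwards [h3] with ω hω
    exact (integrableOn_momentIntegrand hρ hN hn hA m _ hω.1 hω.2).1
  · filter_upwards [h3] with ω hω
    rw [(integrableOn_momentIntegrand hρ hN hn hA m _ hω.1 hω.2).2]

end PosteriorMoments

section Regularization

variable {𝕏 : Type*} [MeasurableSpace 𝕏]

lemma IsLevyMeasure.lintegral_min_ne_zero {L : Measure ℝ} (hL : IsLevyMeasure L)
    (h : L univ ≠ 0) : ∫⁻ s, ENNReal.ofReal (min s 1) ∂L ≠ 0 := by
  intro h0
  rw [lintegral_eq_zero_iff (by fun_prop)] at h0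
  refine h ?_
  have h1 : ∀ᵐ s ∂L, False := by
    filter_upwards [h0, hL.ae_pos] with s hs hs0
    have : 0 < min s 1 := lt_min hs0 one_pos
    simp only [Pi.zero_apply, ENNReal.ofReal_eq_zero] at hs
    linarith
  simpa [ae_iff] using h1

/-- A kernel of Lévy measures is s-finite. -/
lemma isSFiniteKernel_of_isLevyMeasure (ρ : Kernel 𝕏 ℝ) (h : ∀ x, IsLevyMeasure (ρ x))
    (h0 : ∀ x, ρ x univ ≠ 0) : IsSFiniteKernel ρ := by
  set w : ℝ → ℝ≥0∞ := fun s => ENNReal.ofReal (min s 1) with hw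
  have hwm : Measurable w := by fun_prop
  set I : 𝕏 → ℝ≥0∞ := fun x => ∫⁻ s, w s ∂(ρ x) with hI
  have hIm : Measurable I := hwm.lintegral_kernel
  have hI0 : ∀ x, I x ≠ 0 := fun x => (h x).lintegral_min_ne_zero (h0 x)
  have hIt : ∀ x, I x ≠ ∞ := fun x => (h x).int.ne
  let η : Kernel 𝕏 ℝ := ⟨fun x => (I x)⁻¹ • (ρ x).withDensity w, by
    refine Measure.measurable_of_measurable_coe _ fun B hB => ?_
    simp only [Measure.smul_apply, smul_eq_mul, withDensity_apply _ hB,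
      ← lintegral_indicator hB]
    exact hIm.inv.mul (hwm.indicator hB).lintegral_kernel⟩
  have hη : ∀ x, η x = (I x)⁻¹ • (ρ x).withDensity w := fun x => rfl
  have hfin : IsFiniteKernel η := by
    refine ⟨1, ENNReal.one_lt_top, fun x => ?_⟩
    rw [hη, Measure.smul_apply, smul_eq_mul, withDensity_apply _ MeasurableSet.univ,
      Measure.restrict_univ]
    exact ENNReal.inv_mul_le_one _
  set f : 𝕏 → ℝ → ℝ≥0∞ := fun x s => I x * (Ioi (0 : ℝ)).indicator (fun s => (w s)⁻¹) s with hf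
  have hgm : Measurable ((Ioi (0 : ℝ)).indicator fun s => (w s)⁻¹) :=
    hwm.inv.indicator measurableSet_Ioi
  have hfm : Measurable (Function.uncurry f) :=
    (hIm.comp measurable_fst).mul (hgm.comp measurable_snd)
  have hw0 : ∀ {s : ℝ}, 0 < s → w s ≠ 0 := fun hs => by
    simpa [hw] using hs
  have hft : ∀ x s, f x s ≠ ∞ := by
    intro x s
    refine ENNReal.mul_ne_top (hIt x) ?_
    by_cases hs : s ∈ Ioi (0 : ℝ)
    · rw [indicator_of_mem hs]
      exact ENNReal.inv_ne_top.2 (hw0 hs)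
    · rw [indicator_of_notMem hs]
      exact ENNReal.zero_ne_top
  have hρ : ρ = η.withDensity f := by
    ext1 x
    rw [Kernel.withDensity_apply _ hfm, hη, withDensity_smul_measure,
      ← withDensity_mul _ hwm (hgm.const_mul (I x))]
    have he : w * f x =ᵐ[ρ x] fun _ => I x := by
      filter_upwards [(h x).ae_pos] with s hs
      have hwt : w s ≠ ∞ := ENNReal.ofReal_ne_top
      simp only [Pi.mul_apply, hf, indicator_of_mem (show s ∈ Ioi (0 : ℝ) from hs)]
      rw [mul_left_comm, ENNReal.mul_inv_cancel (hw0 hs) hwt, mul_one]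
    rw [withDensity_congr_ae he, withDensity_const, smul_smul,
      ENNReal.inv_mul_cancel (hI0 x) (hIt x), one_smul]
  rw [hρ]
  exact Kernel.IsSFiniteKernel.withDensity η hft

/-- A kernel that satisfies the integrability condition agrees almost everywhere with a kernel of
Lévy measures. -/
lemma exists_isLevyKernel {α : Measure 𝕏} (hα : α ≠ 0) (ρ : Kernel 𝕏 ℝ)
    (hpos : ∀ x, ρ x (Iic 0) = 0) (htop : ∀ x, ρ x univ = ∞)
    (hint : ∫⁻ x, ∫⁻ s, ENNReal.ofReal (min s 1) ∂(ρ x) ∂α < ∞) :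
    ∃ (ρ' : Kernel 𝕏 ℝ) (S : Set 𝕏), IsSFiniteKernel ρ' ∧ IsLevyKernel α ρ' ∧ MeasurableSet S ∧
      α Sᶜ = 0 ∧ ∀ x ∈ S, ρ x = ρ' x := by
  classical
  have hm : Measurable fun x => ∫⁻ s, ENNReal.ofReal (min s 1) ∂(ρ x) :=
    Measurable.lintegral_kernel (by fun_prop)
  set S : Set 𝕏 := {x | ∫⁻ s, ENNReal.ofReal (min s 1) ∂(ρ x) < ∞}
  have hS : MeasurableSet S := measurableSet_lt hm measurable_const
  have hae : ∀ᵐ x ∂α, x ∈ S := ae_lt_top hm hint.ne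
  have hSc : α Sᶜ = 0 := hae
  obtain ⟨x₀, hx₀⟩ : S.Nonempty := by
    rw [nonempty_iff_ne_empty]
    intro h
    rw [h, compl_empty, Measure.measure_univ_eq_zero] at hSc
    exact hα hSc
  set ρ' : Kernel 𝕏 ℝ := Kernel.piecewise hS ρ (Kernel.const 𝕏 (ρ x₀))
  have h1 : ∀ x ∈ S, ρ x = ρ' x := fun x hx => by rw [Kernel.piecewise_apply, if_pos hx]
  have h2 : ∀ x, ∃ y ∈ S, ρ' x = ρ y := by
    intro x
    by_cases hx : x ∈ S
    · exact ⟨x, hx, (h1 x hx).symm⟩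
    · exact ⟨x₀, hx₀, by rw [Kernel.piecewise_apply, if_neg hx, Kernel.const_apply]⟩
  have h3 : ∀ x, IsLevyMeasure (ρ' x) := by
    intro x
    obtain ⟨y, hy, h⟩ := h2 x
    rw [h]
    exact ⟨hpos y, hy⟩
  have h4 : ∀ x, ρ' x univ = ∞ := by
    intro x
    obtain ⟨y, -, h⟩ := h2 x
    rw [h, htop]
  refine ⟨ρ', S, isSFiniteKernel_of_isLevyMeasure ρ' h3 fun x => by simp [h4 x],
    ⟨h3, h4, ?_⟩, hS, hSc, h1⟩
  refine lt_of_eq_of_lt (lintegral_congr_ae ?_) hint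
  filter_upwards [hae] with x hx
  rw [h1 x hx]

lemma levyIntensity_congr {α : Measure 𝕏} {ρ ρ' : Kernel 𝕏 ℝ} (h : ∀ᵐ x ∂α, ρ x = ρ' x) :
    levyIntensity α ρ = levyIntensity α ρ' := by
  refine Measure.bind_congr_right ?_
  filter_upwards [h] with x hx
  rw [hx]

section Congr

variable {α : Measure 𝕏} {ρ ρ' : Kernel 𝕏 ℝ}

lemma V_congr (h : levyIntensity α ρ = levyIntensity α ρ') : V α ρ = V α ρ' := by
  funext A k u
  simp only [V, psi, h]

variable {n : ℕ} {x : Fin n → 𝕏}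

lemma tau_congr (hx : ∀ i, ρ (x i) = ρ' (x i)) {y : 𝕏} (hy : y ∈ distinct x) (k : ℕ) (u : ℝ) :
    tau ρ k u y = tau ρ' k u y := by
  classical
  obtain ⟨i, -, rfl⟩ := Finset.mem_image.1 hy
  rw [tau, tau, hx i]

lemma latentWeight_congr (h : levyIntensity α ρ = levyIntensity α ρ')
    (hx : ∀ i, ρ (x i) = ρ' (x i)) : latentWeight α ρ x = latentWeight α ρ' x := by
  funext u
  simp only [latentWeight, psi, h]
  rw [Finset.prod_congr rfl fun y hy => tau_congr hx hy _ u]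

lemma latentDensity_congr (h : levyIntensity α ρ = levyIntensity α ρ')
    (hx : ∀ i, ρ (x i) = ρ' (x i)) : latentDensity α ρ x = latentDensity α ρ' x := by
  funext u
  simp only [latentDensity, latentWeight_congr h hx]

lemma momentIntegrand_congr (h : levyIntensity α ρ = levyIntensity α ρ')
    (hx : ∀ i, ρ (x i) = ρ' (x i)) (A : Set 𝕏) (m : ℕ) (l : 𝕏 → ℕ) :
    momentIntegrand α ρ x A m l = momentIntegrand α ρ' x A m l := by
  funext u
  simp only [momentIntegrand, latentDensity_congr h hx, V_congr h]
  congr 1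
  refine Finset.prod_congr rfl fun y hy => ?_
  rw [tau_congr hx hy, tau_congr hx hy]

lemma mixedFactor_congr (h : levyIntensity α ρ = levyIntensity α ρ')
    (hx : ∀ i, ρ (x i) = ρ' (x i)) (A : Set 𝕏) (m : ℕ) :
    mixedFactor α ρ x A m = mixedFactor α ρ' x A m := by
  funext u
  simp only [mixedFactor, V_congr h]
  refine Finset.sum_congr rfl fun l _ => ?_
  congr 1
  refine Finset.prod_congr rfl fun y hy => ?_
  have hy' := (mem_distinctIn.1 hy).1
  rw [tau_congr hx hy', tau_congr hx hy']

lemma mixedIntegrand_congr (h : levyIntensity α ρ = levyIntensity α ρ')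
    (hx : ∀ i, ρ (x i) = ρ' (x i)) {q : ℕ} (A : Fin q → Set 𝕏) (m : Fin q → ℕ) :
    mixedIntegrand α ρ x A m = mixedIntegrand α ρ' x A m := by
  funext u
  simp only [mixedIntegrand, latentDensity_congr h hx, mixedFactor_congr h hx]

end Congr

variable {Ω : Type*} [MeasurableSpace Ω] {Pr : Measure Ω} {α : Measure 𝕏} {ρ : Kernel 𝕏 ℝ}
  {N : Ω → Measure (ℝ × 𝕏)} {n : ℕ} {X : Fin n → Ω → 𝕏} [IsSFiniteKernel ρ]
  [IsProbabilityMeasure Pr]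

lemma ae_nrmi_eq_zero (hN : IsPoissonRandomMeasure N (levyIntensity α ρ) Pr) {S : Set 𝕏}
    (hS : MeasurableSet S) (h : α S = 0) : ∀ᵐ ω ∂Pr, nrmi N ω S = 0 := by
  have hB : MeasurableSet ((univ : Set ℝ) ×ˢ S) := MeasurableSet.univ.prod hS
  have h0 : levyIntensity α ρ (univ ×ˢ S) = 0 := by
    rw [← lintegral_indicator_one hB, lintegral_levyIntensity (measurable_one.indicator hB)]
    refine (lintegral_congr_ae ?_).trans lintegral_zero
    filter_upwards [measure_eq_zero_iff_ae_notMem.1 h] with x hx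
    simp [indicator, hx]
  filter_upwards [ae_eq_zero_of_intensity_eq_zero hN hB h0] with ω hω
  rw [nrmi_apply, crm_apply N ω hS, Measure.restrict_eq_zero.2 hω, lintegral_zero_measure, mul_zero]

lemma ae_mem_of_measure_compl_eq_zero (hN : IsPoissonRandomMeasure N (levyIntensity α ρ) Pr)
    (hX : IsSample X (nrmi N) Pr) {S : Set 𝕏} (hS : MeasurableSet S) (h : α Sᶜ = 0) :
    ∀ᵐ ω ∂Pr, ∀ i, X i ω ∈ S := by
  classical
  refine ae_all_iff.2 fun i => ?_
  set B : Fin n → Set 𝕏 := Function.update (fun _ => univ) i Sᶜ with hBdef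
  have hB : ∀ j, MeasurableSet (B j) := by
    intro j
    by_cases hj : j = i
    · subst hj; simpa [hBdef] using hS
    · simp [hBdef, Function.update_of_ne hj]
  have h1 := hX.lintegral_boxInd_mul hN.measurable (ι := Empty) (A := fun e => e.elim)
    (fun e => e.elim) (fun e => e.elim) hB
  have h2 : ∫⁻ ω, boxInd B (fun i => X i ω) ∂Pr = 0 := by
    simp only [Finset.univ_eq_empty, Finset.prod_empty, one_mul] at h1
    rw [h1]
    refine (lintegral_congr_ae ?_).trans lintegral_zero
    filter_upwards [ae_nrmi_eq_zero hN hS.compl h] with ω hω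
    exact Finset.prod_eq_zero (Finset.mem_univ i) (by simpa [hBdef] using hω)
  have hm : Measurable fun ω => boxInd B fun i => X i ω :=
    (measurable_boxInd hB).comp (measurable_pi_lambda _ hX.measurable)
  rw [lintegral_eq_zero_iff hm] at h2
  filter_upwards [h2] with ω hω
  by_contra hi
  have h3 : boxInd B (fun i => X i ω) = 1 := by
    refine Finset.prod_eq_one fun j _ => indicator_of_mem ?_ 1
    by_cases hj : j = i
    · subst hj; simpa [hBdef] using hi
    · simp [hBdef, Function.update_of_ne hj]
  rw [h3] at hω
  exact one_ne_zero hω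

end Regularization

end NRMI

end

open NRMI in
theorem mainTheorem6 {Ω 𝕏 : Type*} [MeasurableSpace Ω]
    [TopologicalSpace 𝕏] [PolishSpace 𝕏] [MeasurableSpace 𝕏] [BorelSpace 𝕏]
    (Pr : Measure Ω) [IsProbabilityMeasure Pr]
    (α : Measure 𝕏) [IsFiniteMeasure α] [NullSingletonClass α] (hα : α ≠ 0)
    (ρ : Kernel 𝕏 ℝ) (hρ_sigma : ∀ x, SigmaFinite (ρ x)) (hρ_pos : ∀ x, ρ x (Iic 0) = 0)
    (hρ_top : ∀ x, ρ x univ = ∞)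
    (hρ_int : ∫⁻ x, ∫⁻ s, ENNReal.ofReal (min s 1) ∂(ρ x) ∂α < ∞)
    (N : Ω → Measure (ℝ × 𝕏)) (hN : IsPoissonRandomMeasure N (levyIntensity α ρ) Pr)
    (n : ℕ) (hn : 1 ≤ n) (X : Fin n → Ω → 𝕏) (hX : IsSample X (nrmi N) Pr) :
    -- the density `f(u | X)` is well defined, and is the conditional density of any latent variable
    ((∀ᵐ ω ∂Pr, IntegrableOn (latentWeight α ρ (fun i => X i ω)) (Ioi 0) ∧
        0 < ∫ v in Ioi (0 : ℝ), latentWeight α ρ (fun i => X i ω) v) ∧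
      ∀ U : Ω → ℝ, IsLatent U X N Pr → ∀ C : Set ℝ, MeasurableSet C →
        Pr[(U ⁻¹' C).indicator (fun _ => (1 : ℝ)) | sampleSigma X]
          =ᵐ[Pr] fun ω => ∫ u in C ∩ Ioi 0, latentDensity α ρ (fun i => X i ω) u) ∧
    -- posterior moments
    (∀ (A : Set 𝕏) (m : ℕ), MeasurableSet A →
      (∀ᵐ ω ∂Pr, ∀ l ∈ multiIndices m (distinct (fun i => X i ω)),
        IntegrableOn (momentIntegrand α ρ (fun i => X i ω) A m l) (Ioi 0)) ∧
      Pr[fun ω => (nrmi N ω A).toReal ^ m | sampleSigma X]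
        =ᵐ[Pr] fun ω => Real.Gamma n / Real.Gamma (m + n) *
          ∑ l ∈ multiIndices m (distinct (fun i => X i ω)),
            multiCoeff m (distinct (fun i => X i ω)) l *
              ∫ u in Ioi (0 : ℝ), momentIntegrand α ρ (fun i => X i ω) A m l u) ∧
    -- mixed posterior moments
    (∀ (q : ℕ) (A : Fin q → Set 𝕏) (m : Fin q → ℕ), (∀ i, MeasurableSet (A i)) →
      Pairwise (fun i j => Disjoint (A i) (A j)) →
      (∀ᵐ ω ∂Pr, IntegrableOn (mixedIntegrand α ρ (fun i => X i ω) A m) (Ioi 0)) ∧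
      Pr[fun ω => ∏ i, (nrmi N ω (A i)).toReal ^ m i | sampleSigma X]
        =ᵐ[Pr] fun ω => Real.Gamma n / Real.Gamma ((∑ i, m i : ℕ) + n) *
          ∫ u in Ioi (0 : ℝ), mixedIntegrand α ρ (fun i => X i ω) A m u) := by
  obtain ⟨ρ', S, hsf, hρ', hS, hSc, hSρ⟩ := exists_isLevyKernel hα ρ hρ_pos hρ_top hρ_int
  have hI : levyIntensity α ρ = levyIntensity α ρ' := levyIntensity_congr (by
    filter_upwards [measure_eq_zero_iff_ae_notMem.1 hSc] with x hx
    exact hSρ x (not_not.1 hx))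
  rw [hI] at hN
  have hXS : ∀ᵐ ω ∂Pr, ∀ i, ρ (X i ω) = ρ' (X i ω) := by
    filter_upwards [ae_mem_of_measure_compl_eq_zero hN hX hS hSc] with ω hω i
    exact hSρ _ (hω i)
  refine ⟨⟨?_, fun U hU C hC => ?_⟩, fun A m hA => ⟨?_, ?_⟩, fun q A m hA hd => ⟨?_, ?_⟩⟩
  · filter_upwards [ae_integrableOn_latentWeight hρ' hα hN hn hX, hXS] with ω h hω
    rwa [latentWeight_congr hI hω]
  · refine (condExp_latent hρ' hα hN hn hX hU hC).trans ?_
    filter_upwards [hXS] with ω hω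
    rw [latentDensity_congr hI hω]
  · filter_upwards [(condExp_moment hρ' hα hN hn hX m hA).1, hXS] with ω h hω l hl
    rw [momentIntegrand_congr hI hω]
    exact h l hl
  · refine (condExp_moment hρ' hα hN hn hX m hA).2.trans ?_
    filter_upwards [hXS] with ω hω
    simp only [momentIntegrand_congr hI hω]
  · filter_upwards [(condExp_mixed hρ' hα hN hn hX m hA hd).1, hXS] with ω h hω
    rwa [mixedIntegrand_congr hI hω]
  · refine (condExp_mixed hρ' hα hN hn hX m hA hd).2.trans ?_
    filter_upwards [hXS] with ω hω
    rw [mixedIntegrand_congr hI hω]
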